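/- **Setting.** Let $I=[l,r]\subset\overline{\mathbb R}$ with $-\infty\le l<0<r\le\infty$; let $\mathbf s$ be a non-constant increasing (not necessarily strictly increasing or left/right continuous) real function on $(l,r)$ with $\mathbf s(0-)=\mathbf s(0)=\mathbf s(0+)=0$, extended by $\mathbf s(l)=\mathbf s(l-):=\lim_{x\downarrow l}\mathbf s(x)$ and $\mathbf s(r)=\mathbf s(r+):=\lim_{x\uparrow r}\mathbf s(x)$ (possibly infinite); let $\mathfrak m$ be a measure on $I$ with $\mathfrak m([a,b])<\infty$ for $[a,b]\subset(l,r)$ and $\mathfrak m(\{0\})=0$ (not necessarily fully supported). Let $U$ be the set of points of $I$ having a neighbourhood in $I$ on which $\mathbf s$ is constant, and $U\setminus\{l,r\}=\bigcup_n(c_n,d_n)$ the decomposition into disjoint open intervals; $D^\pm=\{x\in I:\mathbf s(x)\ne\mathbf s(x\pm)\}$, $D=D^+\cup D^-$, $D^0=D^+\cap D^-$. Call $(c_n,d_n)$ isolated if $c_n,d_n\in D\cup\{l,r\}$. The endpoint $r$ is approachable if $\mathbf s(r)<\infty$, and reflecting if moreover $\mathfrak m((a,r))<\infty$ for some $a<r$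 and $\mathfrak m(\{r\})<\infty$; similarly for $l$. Assume * (DK) if $l$ or $r$ is an endpoint of an isolated interval, it is reflecting; * (DM) $I\setminus U\subset\operatorname{supp}\mathfrak m$; $\mathfrak m(\{x\})>0$ for $x\in D^0$; and for every isolated $(c_n,d_n)$ the interval with endpoints $c_n,d_n$ that contains $c_n$ iff $c_n\notin D^+$ and $d_n$ iff $d_n\notin D^-$ has positive $\mathfrak m$-measure. **The form.** Put $\mu_d^+=\sum_x(\mathbf s(x+)-\mathbf s(x))\delta_x$, $\mu_d^-=\sum_x(\mathbf s(x)-\mathbf s(x-))\delta_x$ (sums over $x\in(l,r)$), and let $\mu_c$ be the Lebesgue–Stieltjes measure of the continuous part $\mathbf s_c(x)=\mathbf s(x)-\mu_d^+((0,x))-\mu_d^-((0,x])$ of $\mathbf s$ on $(l,r)$, where for $x<0$ one reads $\mu((0,x))=-\mu([x,0))$ and $\mu((0,x])=-\mu((x,0))$, and similarly for integrals. Let $\mathscr S$ be the set of functions on $(l,r)$ of the form $$f(x)=c_0+\int_{(0,x)}g^c\,d\mu_c+\int_{(0,x)}g^+\,d\mu_d^++\int_{(0,x]}g^-\,d\mu_d^-,\qquad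 c_0\in\mathbb R,\ g^c\in L^2(\mu_c),\ g^\pm\in L^2(\mu_d^\pm),$$ extended to approachable endpoints by their limits. Let $I_0$ be $I$ without its non-reflecting endpoints, and let $$\mathscr F=\{f\in\mathscr S\cap L^2(I_0,\mathfrak m): f(j)=0\text{ if }j\in\{l,r\}\setminus I_0\text{ is approachable}\},$$ $$\mathscr E(f,\tilde f)=\tfrac12\Big(\int g^c\tilde g^c\,d\mu_c+\int g^+\tilde g^+\,d\mu_d^++\int g^-\tilde g^-\,d\mu_d^-\Big),\qquad f,\tilde f\in\mathscr F.$$ **Regularization.** Let $\bar I^{d}$ be the completion of $I$ for the metric $d(x,y)=|\arctan x-\arctan y|+|\arctan\mathbf s(x)-\arctan\mathbf s(y)|$ (scale completion), and $\bar I^{d,*}$ the quotient space obtained by collapsing the closure in $\bar I^d$ of each $(c_n,d_n)$ to a point (darning). Let $\mathbf s^*:\bar I^{d,*}\to\overline{\mathbb R}$ be the map induced by the continuous extension of $\mathbf s$ to $\bar I^d$, and put $\widehat l=\mathbf s(l)$, $\widehat r=\mathbf s(r)$. Let $I^*$ be $\bar I^{d,*}$ without the point $\mathbf s^{*-1}(\widehat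 l)$ if $l$ is not reflecting and without the point $\mathbf s^{*-1}(\widehat r)$ if $r$ is not reflecting. Let $\widehat I=\mathbf s^*(I^*)\subset\mathbb R$, let $\widehat{\mathfrak m}=\mathfrak m\circ\mathbf s^{-1}$ on $\widehat I$ and $\mathfrak m^*=\widehat{\mathfrak m}\circ\mathbf s^*$ on $I^*$. For $f\in\mathscr S$ let $\widehat f$ be the continuous function on $\widehat I$ with $\widehat f(\mathbf s(x))=f(x)$ for $x\in I_0$ with $\mathbf s(x)\in\widehat I$, and $\widehat f(\mathbf s(x\pm))=f(x\pm)$ for $x\in D^\pm$ (it has finite limits at finite endpoints $\widehat l,\widehat r\notin\widehat I$), and let $f^*=\widehat f\circ\mathbf s^*$ on $I^*$. Put $\widehat{\mathscr S}=\{\widehat f:f\in\mathscr S\}$, $\widehat{\mathscr F}=\{\widehat f:f\in\mathscr F\}$, $\widehat{\mathscr E}(\widehat f,\widehat g)=\mathscr E(f,g)$, and $\mathscr F^*=\{f^*:f\in\mathscr F\}$, $\mathscr E^*(f^*,g^*)=\mathscr E(f,g)$. Write the open set $(\widehat l,\widehat r)\setminus\widehat I$ as the disjoint union of open intervals $(\widehat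 a_k,\widehat b_k)$. A Dirichlet form in the wide sense is a non-negative symmetric closed Markovian form on an $L^2$-space, whose domain need not be dense; it is a Dirichlet form if its domain is dense. It is irreducible if every set invariant under its $L^2$-semigroup is null or has null complement. A regular representation of a Dirichlet form in the wide sense $(\mathscr E,\mathscr F)$ on $L^2(E,\mathfrak m)$ is a regular Dirichlet form $(\mathscr E',\mathscr F')$ on some $L^2(E',\mathfrak m')$ together with an algebra isomorphism $\mathscr F\cap L^\infty\to\mathscr F'\cap L^\infty$ preserving the $L^\infty$-norm, the $L^2$-norm and the form. **Theorem.** 1. $\mathfrak m^*$ and $\widehat{\mathfrak m}$ are fully supported Radon measures on $I^*$ and $\widehat I$, respectively. 2. $(\mathscr E^*,\mathscr F^*)$ is a regular and irreducible Dirichlet form on $L^2(I^*,\mathfrak m^*)$, and it is a regular representation of the Dirichlet form in the wide sense $(\mathscr E,\mathscr F)$ on $L^2(I_0,\mathfrak m)$. 3. $(\widehat{\mathscr E},\widehat{\mathscr F})$ is a regular and irreducible Dirichlet form on $L^2(\widehat I,\widehat{\mathfrak m})$, it is a regular representation of $(\mathscr E,\mathscr F)$, and $$\widehat{\mathscr F}=\{\widehat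 f\in L^2(\widehat I,\widehat{\mathfrak m})\cap\widehat{\mathscr S}:\widehat f(\widehat j)=0\text{ if }\widehat j\in\mathbb R\setminus\widehat I,\ \widehat j=\widehat l\text{ or }\widehat r\},$$ $$\widehat{\mathscr E}(\widehat f,\widehat f)=\frac12\int_{\widehat I}\widehat f'(\widehat x)^2\,d\widehat x+\frac12\sum_k\frac{(\widehat f(\widehat a_k)-\widehat f(\widehat b_k))^2}{|\widehat b_k-\widehat a_k|},\qquad \widehat f\in\widehat{\mathscr F},$$ where $\widehat f'$ is the derivative of $\widehat f$ along $\widehat I$, which exists Lebesgue-a.e. on $\widehat I$. -/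

import Mathlib

open Set Filter Topology MeasureTheory
open scoped ENNReal

noncomputable section

/-! ### Dirichlet forms on `L²`-spaces -/

/-- A real valued form `form` on a set `dom` of elements of the real Hilbert space `L²(X, μ)`;
only the values of `form` on `dom` matter. -/
structure L2Form {X : Type*} [MeasurableSpace X] (μ : Measure X) where
  dom : Set (Lp ℝ 2 μ)
  form : Lp ℝ 2 μ → Lp ℝ 2 μ → ℝ

namespace L2Form

variable {X : Type*} [MeasurableSpace X] {μ : Measure X}

/-- The form on `L²(X, μ)` obtained by realizing every element `a` of a family `V` as a function
`ev a` on `X` and transporting `e : V × V → ℝ`: its domain consists of the classes of the functions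
`ev a`, `a ∈ V`, and the value at the classes of `ev a` and `ev b` is `e a b`. -/
def ofFunctions {A : Type*} (μ : Measure X) (V : Set A) (ev : A → X → ℝ) (e : A → A → ℝ) :
    L2Form μ where
  dom := {u | ∃ a ∈ V, u =ᵐ[μ] ev a}
  form u v := by
    classical
    exact if h : (∃ a ∈ V, u =ᵐ[μ] ev a) ∧ (∃ b ∈ V, v =ᵐ[μ] ev b) then
      e h.1.choose h.2.choose else 0

/-- `ℰ₁(u, u) = ℰ(u, u) + (u, u)`. -/
def normOne (E : L2Form μ) (u : Lp ℝ 2 μ) : ℝ := E.form u u + ‖u‖ ^ 2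

/-- Dirichlet form in the wide sense: a non-negative symmetric closed form with the Markovian
property whose domain is a linear subspace, not necessarily dense, of `L²(X, μ)`. -/
structure IsWideDirichletForm (E : L2Form μ) : Prop where
  zero_mem : (0 : Lp ℝ 2 μ) ∈ E.dom
  add_mem : ∀ u ∈ E.dom, ∀ v ∈ E.dom, u + v ∈ E.dom
  smul_mem : ∀ (c : ℝ), ∀ u ∈ E.dom, c • u ∈ E.dom
  form_add : ∀ u ∈ E.dom, ∀ v ∈ E.dom, ∀ w ∈ E.dom,
    E.form (u + v) w = E.form u w + E.form v w
  form_smul : ∀ (c : ℝ), ∀ u ∈ E.dom, ∀ v ∈ E.dom, E.form (c • u) v = c * E.form u v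
  symm : ∀ u ∈ E.dom, ∀ v ∈ E.dom, E.form u v = E.form v u
  nonneg : ∀ u ∈ E.dom, 0 ≤ E.form u u
  closed : ∀ u : ℕ → Lp ℝ 2 μ, (∀ n, u n ∈ E.dom) →
    (∀ ε > 0, ∃ N, ∀ p ≥ N, ∀ q ≥ N, E.normOne (u p - u q) < ε) →
    ∃ v ∈ E.dom, Tendsto (fun n => E.normOne (u n - v)) atTop (𝓝 0)
  markov : ∀ u ∈ E.dom, ∀ v : Lp ℝ 2 μ, (v =ᵐ[μ] fun x => max 0 (min (u x) 1)) →
    v ∈ E.dom ∧ E.form v v ≤ E.form u u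

/-- `T` is the strongly continuous contraction semigroup of symmetric operators on `L²(X, μ)`
associated with the form: `u ∈ dom` iff `t⁻¹ (u - T_t u, u)` has a finite limit as `t ↓ 0`, and
`ℰ(u, v) = lim_{t ↓ 0} t⁻¹ (u - T_t u, v)`. -/
structure IsSemigroupOf (T : ℝ → Lp ℝ 2 μ →L[ℝ] Lp ℝ 2 μ) (E : L2Form μ) : Prop where
  zero : T 0 = ContinuousLinearMap.id ℝ _
  add : ∀ s t, 0 ≤ s → 0 ≤ t → T (s + t) = (T s).comp (T t)
  contraction : ∀ t, 0 ≤ t → ∀ u, ‖T t u‖ ≤ ‖u‖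
  symm : ∀ t, 0 ≤ t → ∀ u v, inner ℝ (T t u) v = inner ℝ u (T t v)
  strongly_continuous : ∀ u, Tendsto (fun t => T t u) (𝓝[>] 0) (𝓝 u)
  mem_dom : ∀ u, u ∈ E.dom ↔
    ∃ a : ℝ, Tendsto (fun t : ℝ => t⁻¹ * inner ℝ (u - T t u) u) (𝓝[>] 0) (𝓝 a)
  form_eq : ∀ u ∈ E.dom, ∀ v ∈ E.dom,
    Tendsto (fun t : ℝ => t⁻¹ * inner ℝ (u - T t u) v) (𝓝[>] 0) (𝓝 (E.form u v))

/-- `A` is invariant for the semigroup `T`: `T_t (1_A u) = 1_A T_t u`. -/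
def IsInvariantSet (T : ℝ → Lp ℝ 2 μ →L[ℝ] Lp ℝ 2 μ) (A : Set X) : Prop :=
  MeasurableSet A ∧ ∀ t > 0, ∀ u v : Lp ℝ 2 μ, v =ᵐ[μ] A.indicator u →
    T t v =ᵐ[μ] A.indicator (T t u)

/-- Irreducibility: every set invariant for the semigroup of the form is trivial. -/
def IsIrreducible (E : L2Form μ) : Prop :=
  ∀ T, IsSemigroupOf T E → ∀ A : Set X, IsInvariantSet T A → μ A = 0 ∨ μ Aᶜ = 0

/-- Elements of the domain with a continuous, compactly supported version. -/
def core [TopologicalSpace X] (E : L2Form μ) : Set (Lp ℝ 2 μ) :=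
  {u | u ∈ E.dom ∧ ∃ φ : X → ℝ, Continuous φ ∧ HasCompactSupport φ ∧ u =ᵐ[μ] φ}

/-- A regular Dirichlet form on `L²(X, μ)`: `X` is a locally compact separable metrizable space,
`μ` is a fully supported Radon measure, the form is a (densely defined) Dirichlet form, and
`dom ∩ C_c(X)` is `ℰ₁`-dense in `dom` and uniformly dense in `C_c(X)`. -/
structure IsRegularDirichletForm [TopologicalSpace X] (E : L2Form μ) : Prop where
  locallyCompact : LocallyCompactSpace X
  separable : TopologicalSpace.SeparableSpace X
  metrizable : TopologicalSpace.MetrizableSpace X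
  radon : μ.Regular
  fullSupport : μ.IsOpenPosMeasure
  wide : E.IsWideDirichletForm
  dense : Dense E.dom
  core_dense : ∀ u ∈ E.dom, ∀ ε > 0, ∃ v ∈ E.core, E.normOne (u - v) < ε
  core_uniform : ∀ φ : X → ℝ, Continuous φ → HasCompactSupport φ → ∀ ε > 0,
    ∃ ψ : X → ℝ, Continuous ψ ∧ HasCompactSupport ψ ∧ (∃ u ∈ E.dom, u =ᵐ[μ] ψ) ∧
      ∀ x, |φ x - ψ x| < ε

/-- `dom ∩ L^∞`. -/
def bdd (E : L2Form μ) : Set (Lp ℝ 2 μ) := {u | u ∈ E.dom ∧ eLpNorm u ∞ μ < ∞}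

variable {Y : Type*} [MeasurableSpace Y] {ν : Measure Y}

/-- Equivalence of D-spaces: an algebra isomorphism between the bounded parts of the domains
preserving the `L^∞`-norm, the `L²`-norm and the form. -/
def Equivalent (E : L2Form μ) (E' : L2Form ν) : Prop :=
  ∃ Φ : Lp ℝ 2 μ → Lp ℝ 2 ν, BijOn Φ E.bdd E'.bdd ∧
    (∀ u ∈ E.bdd, ∀ v ∈ E.bdd, Φ (u + v) = Φ u + Φ v) ∧
    (∀ (c : ℝ), ∀ u ∈ E.bdd, Φ (c • u) = c • Φ u) ∧
    (∀ u ∈ E.bdd, ∀ v ∈ E.bdd, ∃ w ∈ E.bdd, (w =ᵐ[μ] fun x => u x * v x) ∧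
      Φ w =ᵐ[ν] fun y => Φ u y * Φ v y) ∧
    ∀ u ∈ E.bdd, eLpNorm u ∞ μ = eLpNorm (Φ u) ∞ ν ∧ ‖u‖ = ‖Φ u‖ ∧
      E.form u u = E'.form (Φ u) (Φ u)

/-- `E'` is a regular representation of `E`: both are Dirichlet forms in the wide sense, they are
equivalent, and `E'` is regular. -/
structure IsRegularRepresentation [TopologicalSpace Y] (E : L2Form μ) (E' : L2Form ν) : Prop where
  wide : E.IsWideDirichletForm
  regular : E'.IsRegularDirichletForm
  equiv : E.Equivalent E'

end L2Form

/-! ### Discontinuous scales -/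

/-- `(c, d)` is one of the maximal open intervals of which the open set `O` is the disjoint
union. -/
def IsComponentInterval {α : Type*} [LinearOrder α] (O : Set α) (c d : α) : Prop :=
  c < d ∧ Ioo c d ⊆ O ∧ c ∉ O ∧ d ∉ O

/-- `μ` is the Lebesgue-Stieltjes measure on the interval `J` of the continuous increasing
function `F` (extended by zero off `J`). -/
def IsLebesgueStieltjes (F : ℝ → ℝ) (J : Set ℝ) (μ : Measure ℝ) : Prop :=
  μ Jᶜ = 0 ∧ ∀ a ∈ J, ∀ b ∈ J, a ≤ b → μ (Ioc a b) = ENNReal.ofReal (F b - F a)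

/-- The Lebesgue-Stieltjes measure of `F` on `J`. -/
def lebesgueStieltjes (F : ℝ → ℝ) (J : Set ℝ) : Measure ℝ := by
  classical
  exact if h : ∃ μ, IsLebesgueStieltjes F J μ then h.choose else 0

/-- `∫_{(0,x)} g dμ`, with the convention `∫_{(0,x)} = -∫_{[x,0)}` for `x < 0`. -/
def integralOpen (μ : Measure ℝ) (g : ℝ → ℝ) (x : ℝ) : ℝ :=
  if 0 ≤ x then ∫ y in Ioo 0 x, g y ∂μ else -∫ y in Ico x 0, g y ∂μ

/-- `∫_{(0,x]} g dμ`, with the convention `∫_{(0,x]} = -∫_{(x,0)}` for `x < 0`. -/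
def integralClosed (μ : Measure ℝ) (g : ℝ → ℝ) (x : ℝ) : ℝ :=
  if 0 ≤ x then ∫ y in Ioc 0 x, g y ∂μ else -∫ y in Ioo x 0, g y ∂μ

/-- A triple: a closed interval `I = [l, r]` of the extended reals containing `0` in its interior,
a non-constant increasing real function `s` on `(l, r)`, continuous and vanishing at `0` (its values
off `(l, r)` are irrelevant), and a measure `m` on `I` (regarded as a measure on the extended reals
without mass off `I`) that is finite on compact subintervals of `(l, r)` and does not charge `0`. -/
structure ScaleTriple where
  l : EReal
  r : EReal
  l_neg : l < 0
  r_pos : 0 < r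
  s : ℝ → ℝ
  s_mono : MonotoneOn s {x : ℝ | l < (x : EReal) ∧ (x : EReal) < r}
  s_nonconst : ∃ x y : ℝ, l < (x : EReal) ∧ (x : EReal) < r ∧ l < (y : EReal) ∧ (y : EReal) < r ∧
    s x ≠ s y
  s_zero : s 0 = 0
  s_cont_zero : ContinuousAt s 0
  m : Measure EReal
  m_compl : m (Icc l r)ᶜ = 0
  m_radon : ∀ a b : EReal, l < a → b < r → m (Icc a b) < ∞
  m_zero : m {0} = 0

namespace ScaleTriple

variable (T : ScaleTriple)

def I : Set EReal := Icc T.l T.r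

/-- The open interval `(l, r)`, a set of real numbers. -/
def openPart : Set ℝ := {x : ℝ | T.l < (x : EReal) ∧ (x : EReal) < T.r}

/-- The scale function on `I`: at the endpoints it is the limit of `s` from inside, that is the
infimum and the supremum of its values. For convenience it is continued by constants off `I`, so
that its left limit at `l` is `s(l)` and its right limit at `r` is `s(r)`. -/
def scale (x : EReal) : EReal :=
  if x ≤ T.l then ⨅ y ∈ T.openPart, (T.s y : EReal)
  else if T.r ≤ x then ⨆ y ∈ T.openPart, (T.s y : EReal)
  else (T.s x.toReal : EReal)

/-- The points of `I` with a relatively open neighbourhood in `I` on which the scale is constant. -/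
def U : Set EReal :=
  {x | x ∈ T.I ∧ ∃ V ∈ 𝓝 x, ∀ y ∈ V ∩ T.I, ∀ z ∈ V ∩ T.I, T.scale y = T.scale z}

/-- `(c, d)` is one of the disjoint open intervals that make up `U \ {l, r}`. -/
def IsFlat (c d : EReal) : Prop := IsComponentInterval (T.U \ {T.l, T.r}) c d

def Dplus : Set EReal := {x | x ∈ T.I ∧ T.scale x ≠ Function.rightLim T.scale x}

def Dminus : Set EReal := {x | x ∈ T.I ∧ T.scale x ≠ Function.leftLim T.scale x}

/-- `(c, d)` is an isolated interval. -/
def IsIsolatedInterval (c d : EReal) : Prop :=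
  T.IsFlat c d ∧ c ∈ T.Dplus ∪ T.Dminus ∪ {T.l, T.r} ∧ d ∈ T.Dplus ∪ T.Dminus ∪ {T.l, T.r}

/-! Classification of the endpoints. -/

def LeftApproachable : Prop := T.scale T.l ≠ ⊥

def RightApproachable : Prop := T.scale T.r ≠ ⊤

def LeftRegular : Prop := T.LeftApproachable ∧ ∃ b > T.l, T.m (Ioo T.l b) < ∞

def RightRegular : Prop := T.RightApproachable ∧ ∃ a < T.r, T.m (Ioo a T.r) < ∞

def LeftReflecting : Prop := T.LeftRegular ∧ T.m {T.l} < ∞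

def RightReflecting : Prop := T.RightRegular ∧ T.m {T.r} < ∞

/-- An endpoint of `I` that is an endpoint of an isolated interval is reflecting. -/
def DK : Prop :=
  ∀ c d, T.IsIsolatedInterval c d →
    (c = T.l → T.LeftReflecting) ∧ (d = T.r → T.RightReflecting)

/-- The interval with endpoints `c < d` containing `c` iff `c ∉ D⁺` and `d` iff `d ∉ D⁻`. -/
def flatHull (c d : EReal) : Set EReal :=
  {x | (c < x ∧ x < d) ∨ (x = c ∧ c ∉ T.Dplus) ∨ (x = d ∧ d ∉ T.Dminus)}

/-- The support of `s` is contained in that of `m`, and `m` charges the isolated points and the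
isolated intervals. -/
def DM : Prop :=
  T.I \ T.U ⊆ T.m.support ∧ (∀ x ∈ T.Dplus ∩ T.Dminus, 0 < T.m {x}) ∧
    ∀ c d, T.IsIsolatedInterval c d → 0 < T.m (T.flatHull c d)

/-! ### The form associated with the triple -/

/-- `μ_d⁺ = ∑ (s(x+) - s(x)) δ_x`. -/
def muPlus : Measure ℝ :=
  Measure.sum fun x : T.openPart =>
    ENNReal.ofReal (Function.rightLim T.s x - T.s x) • Measure.dirac (x : ℝ)

/-- `μ_d⁻ = ∑ (s(x) - s(x-)) δ_x`. -/
def muMinus : Measure ℝ :=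
  Measure.sum fun x : T.openPart =>
    ENNReal.ofReal (T.s x - Function.leftLim T.s x) • Measure.dirac (x : ℝ)

def sPlus (x : ℝ) : ℝ :=
  if 0 ≤ x then (T.muPlus (Ioo 0 x)).toReal else -(T.muPlus (Ico x 0)).toReal

def sMinus (x : ℝ) : ℝ :=
  if 0 ≤ x then (T.muMinus (Ioc 0 x)).toReal else -(T.muMinus (Ioo x 0)).toReal

/-- The continuous part of the scale. -/
def sCont (x : ℝ) : ℝ := T.s x - T.sPlus x - T.sMinus x

def muCont : Measure ℝ := lebesgueStieltjes T.sCont T.openPart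

/-- Three functions, the candidates for `df^c/dμ_c`, `df⁺/dμ_d⁺` and `df⁻/dμ_d⁻`. -/
structure Density where
  cont : ℝ → ℝ
  plus : ℝ → ℝ
  minus : ℝ → ℝ

/-- `f = f^c + f⁺ + f⁻` on `(l, r)` where the three summands have the given square integrable
densities. -/
def HasDensity (f : ℝ → ℝ) (g : Density) : Prop :=
  MemLp g.cont 2 T.muCont ∧ MemLp g.plus 2 T.muPlus ∧ MemLp g.minus 2 T.muMinus ∧
    ∃ c₀ : ℝ, ∀ x ∈ T.openPart, f x = (c₀ + integralOpen T.muCont g.cont x) +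
      integralOpen T.muPlus g.plus x + integralClosed T.muMinus g.minus x

/-- The functions on `(l, r)` that are absolutely continuous with respect to `s` with a square
integrable density; values off `(l, r)` are irrelevant. -/
def S : Set (ℝ → ℝ) := {f | ∃ g, T.HasDensity f g}

/-- `½ ∫_I (df/ds) (dg/ds) ds` for `f, g ∈ S`; the densities of `f` and `g` are unique almost
everywhere. -/
def energy (f g : ℝ → ℝ) : ℝ := by
  classical
  exact if h : (∃ a, T.HasDensity f a) ∧ (∃ b, T.HasDensity g b) then
    (1 / 2) * ((∫ x, h.1.choose.cont x * h.2.choose.cont x ∂T.muCont) +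
      (∫ x, h.1.choose.plus x * h.2.choose.plus x ∂T.muPlus) +
      (∫ x, h.1.choose.minus x * h.2.choose.minus x ∂T.muMinus))
  else 0

/-- `I` without its non-reflecting endpoints. -/
def I₀ : Set EReal :=
  {x | x ∈ T.I ∧ (x = T.l → T.LeftReflecting) ∧ (x = T.r → T.RightReflecting)}

/-- The restriction of `m` to `I₀`. -/
def m₀ : Measure T.I₀ := T.m.comap Subtype.val

/-- The filter `x ↓ l` on the real line. -/
def atLeft : Filter ℝ := comap Real.toEReal (𝓝[>] T.l)

/-- The filter `x ↑ r` on the real line. -/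
def atRight : Filter ℝ := comap Real.toEReal (𝓝[<] T.r)

/-- `f : (l, r) → ℝ` continued to `l` and `r` by its limits. -/
def extendEnds (f : ℝ → ℝ) (x : EReal) : ℝ :=
  if x ≤ T.l then limUnder T.atLeft f
  else if T.r ≤ x then limUnder T.atRight f
  else f x.toReal

/-- The functions in the domain of the form associated with the triple. -/
def F : Set (ℝ → ℝ) :=
  {f | f ∈ T.S ∧ MemLp (fun x : T.I₀ => T.extendEnds f x) 2 T.m₀ ∧
    (T.l ∉ T.I₀ → T.LeftApproachable → Tendsto f T.atLeft (𝓝 0)) ∧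
    (T.r ∉ T.I₀ → T.RightApproachable → Tendsto f T.atRight (𝓝 0))}

/-- The form `(ℰ, ℱ)` on `L²(I₀, m)` associated with the triple. -/
def wideForm : L2Form T.m₀ :=
  L2Form.ofFunctions T.m₀ T.F (fun f x => T.extendEnds f x) T.energy

/-! ### Scale completion and darning -/

/-- `arctan` on the extended reals. -/
def arctanE (x : EReal) : ℝ :=
  if x = ⊥ then -(Real.pi / 2) else if x = ⊤ then Real.pi / 2 else Real.arctan x.toReal

theorem arctanE_coe (x : ℝ) : arctanE (x : EReal) = Real.arctan x := by
  simp [arctanE]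

theorem arctanE_bot : arctanE ⊥ = -(Real.pi / 2) := by simp [arctanE]

theorem arctanE_top : arctanE ⊤ = Real.pi / 2 := by simp [arctanE]

theorem arctanE_strictMono : StrictMono arctanE := by
  intro x y h
  induction x <;> induction y <;>
    simp_all [arctanE_coe, arctanE_bot, arctanE_top, Real.arctan_lt_pi_div_two,
      Real.neg_pi_div_two_lt_arctan, Real.arctan_strictMono.lt_iff_lt, neg_lt_self_iff,
      Real.pi_pos]

theorem arctanE_mem (x : EReal) : arctanE x ∈ Icc (-(Real.pi / 2)) (Real.pi / 2) := by
  rw [← arctanE_bot, ← arctanE_top]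
  exact ⟨arctanE_strictMono.monotone bot_le, arctanE_strictMono.monotone le_top⟩

theorem arctanE_surj {t : ℝ} (ht : t ∈ Icc (-(Real.pi / 2)) (Real.pi / 2)) :
    ∃ x, arctanE x = t := by
  rcases ht.1.eq_or_lt with h | h
  · exact ⟨⊥, by rw [arctanE_bot, h]⟩
  rcases ht.2.eq_or_lt with h' | h'
  · exact ⟨⊤, by rw [arctanE_top, h']⟩
  · exact ⟨(Real.tan t : ℝ), by rw [arctanE_coe, Real.arctan_tan h h']⟩

theorem arctanE_continuous : Continuous arctanE := by
  let g : EReal → Icc (-(Real.pi / 2)) (Real.pi / 2) := fun x => ⟨arctanE x, arctanE_mem x⟩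
  have hg : Continuous g := by
    apply Monotone.continuous_of_surjective
    · intro x y h
      exact arctanE_strictMono.monotone h
    · rintro ⟨t, ht⟩
      obtain ⟨x, hx⟩ := arctanE_surj ht
      exact ⟨x, Subtype.ext hx⟩
  exact continuous_subtype_val.comp hg

/-- The interval `I`, as a space of its own, to be equipped with the metric
`|arctan x - arctan y| + |arctan s(x) - arctan s(y)|`. -/
def ScaleSpace : Type := {x : EReal // x ∈ T.I}

instance : MetricSpace T.ScaleSpace where
  dist x y := |arctanE x.1 - arctanE y.1| + |arctanE (T.scale x.1) - arctanE (T.scale y.1)|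
  dist_self x := by simp
  dist_comm x y := by
    rw [abs_sub_comm (arctanE x.1), abs_sub_comm (arctanE (T.scale x.1))]
  dist_triangle x y z := by
    have h₁ := abs_sub_le (arctanE x.1) (arctanE y.1) (arctanE z.1)
    have h₂ := abs_sub_le (arctanE (T.scale x.1)) (arctanE (T.scale y.1)) (arctanE (T.scale z.1))
    linarith
  eq_of_dist_eq_zero := by
    intro x y h
    have h₁ := abs_nonneg (arctanE x.1 - arctanE y.1)
    have h₂ := abs_nonneg (arctanE (T.scale x.1) - arctanE (T.scale y.1))
    have h₃ : |arctanE x.1 - arctanE y.1| = 0 := by linarith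
    exact Subtype.ext (arctanE_strictMono.injective (sub_eq_zero.1 (abs_eq_zero.1 h₃)))

/-- The scale completion of `I`. -/
abbrev ScaleCompletion : Type := UniformSpace.Completion T.ScaleSpace

/-- The closure of the flat interval `(c, d)` in the scale completion. -/
def flatClosure (c d : EReal) : Set T.ScaleCompletion :=
  closure ((fun x : T.ScaleSpace => (x : T.ScaleCompletion)) '' {x | c < x.1 ∧ x.1 < d})

/-- The relation that identifies the points of the closure of each flat interval. -/
def darn (p q : T.ScaleCompletion) : Prop :=
  ∃ c d, T.IsFlat c d ∧ p ∈ T.flatClosure c d ∧ q ∈ T.flatClosure c d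

/-- The space obtained from the scale completion by collapsing the closure of each flat interval
into a point, with the quotient topology and the Borel σ-algebra. -/
def DarnedSpace : Type := Quot T.darn

instance : TopologicalSpace T.DarnedSpace := inferInstanceAs (TopologicalSpace (Quot T.darn))

instance : MeasurableSpace T.DarnedSpace := borel _

instance : BorelSpace T.DarnedSpace := ⟨rfl⟩

/-- The extension of the scale to the scale completion by continuity. -/
def scaleBar : T.ScaleCompletion → EReal :=
  UniformSpace.Completion.isDenseInducing_coe.extend fun x : T.ScaleSpace => T.scale x.1

theorem exists_tendsto_scale (p : T.ScaleCompletion) :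
    ∃ c, Tendsto (fun x : T.ScaleSpace => T.scale x.1)
      (comap (fun x : T.ScaleSpace => (x : T.ScaleCompletion)) (𝓝 p)) (𝓝 c) := by
  have hu : UniformContinuous fun x : T.ScaleSpace => arctanE (T.scale x.1) := by
    refine (LipschitzWith.of_dist_le_mul (K := 1) fun x y => ?_).uniformContinuous
    have h : dist x y = |arctanE x.1 - arctanE y.1| +
      |arctanE (T.scale x.1) - arctanE (T.scale y.1)| := rfl
    rw [h, Real.dist_eq, NNReal.coe_one, one_mul]
    linarith [abs_nonneg (arctanE x.1 - arctanE y.1)]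
  have ht : Tendsto (fun x : T.ScaleSpace => arctanE (T.scale x.1))
      (comap (fun x : T.ScaleSpace => (x : T.ScaleCompletion)) (𝓝 p))
      (𝓝 (UniformSpace.Completion.extension (fun x : T.ScaleSpace => arctanE (T.scale x.1)) p)) := by
    have h := (UniformSpace.Completion.continuous_extension
      (f := fun x : T.ScaleSpace => arctanE (T.scale x.1))).tendsto p
    have h' := h.comp (tendsto_comap (f := fun x : T.ScaleSpace => (x : T.ScaleCompletion)))
    refine h'.congr fun x => ?_
    exact UniformSpace.Completion.extension_coe hu x
  have hemb : Topology.IsClosedEmbedding arctanE :=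
    arctanE_continuous.isClosedEmbedding arctanE_strictMono.injective
  have : (comap (fun x : T.ScaleSpace => (x : T.ScaleCompletion)) (𝓝 p)).NeBot :=
    UniformSpace.Completion.isDenseInducing_coe.comap_nhds_neBot p
  have hmem := hemb.isClosed_range.mem_of_tendsto ht
    (Eventually.of_forall fun x => mem_range_self _)
  obtain ⟨c, hc⟩ := hmem
  rw [← hc] at ht
  exact ⟨c, hemb.isInducing.tendsto_nhds_iff.2 ht⟩

theorem scaleBar_continuous : Continuous T.scaleBar :=
  UniformSpace.Completion.isDenseInducing_coe.continuous_extend T.exists_tendsto_scale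

theorem scaleBar_coe (x : T.ScaleSpace) : T.scaleBar x = T.scale x.1 :=
  UniformSpace.Completion.isDenseInducing_coe.extend_eq' T.exists_tendsto_scale x

theorem scale_eq_of_isFlat {c d : EReal} (h : T.IsFlat c d) {x y : EReal} (hx : x ∈ Ioo c d)
    (hy : y ∈ Ioo c d) : T.scale x = T.scale y := by
  have hloc : ∀ z ∈ Ioo c d, ∀ᶠ w in 𝓝[Ioo c d] z, T.scale z = T.scale w := by
    intro z hz
    obtain ⟨-, V, hV, hc⟩ := (h.2.1 hz).1
    filter_upwards [mem_nhdsWithin_of_mem_nhds hV, self_mem_nhdsWithin] with w hw hw'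
    exact hc z ⟨mem_of_mem_nhds hV, (h.2.1 hz).1.1⟩ w ⟨hw, (h.2.1 hw').1.1⟩
  exact isPreconnected_Ioo.induction₂ (fun a b => T.scale a = T.scale b) hloc
    (fun a b c _ _ _ hab hbc => Eq.trans hab hbc) (fun a b _ _ hab => Eq.symm hab) hx hy

theorem scaleBar_eq_of_darn (p q : T.ScaleCompletion) (h : T.darn p q) :
    T.scaleBar p = T.scaleBar q := by
  obtain ⟨c, d, hcd, hp, hq⟩ := h
  obtain ⟨e, hce, hed⟩ := exists_between hcd.1
  have key : T.flatClosure c d ⊆ T.scaleBar ⁻¹' {T.scale e} := by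
    refine closure_minimal ?_ (isClosed_singleton.preimage T.scaleBar_continuous)
    rintro _ ⟨x, hx, rfl⟩
    change T.scaleBar x = T.scale e
    rw [T.scaleBar_coe]
    exact T.scale_eq_of_isFlat hcd hx ⟨hce, hed⟩
  exact (key hp).trans (key hq).symm

/-- The map `s*` on the darned space: at (the class of) `x`, `x±` and the collapsed interval
`(c, d)` its value is `s(x)`, `s(x±)` and the constant value of `s` on `(c, d)`. -/
def sStar : T.DarnedSpace → EReal := Quot.lift T.scaleBar T.scaleBar_eq_of_darn

/-! ### The regularization and the image regularization -/

/-- The darned space without those of its endpoints `l* = s*⁻¹(s(l))`, `r* = s*⁻¹(s(r))` that are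
not reflecting. -/
def IStar : Set T.DarnedSpace :=
  {p | (T.sStar p = T.scale T.l → T.LeftReflecting) ∧
    (T.sStar p = T.scale T.r → T.RightReflecting)}

/-- `Î = s*(I*)`, a set of real numbers. -/
def hatI : Set ℝ := {x | (x : EReal) ∈ T.sStar '' T.IStar}

/-- The image measure of `m` under `s`, on `Î`. -/
def hatM : Measure T.hatI := (T.m.map T.scale).comap fun x : T.hatI => ((x : ℝ) : EReal)

/-- `m*(A) = m̂(s*(A))`. -/
def mStar : Measure T.IStar := (T.m.map T.scale).comap fun p : T.IStar => T.sStar p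

/-- `f̂` is the continuous function on `Î` with `f̂(s(x)) = f(x)` for `x ∈ I₀` and
`f̂(s(x±)) = f(x±)` for `x ∈ D^±`; moreover it has a finite limit at each finite endpoint of `Î` not
in `Î`. -/
structure IsIotaHat (f : ℝ → ℝ) (f' : T.hatI → ℝ) : Prop where
  continuous : Continuous f'
  limit_left : ∀ j : ℝ, (j : EReal) = T.scale T.l → j ∉ T.hatI →
    ∃ a, Tendsto f' (comap Subtype.val (𝓝 j)) (𝓝 a)
  limit_right : ∀ j : ℝ, (j : EReal) = T.scale T.r → j ∉ T.hatI →
    ∃ a, Tendsto f' (comap Subtype.val (𝓝 j)) (𝓝 a)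
  eq_openPart : ∀ x ∈ T.openPart, ∀ y : T.hatI, (y : ℝ) = T.s x → f' y = f x
  eq_left : T.l ∈ T.I₀ → ∀ y : T.hatI, ((y : ℝ) : EReal) = T.scale T.l →
    Tendsto f T.atLeft (𝓝 (f' y))
  eq_right : T.r ∈ T.I₀ → ∀ y : T.hatI, ((y : ℝ) : EReal) = T.scale T.r →
    Tendsto f T.atRight (𝓝 (f' y))
  eq_plus : ∀ x : ℝ, (x : EReal) ∈ T.Dplus → ∀ y : T.hatI,
    ((y : ℝ) : EReal) = Function.rightLim T.scale x → Tendsto f (𝓝[>] x) (𝓝 (f' y))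
  eq_minus : ∀ x : ℝ, (x : EReal) ∈ T.Dminus → ∀ y : T.hatI,
    ((y : ℝ) : EReal) = Function.leftLim T.scale x → Tendsto f (𝓝[<] x) (𝓝 (f' y))

/-- The map `f ↦ f̂` from `S` to the functions on `Î`. -/
def iotaHat (f : ℝ → ℝ) : T.hatI → ℝ := by
  classical
  exact if h : ∃ f', T.IsIotaHat f f' then h.choose else 0

/-- The map `f ↦ f* = f̂ ∘ s*` from `S` to the functions on `I*`. -/
def iotaStar (f : ℝ → ℝ) (p : T.IStar) : ℝ := by
  classical
  exact if h : (T.sStar p).toReal ∈ T.hatI then T.iotaHat f ⟨_, h⟩ else 0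

/-- `Ŝ`. -/
def hatS : Set (T.hatI → ℝ) := T.iotaHat '' T.S

/-- The functions `f̂` with `f ∈ ℱ`. -/
def hatF : Set (T.hatI → ℝ) := T.iotaHat '' T.F

/-- The regularization `(ℰ*, ℱ*)` of `(ℰ, ℱ)`, a form on `L²(I*, m*)`. -/
def starForm : L2Form T.mStar := L2Form.ofFunctions T.mStar T.F T.iotaStar T.energy

/-- The image regularization `(ℰ̂, ℱ̂)` of `(ℰ, ℱ)`, a form on `L²(Î, m̂)`. -/
def hatForm : L2Form T.hatM := L2Form.ofFunctions T.hatM T.F T.iotaHat T.energy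

/-- A function on `Î` continued by zero to the real line. -/
def zeroExtend (f : T.hatI → ℝ) : ℝ → ℝ := Function.extend Subtype.val f 0

/-- The gaps of `Î`: the pairs `(â, b̂)` such that the intervals `(â, b̂)` are the components of
`(s(l), s(r)) \ Î`. -/
def gaps : Set (ℝ × ℝ) :=
  {g | IsComponentInterval
    {x : ℝ | T.scale T.l < (x : EReal) ∧ (x : EReal) < T.scale T.r ∧ x ∉ T.hatI} g.1 g.2}

end ScaleTriple

end

noncomputable section

/-! ### Square integrable densities of functions on a subset of the line -/

/-! Everything is read off one closed set of the line, the closure `C` of the values of the scale on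
`(l, r)` (`traceSet`), and one Hilbert space, `L²(ℝ)`.

Functions. The generalized inverse of the scale (`quantile`) carries Lebesgue measure on the values
strictly between `s(l)` and `s(r)` to `μ_c`, `μ_d⁺` and `μ_d⁻`, according as a value is attained at
its generalized inverse, skipped by the jump to the right of it, or skipped by the jump from the
left (`muCont_eq`, `muPlus_eq`, `muMinus_eq`). A triple `(g^c, g⁺, g⁻)` thus becomes one square
integrable function `G` of the value, and `f` becomes `H ∘ s` with `H y - H x = ∫ t in x..y, G t` on
`C`. The functions `G` that arise vanish off the hull of `C` and are constant on its gaps, and the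
functions with these two properties are exactly the closed span of the indicators of intervals with
endpoints in `C` (`traceSpace`): among all densities of `H` along `C`, `G` is the one of least norm.
So `S` consists of the `H ∘ s` where `H` has a square integrable density along `C`, and the energy
is `½ ∫ G²` (`mem_S_iff`, `energy_eq`). On `C` itself `G` is the derivative of `H`, on a gap it is
the mean slope; this is the formula for the energy on `Î`.

Spaces. The scale completion is compact, and points of it with the same scale value are identified
by darning. So `s*` is a closed embedding, and `I*` and `Î` are two copies of `C` without its
non-reflecting endpoints. DM makes the image of `m` fully supported, the reflecting property makes
it locally finite, and DK prevents a removed endpoint from being isolated in `C`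
(`isTraceEmbedding`). The scale also transports `m` from the part of `I₀` over `Î`, off which the
functions of `ℱ` vanish (`isTracePullback`).

Forms. It remains to study the form `½ ∫ G G'` on such a space. Increments are inner products with
fixed kernels, which yields closedness; normal contractions do not increase the least norm, which
yields the Markov property. Polynomials in the coordinate times cutoffs are uniformly dense in
`C_c`. Truncations converge weakly to a given function of the domain, and a subspace has the same
weak and strong closure, so the core is dense. For irreducibility, an invariant set splits a cutoff
into continuous `H₁, H₂ ≥ 0` with `H₁ H₂ = 0` and vanishing mutual energy. That energy is a sum of
nonpositive terms over the gaps, and if neither part is trivial, one term is negative, because `H₁`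
has to drop from `1` to `0` across a gap over which `H₂` rises (`isIrreducible`). Finally,
composition with a measure preserving map is an isomorphism of the bounded parts of the domains
(`equivalent`). -/

/-- The real Hilbert space `L²(ℝ)`. -/
abbrev LineL2 : Type := Lp ℝ 2 (volume : Measure ℝ)

theorem LineL2.intervalIntegrable (G : LineL2) (x y : ℝ) : IntervalIntegrable G volume x y := by
  have h : LocallyIntegrable G volume :=
    (Lp.memLp G).locallyIntegrable one_le_two
  exact intervalIntegrable_iff.mpr
    ((h.integrableOn_isCompact isCompact_uIcc).mono_set uIoc_subset_uIcc)

theorem LineL2.locallyIntegrable (G : LineL2) : LocallyIntegrable G volume :=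
  (Lp.memLp G).locallyIntegrable one_le_two

/-- The element of `L²(ℝ)` representing `G ↦ ∫ t in x..y, G t`. -/
def intervalKernel (x y : ℝ) : LineL2 :=
  indicatorConstLp 2 (measurableSet_Ioc (a := x) (b := y)) (by simp) 1 -
    indicatorConstLp 2 (measurableSet_Ioc (a := y) (b := x)) (by simp) 1

theorem inner_intervalKernel (x y : ℝ) (G : LineL2) :
    inner ℝ (intervalKernel x y) G = ∫ t in x..y, G t := by
  rw [intervalKernel, inner_sub_left, L2.inner_indicatorConstLp_one,
    L2.inner_indicatorConstLp_one, intervalIntegral]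

/-- The closed subspace of `L²(ℝ)` spanned by the indicators of the intervals with endpoints
in `C`. -/
def traceSpace (C : Set ℝ) : Submodule ℝ LineL2 :=
  (Submodule.span ℝ {k | ∃ x ∈ C, ∃ y ∈ C, k = intervalKernel x y}).topologicalClosure

instance (C : Set ℝ) : CompleteSpace (traceSpace C) :=
  (Submodule.isClosed_topologicalClosure _).completeSpace_coe

theorem intervalKernel_mem {C : Set ℝ} {x y : ℝ} (hx : x ∈ C) (hy : y ∈ C) :
    intervalKernel x y ∈ traceSpace C :=
  Submodule.le_topologicalClosure _ (Submodule.subset_span ⟨x, hx, y, hy, rfl⟩)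

/-- Passing to the closed span does not change the orthogonal complement, so only the kernels have
to be tested. -/
theorem mem_traceSpace_orthogonal_iff {C : Set ℝ} {n : LineL2} :
    n ∈ (traceSpace C)ᗮ ↔ ∀ x ∈ C, ∀ y ∈ C, ∫ t in x..y, n t = 0 := by
  constructor
  · intro h x hx y hy
    rw [← inner_intervalKernel]
    exact (Submodule.mem_orthogonal _ _).1 h _ (intervalKernel_mem hx hy)
  · intro h
    rw [traceSpace, Submodule.orthogonal_closure, Submodule.mem_orthogonal]
    intro u hu
    induction hu using Submodule.span_induction with
    | mem k hk =>
      obtain ⟨x, hx, y, hy, rfl⟩ := hk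
      rw [inner_intervalKernel, h x hx y hy]
    | zero => simp
    | add a b _ _ ha hb => rw [inner_add_left, ha, hb, add_zero]
    | smul c a _ ha => rw [inner_smul_left, ha, mul_zero]

/-- A closed subspace is its own double complement. Explicit choices of `n` in this criterion later
reveal the shape of the elements of the trace space. -/
theorem mem_traceSpace_iff {C : Set ℝ} {G : LineL2} :
    G ∈ traceSpace C ↔
      ∀ n : LineL2, (∀ x ∈ C, ∀ y ∈ C, ∫ t in x..y, n t = 0) → inner ℝ n G = 0 := by
  rw [← Submodule.orthogonal_orthogonal (traceSpace C), Submodule.mem_orthogonal]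
  simp only [mem_traceSpace_orthogonal_iff]

/-- `G` is a density of `H` along `C`. -/
def IsDensity (C : Set ℝ) (H : ℝ → ℝ) (G : LineL2) : Prop :=
  ∀ x ∈ C, ∀ y ∈ C, H y - H x = ∫ t in x..y, G t

theorem IsDensity.mono {C D : Set ℝ} {H : ℝ → ℝ} {G : LineL2} (h : IsDensity D H G)
    (hCD : C ⊆ D) : IsDensity C H G :=
  fun x hx y hy => h x (hCD hx) y (hCD hy)

theorem IsDensity.congr {C : Set ℝ} {H H' : ℝ → ℝ} {G : LineL2} (h : IsDensity C H G)
    (hH : EqOn H H' C) : IsDensity C H' G := by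
  intro x hx y hy
  rw [← hH hx, ← hH hy, h x hx y hy]

theorem IsDensity.add {C : Set ℝ} {H H' : ℝ → ℝ} {G G' : LineL2} (h : IsDensity C H G)
    (h' : IsDensity C H' G') : IsDensity C (H + H') (G + G') := by
  intro x hx y hy
  rw [← inner_intervalKernel, inner_add_right, inner_intervalKernel, inner_intervalKernel,
    ← h x hx y hy, ← h' x hx y hy, Pi.add_apply, Pi.add_apply]
  ring

theorem IsDensity.smul {C : Set ℝ} {H : ℝ → ℝ} {G : LineL2} (h : IsDensity C H G) (c : ℝ) :
    IsDensity C (c • H) (c • G) := by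
  intro x hx y hy
  rw [← inner_intervalKernel, inner_smul_right, inner_intervalKernel,
    ← h x hx y hy, Pi.smul_apply, Pi.smul_apply, smul_eq_mul, smul_eq_mul]
  ring

theorem IsDensity.sub {C : Set ℝ} {H H' : ℝ → ℝ} {G G' : LineL2} (h : IsDensity C H G)
    (h' : IsDensity C H' G') : IsDensity C (H - H') (G - G') := by
  have := h.add (h'.smul (-1))
  simpa [sub_eq_add_neg] using this

theorem isDensity_const (C : Set ℝ) (c : ℝ) : IsDensity C (fun _ => c) 0 := by
  intro x hx y hy
  rw [← inner_intervalKernel, inner_zero_right, sub_self]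

/-- The primitive of an element of `L²(ℝ)`. -/
def primitive (a c : ℝ) (G : LineL2) (y : ℝ) : ℝ := c + ∫ t in a..y, G t

theorem primitive_isDensity (a c : ℝ) (G : LineL2) : IsDensity univ (primitive a c G) G := by
  intro x _ y _
  rw [primitive, primitive, add_sub_add_left_eq_sub,
    intervalIntegral.integral_interval_sub_left (G.intervalIntegrable _ _)
      (G.intervalIntegrable _ _)]

theorem primitive_continuous (a c : ℝ) (G : LineL2) : Continuous (primitive a c G) :=
  continuous_const.add
    (intervalIntegral.continuous_primitive (fun x y => G.intervalIntegrable x y) a)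

theorem IsDensity.eqOn_primitive {C : Set ℝ} {H : ℝ → ℝ} {G : LineL2} (h : IsDensity C H G)
    {a : ℝ} (ha : a ∈ C) : EqOn H (primitive a (H a) G) C := by
  intro y hy
  rw [primitive, ← h a ha y hy]
  ring

theorem IsDensity.continuous {H : ℝ → ℝ} {G : LineL2} (h : IsDensity univ H G) :
    Continuous H := by
  have : H = primitive 0 (H 0) G := funext fun y => h.eqOn_primitive (mem_univ 0) (mem_univ y)
  rw [this]
  exact primitive_continuous _ _ _

theorem IsDensity.continuousOn {C : Set ℝ} {H : ℝ → ℝ} {G : LineL2} (h : IsDensity C H G) :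
    ContinuousOn H C := by
  rcases C.eq_empty_or_nonempty with rfl | ⟨a, ha⟩
  · exact continuousOn_empty _
  · exact (primitive_continuous a (H a) G).continuousOn.congr (h.eqOn_primitive ha)

/-- The difference lies both in the trace space and in its orthogonal complement. -/
theorem IsDensity.eq_of_mem {C : Set ℝ} {H : ℝ → ℝ} {G G' : LineL2} (h : IsDensity C H G)
    (h' : IsDensity C H G') (hG : G ∈ traceSpace C) (hG' : G' ∈ traceSpace C) : G = G' := by
  have h₁ : G - G' ∈ (traceSpace C)ᗮ := by
    rw [mem_traceSpace_orthogonal_iff]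
    intro x hx y hy
    rw [← inner_intervalKernel, inner_sub_right, inner_intervalKernel, inner_intervalKernel,
      ← h x hx y hy, ← h' x hx y hy, sub_self]
  have h₂ := (Submodule.mem_orthogonal _ _).1 h₁ _ (sub_mem hG hG')
  exact sub_eq_zero.1 (inner_self_eq_zero.1 h₂)

/-- Increments between points of `C` are inner products with elements of the trace space, and these
do not notice the projection. Hence each `H` with a density has one in the trace space, and it has
the least norm. -/
theorem IsDensity.starProjection {C : Set ℝ} {H : ℝ → ℝ} {G : LineL2} (h : IsDensity C H G) :
    IsDensity C H ((traceSpace C).starProjection G) := by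
  intro x hx y hy
  rw [h x hx y hy, ← inner_intervalKernel, ← inner_intervalKernel, ← sub_eq_zero,
    ← inner_sub_right, real_inner_comm]
  exact Submodule.starProjection_inner_eq_zero _ _ (intervalKernel_mem hx hy)

/-- `H` has a square integrable density along `C`. -/
def HasL2Density (C : Set ℝ) (H : ℝ → ℝ) : Prop := ∃ G, IsDensity C H G

theorem HasL2Density.exists_mem {C : Set ℝ} {H : ℝ → ℝ} (h : HasL2Density C H) :
    ∃ G ∈ traceSpace C, IsDensity C H G := by
  obtain ⟨G, hG⟩ := h
  exact ⟨_, Submodule.starProjection_apply_mem _ _, hG.starProjection⟩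

/-- The minimal density of `H` along `C`. -/
def density (C : Set ℝ) (H : ℝ → ℝ) : LineL2 := by
  classical
  exact if h : HasL2Density C H then h.exists_mem.choose else 0

theorem density_mem (C : Set ℝ) (H : ℝ → ℝ) : density C H ∈ traceSpace C := by
  by_cases h : HasL2Density C H
  · rw [density, dif_pos h]
    exact h.exists_mem.choose_spec.1
  · rw [density, dif_neg h]
    exact zero_mem _

theorem HasL2Density.isDensity {C : Set ℝ} {H : ℝ → ℝ} (h : HasL2Density C H) :
    IsDensity C H (density C H) := by
  rw [density, dif_pos h]
  exact h.exists_mem.choose_spec.2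

theorem IsDensity.density_eq {C : Set ℝ} {H : ℝ → ℝ} {G : LineL2} (h : IsDensity C H G)
    (hG : G ∈ traceSpace C) : density C H = G :=
  (HasL2Density.isDensity ⟨G, h⟩).eq_of_mem h (density_mem _ _) hG

theorem IsDensity.density_eq_starProjection {C : Set ℝ} {H : ℝ → ℝ} {G : LineL2}
    (h : IsDensity C H G) : density C H = (traceSpace C).starProjection G :=
  h.starProjection.density_eq (Submodule.starProjection_apply_mem _ _)

theorem IsDensity.norm_density_le {C : Set ℝ} {H : ℝ → ℝ} {G : LineL2}
    (h : IsDensity C H G) : ‖density C H‖ ≤ ‖G‖ := by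
  rw [h.density_eq_starProjection]
  exact Submodule.norm_starProjection_apply_le _ _

theorem HasL2Density.density_congr {C : Set ℝ} {H H' : ℝ → ℝ} (h : HasL2Density C H)
    (hH : EqOn H H' C) : density C H = density C H' :=
  ((h.isDensity.congr hH).density_eq (density_mem _ _)).symm

theorem HasL2Density.add {C : Set ℝ} {H H' : ℝ → ℝ} (h : HasL2Density C H)
    (h' : HasL2Density C H') : HasL2Density C (H + H') :=
  ⟨_, h.isDensity.add h'.isDensity⟩

theorem HasL2Density.smul {C : Set ℝ} {H : ℝ → ℝ} (h : HasL2Density C H) (c : ℝ) :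
    HasL2Density C (c • H) :=
  ⟨_, h.isDensity.smul c⟩

theorem HasL2Density.sub {C : Set ℝ} {H H' : ℝ → ℝ} (h : HasL2Density C H)
    (h' : HasL2Density C H') : HasL2Density C (H - H') :=
  ⟨_, h.isDensity.sub h'.isDensity⟩

theorem HasL2Density.density_add {C : Set ℝ} {H H' : ℝ → ℝ} (h : HasL2Density C H)
    (h' : HasL2Density C H') : density C (H + H') = density C H + density C H' :=
  (h.isDensity.add h'.isDensity).density_eq (add_mem (density_mem _ _) (density_mem _ _))

theorem HasL2Density.density_smul {C : Set ℝ} {H : ℝ → ℝ} (h : HasL2Density C H) (c : ℝ) :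
    density C (c • H) = c • density C H :=
  (h.isDensity.smul c).density_eq (Submodule.smul_mem _ _ (density_mem _ _))

theorem HasL2Density.density_sub {C : Set ℝ} {H H' : ℝ → ℝ} (h : HasL2Density C H)
    (h' : HasL2Density C H') : density C (H - H') = density C H - density C H' :=
  (h.isDensity.sub h'.isDensity).density_eq (sub_mem (density_mem _ _) (density_mem _ _))

theorem HasL2Density.continuousOn {C : Set ℝ} {H : ℝ → ℝ} (h : HasL2Density C H) :
    ContinuousOn H C :=
  h.isDensity.continuousOn

/-- A function with a density along `C` coincides on `C` with one that has the same density on the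
whole line. -/
theorem HasL2Density.exists_extension {C : Set ℝ} {H : ℝ → ℝ} (h : HasL2Density C H) :
    ∃ H', EqOn H H' C ∧ IsDensity univ H' (density C H) := by
  rcases C.eq_empty_or_nonempty with rfl | ⟨a, ha⟩
  · exact ⟨_, eqOn_empty _ _, primitive_isDensity 0 0 _⟩
  · exact ⟨_, h.isDensity.eqOn_primitive ha, primitive_isDensity _ _ _⟩

/-- A function whose increments are dominated by the integrals of a square integrable function has
a square integrable density. -/
theorem exists_isDensity_of_abs_sub_le {H : ℝ → ℝ} {M : LineL2}
    (h : ∀ x y, x ≤ y → |H y - H x| ≤ ∫ t in x..y, M t) :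
    ∃ G, IsDensity univ H G ∧ ‖G‖ ≤ ‖M‖ := by
  -- The primitive of `M` is absolutely continuous, and domination of increments hands this on to
  -- `H`.
  have hac : ∀ a b, AbsolutelyContinuousOnInterval H a b := by
    intro a b
    have hM := (M.intervalIntegrable a b).absolutelyContinuousOnInterval_intervalIntegral
      (c := a) (by simp)
    unfold AbsolutelyContinuousOnInterval at hM ⊢
    refine squeeze_zero (fun E => Finset.sum_nonneg fun _ _ => dist_nonneg) (fun E => ?_) hM
    refine Finset.sum_le_sum fun i _ => ?_
    rw [dist_comm (H _), dist_comm (∫ _ in _.._, _), Real.dist_eq, Real.dist_eq,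
      intervalIntegral.integral_interval_sub_left (M.intervalIntegrable _ _)
      (M.intervalIntegrable _ _)]
    rcases le_total (E.2 i).1 (E.2 i).2 with hle | hle
    · exact (h _ _ hle).trans (le_abs_self _)
    · rw [abs_sub_comm, intervalIntegral.integral_symm, abs_neg]
      exact (h _ _ hle).trans (le_abs_self _)
  have hdiff : ∀ᵐ x, DifferentiableAt ℝ H x := by
    have : ∀ᵐ x, ∀ n : ℕ, x ∈ uIcc (-(n : ℝ)) n → DifferentiableAt ℝ H x :=
      ae_all_iff.2 fun n => (hac _ _).ae_differentiableAt
    filter_upwards [this] with x hx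
    obtain ⟨n, hn⟩ := exists_nat_ge |x|
    refine hx n ?_
    rw [uIcc_of_le (by linarith [abs_nonneg x])]
    exact abs_le.1 hn
  -- Compare right difference quotients of `H` with those of the primitive of `M`, and apply
  -- Lebesgue differentiation to the latter.
  have hbound : ∀ᵐ x, |deriv H x| ≤ M x := by
    filter_upwards [hdiff, LocallyIntegrable.ae_hasDerivAt_integral M.locallyIntegrable]
      with x hx hx'
    have h₁ : Tendsto (fun y => |slope H x y|) (𝓝[>] x) (𝓝 |deriv H x|) :=
      ((hasDerivAt_iff_tendsto_slope.1 hx.hasDerivAt).mono_left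
        (nhdsWithin_mono _ fun y hy => ne_of_gt hy)).abs
    have h₂ : Tendsto (fun y => slope (fun y => ∫ t in x..y, M t) x y) (𝓝[>] x) (𝓝 (M x)) :=
      (hasDerivAt_iff_tendsto_slope.1 (hx' x)).mono_left
        (nhdsWithin_mono _ fun y hy => ne_of_gt hy)
    refine le_of_tendsto_of_tendsto h₁ h₂ ?_
    filter_upwards [self_mem_nhdsWithin] with y hy
    have hy' : 0 < y - x := sub_pos.2 hy
    rw [slope_def_field, slope_def_field, intervalIntegral.integral_same, sub_zero, abs_div,
      abs_of_pos hy']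
    exact div_le_div_of_nonneg_right (h _ _ (le_of_lt hy)) hy'.le
  have hmem : MemLp (deriv H) 2 volume :=
    (Lp.memLp M).mono (measurable_deriv H).aestronglyMeasurable (by
      filter_upwards [hbound] with x hx
      rw [Real.norm_eq_abs, Real.norm_eq_abs]
      exact hx.trans (le_abs_self _))
  refine ⟨hmem.toLp _, fun x _ y _ => ?_, ?_⟩
  · rw [← (hac x y).integral_deriv_eq_sub]
    refine intervalIntegral.integral_congr_ae ?_
    filter_upwards [hmem.coeFn_toLp] with t ht _
    exact ht.symm
  · refine Lp.norm_le_norm_of_ae_le ?_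
    filter_upwards [hmem.coeFn_toLp, hbound] with x hx hx'
    rw [hx, Real.norm_eq_abs, Real.norm_eq_abs]
    exact hx'.trans (le_abs_self _)

theorem LineL2.integral_abs_eq (G : LineL2) (x y : ℝ) :
    ∫ t in x..y, (|G| : LineL2) t = ∫ t in x..y, |G t| := by
  refine intervalIntegral.integral_congr_ae ?_
  filter_upwards [Lp.coeFn_abs G] with t ht _
  exact ht

theorem IsDensity.abs_sub_le {H : ℝ → ℝ} {G : LineL2} (h : IsDensity univ H G) {x y : ℝ}
    (hxy : x ≤ y) : |H y - H x| ≤ ∫ t in x..y, (|G| : LineL2) t := by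
  rw [h x (mem_univ x) y (mem_univ y), G.integral_abs_eq]
  exact intervalIntegral.abs_integral_le_integral_abs hxy

/-- Normal contractions operate. -/
theorem IsDensity.contraction {H : ℝ → ℝ} {G : LineL2} (h : IsDensity univ H G) {φ : ℝ → ℝ}
    (hφ : ∀ s t, |φ s - φ t| ≤ |s - t|) :
    ∃ G', IsDensity univ (φ ∘ H) G' ∧ ‖G'‖ ≤ ‖G‖ := by
  obtain ⟨G', h₁, h₂⟩ := exists_isDensity_of_abs_sub_le (H := φ ∘ H) (M := |G|)
    fun x y hxy => (hφ _ _).trans (h.abs_sub_le hxy)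
  exact ⟨G', h₁, h₂.trans_eq (norm_abs_eq_norm G)⟩

/-- The Leibniz splitting of an increment bounds it by the integral of `a₁ |G₂| + a₂ |G₁|`, so the
domination criterion applies. -/
theorem IsDensity.mul {H₁ H₂ : ℝ → ℝ} {G₁ G₂ : LineL2} (h₁ : IsDensity univ H₁ G₁)
    (h₂ : IsDensity univ H₂ G₂) {a₁ a₂ : ℝ} (ha₁ : ∀ x, |H₁ x| ≤ a₁) (ha₂ : ∀ x, |H₂ x| ≤ a₂) :
    ∃ G, IsDensity univ (H₁ * H₂) G ∧ ‖G‖ ≤ a₁ * ‖G₂‖ + a₂ * ‖G₁‖ := by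
  have hp₁ : 0 ≤ a₁ := (abs_nonneg _).trans (ha₁ 0)
  have hp₂ : 0 ≤ a₂ := (abs_nonneg _).trans (ha₂ 0)
  obtain ⟨G, hG, hn⟩ := exists_isDensity_of_abs_sub_le (H := H₁ * H₂)
    (M := a₁ • |G₂| + a₂ • |G₁|) fun x y hxy => by
      rw [← inner_intervalKernel, inner_add_right, inner_smul_right, inner_smul_right,
        inner_intervalKernel, inner_intervalKernel]
      have e : (H₁ * H₂) y - (H₁ * H₂) x = H₁ y * (H₂ y - H₂ x) + H₂ x * (H₁ y - H₁ x) := by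
        simp only [Pi.mul_apply]; ring
      rw [e]
      refine (abs_add_le _ _).trans ?_
      rw [abs_mul, abs_mul]
      exact add_le_add
        (mul_le_mul (ha₁ y) (h₂.abs_sub_le hxy) (abs_nonneg _) hp₁)
        (mul_le_mul (ha₂ x) (h₁.abs_sub_le hxy) (abs_nonneg _) hp₂)
  refine ⟨G, hG, hn.trans ((norm_add_le _ _).trans_eq ?_)⟩
  rw [norm_smul, norm_smul, norm_abs_eq_norm, norm_abs_eq_norm, Real.norm_of_nonneg hp₁,
    Real.norm_of_nonneg hp₂]

/-- Lipschitz functions that are constant on both sides of an interval have square integrable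
densities. -/
theorem exists_isDensity_of_lipschitz {H : ℝ → ℝ} {c R : ℝ} (hc : 0 ≤ c) (hR : 0 ≤ R)
    (h : ∀ x y, |H x - H y| ≤ c * |x - y|) (hH : ∀ x, H x = H (max (-R) (min x R))) :
    ∃ G, IsDensity univ H G ∧ ‖G‖ ≤ c * √(2 * R) := by
  -- Increments arise only inside `[-R, R]`, so `c` times the indicator of `(-R, R]` dominates; its
  -- norm is `c √(2R)`.
  obtain ⟨G, hG, hn⟩ := exists_isDensity_of_abs_sub_le (H := H)
    (M := c • indicatorConstLp 2 (measurableSet_Ioc (a := -R) (b := R)) (by simp) 1)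
    fun x y hxy => by
      rw [hH x, hH y, ← inner_intervalKernel, inner_smul_right, intervalKernel, inner_sub_left,
        L2.real_inner_indicatorConstLp_one_indicatorConstLp_one (μ := volume)
          (measurableSet_Ioc (a := x) (b := y)) measurableSet_Ioc (by simp) (by simp),
        L2.real_inner_indicatorConstLp_one_indicatorConstLp_one (μ := volume)
          (measurableSet_Ioc (a := y) (b := x)) measurableSet_Ioc (by simp) (by simp),
          Ioc_inter_Ioc, Ioc_inter_Ioc,
        Measure.real, Measure.real, Real.volume_Ioc, Real.volume_Ioc]
      refine (h _ _).trans (mul_le_mul_of_nonneg_left ?_ hc)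
      rw [ENNReal.toReal_ofReal', ENNReal.toReal_ofReal']
      have hm : max (-R) (min x R) ≤ max (-R) (min y R) := by gcongr
      rw [abs_of_nonneg (sub_nonneg.2 hm)]
      grind
  refine ⟨G, hG, hn.trans_eq ?_⟩
  rw [norm_smul, Real.norm_of_nonneg hc, norm_indicatorConstLp (by simp) (by simp), Measure.real,
    Real.volume_Ioc, ENNReal.toReal_ofReal (by linarith), norm_one, one_mul, Real.sqrt_eq_rpow]
  congr 2
  ring

/-- Pointwise convergence along `C` and boundedness imply weak convergence of the minimal
densities. -/
theorem tendsto_inner_density {C : Set ℝ} {H : ℕ → ℝ → ℝ} {H₀ : ℝ → ℝ} {c : ℝ}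
    (hH : ∀ k, HasL2Density C (H k)) (hH₀ : HasL2Density C H₀)
    (hc : ∀ k, ‖density C (H k)‖ ≤ c)
    (hlim : ∀ x ∈ C, Tendsto (fun k => H k x) atTop (𝓝 (H₀ x))) (z : LineL2) :
    Tendsto (fun k => inner ℝ z (density C (H k))) atTop (𝓝 (inner ℝ z (density C H₀))) := by
  suffices hs : ∀ z ∈ traceSpace C, Tendsto (fun k => inner ℝ z (density C (H k))) atTop
      (𝓝 (inner ℝ z (density C H₀))) by
    -- Against minimal densities `z` may be replaced by its projection to the trace space.
    have key : ∀ G ∈ traceSpace C,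
        inner ℝ z G = inner ℝ ((traceSpace C).starProjection z) G := by
      intro G hG
      rw [← sub_eq_zero, ← inner_sub_left]
      exact Submodule.starProjection_inner_eq_zero _ _ hG
    simp only [key _ (density_mem C _)]
    exact hs _ (Submodule.starProjection_apply_mem _ _)
  have hc0 : 0 ≤ c := (norm_nonneg _).trans (hc 0)
  set S := Submodule.span ℝ {k | ∃ x ∈ C, ∃ y ∈ C, k = intervalKernel x y} with hS
  have hspan : ∀ z ∈ S, Tendsto (fun k => inner ℝ z (density C (H k))) atTop
      (𝓝 (inner ℝ z (density C H₀))) := by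
    intro z hz
    induction hz using Submodule.span_induction with
    | mem k hk =>
      obtain ⟨x, hx, y, hy, rfl⟩ := hk
      simp only [inner_intervalKernel]
      rw [← hH₀.isDensity x hx y hy]
      simp only [← (hH _).isDensity x hx y hy]
      exact (hlim y hy).sub (hlim x hx)
    | zero => simp
    | add a b _ _ ha hb => simpa only [inner_add_left] using ha.add hb
    | smul t a _ ha => simpa only [inner_smul_left] using ha.const_mul _
  intro z hz
  rw [Metric.tendsto_atTop]
  intro ε hε
  -- The first two summands bound the norm of a difference of densities; the `1` only makes `b`
  -- positive. On the span convergence is convergence of increments, and this bound extends it to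
  -- the closure.
  set b := c + ‖density C H₀‖ + 1 with hb
  have hb0 : 0 < b := by positivity
  obtain ⟨w, hw, hzw⟩ := Metric.mem_closure_iff.1 (show z ∈ closure (S : Set LineL2) from hz)
    (ε / (2 * b)) (by positivity)
  obtain ⟨N, hN⟩ := Metric.tendsto_atTop.1 (hspan w hw) (ε / 2) (by positivity)
  refine ⟨N, fun k hk => ?_⟩
  have h₁ := hN k hk
  rw [Real.dist_eq] at h₁ ⊢
  have e : inner ℝ z (density C (H k)) - inner ℝ z (density C H₀) =
      inner ℝ (z - w) (density C (H k) - density C H₀) +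
      (inner ℝ w (density C (H k)) - inner ℝ w (density C H₀)) := by
    rw [inner_sub_left, inner_sub_right, inner_sub_right]; ring
  rw [e]
  have h₂ : |inner ℝ (z - w) (density C (H k) - density C H₀)| ≤ ε / (2 * b) * b := by
    refine (abs_real_inner_le_norm _ _).trans (mul_le_mul ?_ ?_ (norm_nonneg _) (by positivity))
    · rw [← dist_eq_norm]; exact hzw.le
    · refine (norm_sub_le _ _).trans ?_
      linarith [hc k]
  have h₃ : ε / (2 * b) * b = ε / 2 := by field_simp
  linarith [abs_add_le (inner ℝ (z - w) (density C (H k) - density C H₀))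
    (inner ℝ w (density C (H k)) - inner ℝ w (density C H₀))]

/-! ### Forms given by families of functions -/

namespace L2Form

variable {X : Type*} [MeasurableSpace X] {μ : Measure X}

/-- The definition selects representatives by choice; the value is independent of them once `e`
respects equality almost everywhere in one slot and is symmetric. -/
theorem ofFunctions_form {A : Type*} {V : Set A} {ev : A → X → ℝ} {e : A → A → ℝ}
    (hcongr : ∀ a ∈ V, ∀ b ∈ V, ev a =ᵐ[μ] ev b → ∀ c ∈ V, e a c = e b c)
    (hsymm : ∀ a ∈ V, ∀ b ∈ V, e a b = e b a) {u v : Lp ℝ 2 μ} {a b : A} (ha : a ∈ V)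
    (hb : b ∈ V) (hu : u =ᵐ[μ] ev a) (hv : v =ᵐ[μ] ev b) :
    (ofFunctions μ V ev e).form u v = e a b := by
  have h : (∃ a ∈ V, u =ᵐ[μ] ev a) ∧ (∃ b ∈ V, v =ᵐ[μ] ev b) := ⟨⟨a, ha, hu⟩, b, hb, hv⟩
  have h₀ : (ofFunctions μ V ev e).form u v = e h.1.choose h.2.choose := by
    simp only [ofFunctions]
    rw [dif_pos h]
  obtain ⟨ha', hu'⟩ := h.1.choose_spec
  obtain ⟨hb', hv'⟩ := h.2.choose_spec
  rw [h₀, hcongr _ ha' _ ha (hu'.symm.trans hu) _ hb', hsymm _ ha _ hb',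
    hcongr _ hb' _ hb (hv'.symm.trans hv) _ ha, hsymm _ hb _ ha]

theorem ofFunctions_congr {A A' : Type*} {V : Set A} {ev : A → X → ℝ} {e : A → A → ℝ}
    {V' : Set A'} {ev' : A' → X → ℝ} {e' : A' → A' → ℝ}
    (h₁ : ∀ a ∈ V, ∃ a' ∈ V', ev a =ᵐ[μ] ev' a') (h₂ : ∀ a' ∈ V', ∃ a ∈ V, ev a =ᵐ[μ] ev' a')
    (he : ∀ a ∈ V, ∀ a' ∈ V', ev a =ᵐ[μ] ev' a' → ∀ b ∈ V, ∀ b' ∈ V', ev b =ᵐ[μ] ev' b' →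
      e a b = e' a' b') :
    ofFunctions μ V ev e = ofFunctions μ V' ev' e' := by
  have hdom : ∀ u : Lp ℝ 2 μ, (∃ a ∈ V, u =ᵐ[μ] ev a) ↔ ∃ a ∈ V', u =ᵐ[μ] ev' a := by
    intro u
    constructor
    · rintro ⟨a, ha, hu⟩
      obtain ⟨a', ha', h⟩ := h₁ a ha
      exact ⟨a', ha', hu.trans h⟩
    · rintro ⟨a, ha, hu⟩
      obtain ⟨a', ha', h⟩ := h₂ a ha
      exact ⟨a', ha', hu.trans h.symm⟩
  unfold ofFunctions
  congr 1
  · ext u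
    exact hdom u
  · funext u v
    by_cases h : (∃ a ∈ V, u =ᵐ[μ] ev a) ∧ (∃ b ∈ V, v =ᵐ[μ] ev b)
    · have h' : (∃ a ∈ V', u =ᵐ[μ] ev' a) ∧ (∃ b ∈ V', v =ᵐ[μ] ev' b) :=
        ⟨(hdom u).1 h.1, (hdom v).1 h.2⟩
      rw [dif_pos h, dif_pos h']
      exact he _ h.1.choose_spec.1 _ h'.1.choose_spec.1
        (h.1.choose_spec.2.symm.trans h'.1.choose_spec.2) _ h.2.choose_spec.1 _
        h'.2.choose_spec.1 (h.2.choose_spec.2.symm.trans h'.2.choose_spec.2)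
    · have h' : ¬((∃ a ∈ V', u =ᵐ[μ] ev' a) ∧ (∃ b ∈ V', v =ᵐ[μ] ev' b)) := by
        rw [← hdom, ← hdom]
        exact h
      rw [dif_neg h, dif_neg h']

end L2Form

/-! ### The trace form on a closed subset of the line -/

/-- `X` is identified by `ι` with the closed set `C` without finitely many of its extremal points,
none of them isolated in `C`, and `μ` is a fully supported measure on `X`, finite on compacts. -/
structure IsTraceEmbedding {X : Type*} [TopologicalSpace X] [MeasurableSpace X] (C : Set ℝ)
    (ι : X → ℝ) (μ : Measure X) : Prop where
  nonempty : Nonempty X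
  isClosed : IsClosed C
  isEmbedding : IsEmbedding ι
  mem : ∀ x, ι x ∈ C
  finite : (C \ range ι).Finite
  subset_closure : C ⊆ closure (range ι)
  extremal : ∀ b ∈ C \ range ι, (∀ c ∈ C, b ≤ c) ∨ ∀ c ∈ C, c ≤ b
  finite_compact : IsFiniteMeasureOnCompacts μ
  open_pos : μ.IsOpenPosMeasure

/-- The functions on `C` with square integrable density and vanishing at the missing points whose
restrictions are square integrable. -/
def traceDomain {X : Type*} [MeasurableSpace X] (C : Set ℝ) (ι : X → ℝ) (μ : Measure X) :
    Set (ℝ → ℝ) :=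
  {H | HasL2Density C H ∧ (∀ x ∈ C \ range ι, H x = 0) ∧ MemLp (fun x => H (ι x)) 2 μ}

/-- The form with values `½ ∫ G G'`, `G` and `G'` the minimal densities. -/
def traceForm {X : Type*} [MeasurableSpace X] (C : Set ℝ) (ι : X → ℝ) (μ : Measure X) :
    L2Form μ :=
  L2Form.ofFunctions μ (traceDomain C ι μ) (fun H x => H (ι x))
    fun H H' => (1 / 2) * inner ℝ (density C H) (density C H')

section TraceDomain

variable {X : Type*} [MeasurableSpace X] {C : Set ℝ} {ι : X → ℝ} {μ : Measure X}
  {H H' : ℝ → ℝ}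

theorem traceDomain_add (h : H ∈ traceDomain C ι μ) (h' : H' ∈ traceDomain C ι μ) :
    H + H' ∈ traceDomain C ι μ :=
  ⟨h.1.add h'.1, fun x hx => by rw [Pi.add_apply, h.2.1 x hx, h'.2.1 x hx, add_zero],
    h.2.2.add h'.2.2⟩

theorem traceDomain_smul (h : H ∈ traceDomain C ι μ) (c : ℝ) : c • H ∈ traceDomain C ι μ :=
  ⟨h.1.smul c, fun x hx => by rw [Pi.smul_apply, h.2.1 x hx, smul_zero], h.2.2.const_smul c⟩

theorem traceDomain_sub (h : H ∈ traceDomain C ι μ) (h' : H' ∈ traceDomain C ι μ) :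
    H - H' ∈ traceDomain C ι μ :=
  ⟨h.1.sub h'.1, fun x hx => by rw [Pi.sub_apply, h.2.1 x hx, h'.2.1 x hx, sub_zero],
    h.2.2.sub h'.2.2⟩

theorem traceDomain_zero : (0 : ℝ → ℝ) ∈ traceDomain C ι μ :=
  ⟨⟨0, isDensity_const C 0⟩, fun _ _ => rfl, MemLp.zero⟩

theorem MeasureTheory.Lp.sub_ae_eq {u v : Lp ℝ 2 μ} {f g : X → ℝ}
    (hu : u =ᵐ[μ] f) (hv : v =ᵐ[μ] g) :
    (u - v : Lp ℝ 2 μ) =ᵐ[μ] f - g :=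
  (Lp.coeFn_sub u v).trans (hu.sub hv)

/-- The contraction is applied to the extension of `H` to the whole line whose density is the
minimal one, so the norm cannot grow. The condition `φ 0 = 0` keeps the zeros at the missing points
and the square integrability. -/
theorem traceDomain_comp (hH : H ∈ traceDomain C ι μ) {φ : ℝ → ℝ} (hφ0 : φ 0 = 0)
    (hφ : ∀ s t, |φ s - φ t| ≤ |s - t|) :
    φ ∘ H ∈ traceDomain C ι μ ∧ ‖density C (φ ∘ H)‖ ≤ ‖density C H‖ := by
  obtain ⟨H₁, he, hd⟩ := hH.1.exists_extension
  obtain ⟨G, hG, hn⟩ := hd.contraction hφ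
  have hG' : IsDensity C (φ ∘ H) G :=
    (hG.mono (subset_univ C)).congr fun x hx => congrArg φ (he hx).symm
  have hcont : Continuous φ := by
    refine (LipschitzWith.of_dist_le_mul (K := 1) fun s t => ?_).continuous
    rw [NNReal.coe_one, one_mul]
    exact hφ s t
  refine ⟨⟨⟨G, hG'⟩, fun x hx => ?_, ?_⟩, hG'.norm_density_le.trans hn⟩
  · rw [Function.comp_apply, hH.2.1 x hx, hφ0]
  · refine hH.2.2.mono (hcont.comp_aestronglyMeasurable hH.2.2.aestronglyMeasurable)
      (Eventually.of_forall fun x => ?_)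
    have := hφ (H (ι x)) 0
    rwa [hφ0, sub_zero, sub_zero] at this

end TraceDomain

/-! ### The trace form is a Dirichlet form in the wide sense -/

namespace IsTraceEmbedding

variable {X : Type*} [TopologicalSpace X] [MeasurableSpace X] {C : Set ℝ}
  {ι : X → ℝ} {μ : Measure X} {H H' : ℝ → ℝ} (h : IsTraceEmbedding C ι μ)

include h

theorem continuous_comp (hH : ContinuousOn H C) : Continuous fun x => H (ι x) :=
  hH.comp_continuous h.isEmbedding.continuous h.mem

theorem eqOn_of_eqOn_range (hH : ContinuousOn H C) (hH' : ContinuousOn H' C)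
    (he : ∀ x, H (ι x) = H' (ι x)) : EqOn H H' C := by
  have h₁ : EqOn H H' (range ι) := by
    rintro _ ⟨x, rfl⟩
    exact he x
  exact h₁.of_subset_closure hH hH' (range_subset_iff.2 h.mem) h.subset_closure

/-- Functions with a density are continuous on `C`, and full support turns almost everywhere into
everywhere on the range of `ι`. The missing points are limits of this range. -/
theorem eqOn_of_ae_eq [BorelSpace X] (hH : HasL2Density C H) (hH' : HasL2Density C H')
    (he : (fun x => H (ι x)) =ᵐ[μ] fun x => H' (ι x)) : EqOn H H' C := by
  have := h.open_pos
  refine h.eqOn_of_eqOn_range hH.continuousOn hH'.continuousOn fun x => ?_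
  exact congrFun (((h.continuous_comp hH.continuousOn).ae_eq_iff_eq μ
    (h.continuous_comp hH'.continuousOn)).1 he) x

theorem traceForm_form [BorelSpace X] {u v : Lp ℝ 2 μ} (hH : H ∈ traceDomain C ι μ)
    (hH' : H' ∈ traceDomain C ι μ) (hu : u =ᵐ[μ] fun x => H (ι x))
    (hv : v =ᵐ[μ] fun x => H' (ι x)) :
    (traceForm C ι μ).form u v = (1 / 2) * inner ℝ (density C H) (density C H') := by
  refine L2Form.ofFunctions_form (fun a ha b hb hab c _ => ?_) (fun a _ b _ => ?_) hH hH' hu hv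
  · rw [ha.1.density_congr (h.eqOn_of_ae_eq ha.1 hb.1 hab)]
  · rw [real_inner_comm]

theorem traceForm_normOne [BorelSpace X] {u : Lp ℝ 2 μ} (hH : H ∈ traceDomain C ι μ)
    (hu : u =ᵐ[μ] fun x => H (ι x)) :
    (traceForm C ι μ).normOne u = (1 / 2) * ‖density C H‖ ^ 2 + ‖u‖ ^ 2 := by
  rw [L2Form.normOne, h.traceForm_form hH hH hu hu, real_inner_self_eq_norm_sq]

/-- A subsequence converges almost everywhere, in particular at some point `e`. Since increments are
inner products of the densities with fixed kernels, it then converges at every point of `C`, to the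
primitive of `G` normalized at `e`. Convergence at every point is what preserves the zeros at the
missing points. -/
theorem exists_trace_limit [BorelSpace X] {u : ℕ → Lp ℝ 2 μ} {H : ℕ → ℝ → ℝ}
    (hH : ∀ n, H n ∈ traceDomain C ι μ) (hu : ∀ n, u n =ᵐ[μ] fun x => H n (ι x))
    {v : Lp ℝ 2 μ} (hv : Tendsto u atTop (𝓝 v)) {G : LineL2}
    (hG : Tendsto (fun n => density C (H n)) atTop (𝓝 G)) :
    ∃ H₀ ∈ traceDomain C ι μ, (v =ᵐ[μ] fun x => H₀ (ι x)) ∧ IsDensity C H₀ G := by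
  have := h.open_pos
  have := h.nonempty
  obtain ⟨ns, hns, hae⟩ := (tendstoInMeasure_of_tendsto_Lp hv).exists_seq_tendsto_ae
  have hae' : ∀ᵐ x ∂μ, Tendsto (fun k => H (ns k) (ι x)) atTop (𝓝 (v x)) := by
    have h' : ∀ᵐ x ∂μ, ∀ n, u n x = H n (ι x) := ae_all_iff.2 hu
    filter_upwards [hae, h'] with x hx hx'
    simpa only [hx'] using hx
  obtain ⟨e, he⟩ := hae'.exists
  have hlim : ∀ y ∈ C, Tendsto (fun k => H (ns k) y) atTop (𝓝 (primitive (ι e) (v e) G y)) := by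
    intro y hy
    have h₁ : ∀ k, H (ns k) y = H (ns k) (ι e) +
        inner ℝ (intervalKernel (ι e) y) (density C (H (ns k))) := by
      intro k
      rw [inner_intervalKernel, ← (hH (ns k)).1.isDensity _ (h.mem e) _ hy]
      ring
    simp only [h₁, primitive, ← inner_intervalKernel]
    exact he.add (tendsto_const_nhds.inner (hG.comp hns.tendsto_atTop))
  have hv' : v =ᵐ[μ] fun x => primitive (ι e) (v e) G (ι x) := by
    filter_upwards [hae'] with x hx
    exact tendsto_nhds_unique hx (hlim _ (h.mem x))
  have hd := (primitive_isDensity (ι e) (v e) G).mono (subset_univ C)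
  refine ⟨primitive (ι e) (v e) G, ⟨⟨G, hd⟩, fun x hx => ?_, (memLp_congr_ae hv').1 (Lp.memLp v)⟩,
    hv', hd⟩
  refine tendsto_nhds_unique (hlim x hx.1) ?_
  simp only [(hH _).2.1 x hx]
  exact tendsto_const_nhds

theorem isWideDirichletForm [BorelSpace X] : (traceForm C ι μ).IsWideDirichletForm where
  zero_mem := ⟨0, traceDomain_zero, Lp.coeFn_zero _ _ _⟩
  add_mem := by
    rintro u ⟨H, hH, hu⟩ v ⟨H', hH', hv⟩
    exact ⟨H + H', traceDomain_add hH hH', (Lp.coeFn_add u v).trans (hu.add hv)⟩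
  smul_mem := by
    rintro c u ⟨H, hH, hu⟩
    exact ⟨c • H, traceDomain_smul hH c, (Lp.coeFn_smul c u).trans (hu.const_smul c)⟩
  form_add := by
    rintro u ⟨H, hH, hu⟩ v ⟨H', hH', hv⟩ w ⟨K, hK, hw⟩
    rw [h.traceForm_form hH hK hu hw, h.traceForm_form hH' hK hv hw,
      h.traceForm_form (traceDomain_add hH hH') hK ((Lp.coeFn_add u v).trans (hu.add hv)) hw,
      hH.1.density_add hH'.1, inner_add_left]
    ring
  form_smul := by
    rintro c u ⟨H, hH, hu⟩ w ⟨K, hK, hw⟩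
    rw [h.traceForm_form hH hK hu hw,
      h.traceForm_form (traceDomain_smul hH c) hK ((Lp.coeFn_smul c u).trans (hu.const_smul c)) hw,
      hH.1.density_smul, real_inner_smul_left]
    ring
  symm := by
    rintro u ⟨H, hH, hu⟩ v ⟨H', hH', hv⟩
    rw [h.traceForm_form hH hH' hu hv, h.traceForm_form hH' hH hv hu, real_inner_comm]
  nonneg := by
    rintro u ⟨H, hH, hu⟩
    rw [h.traceForm_form hH hH hu hu]
    exact mul_nonneg (by norm_num) real_inner_self_nonneg
  closed := by
    intro u hu hcauchy
    choose H hH hu using hu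
    have hN : ∀ p q, (traceForm C ι μ).normOne (u p - u q) =
        (1 / 2) * ‖density C (H p) - density C (H q)‖ ^ 2 + ‖u p - u q‖ ^ 2 := by
      intro p q
      rw [h.traceForm_normOne (traceDomain_sub (hH p) (hH q)) (Lp.sub_ae_eq (hu p) (hu q)),
        (hH p).1.density_sub (hH q).1]
    simp only [hN] at hcauchy
    have hcu : CauchySeq u := by
      rw [Metric.cauchySeq_iff]
      intro ε hε
      obtain ⟨N, hN⟩ := hcauchy (ε ^ 2) (by positivity)
      refine ⟨N, fun p hp q hq => ?_⟩
      rw [dist_eq_norm]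
      refine lt_of_pow_lt_pow_left₀ 2 hε.le ?_
      nlinarith [hN p hp q hq, sq_nonneg ‖density C (H p) - density C (H q)‖]
    have hcG : CauchySeq fun n => density C (H n) := by
      rw [Metric.cauchySeq_iff]
      intro ε hε
      -- The division by `2` compensates the factor `1 / 2` of the form.
      obtain ⟨N, hN⟩ := hcauchy (ε ^ 2 / 2) (by positivity)
      refine ⟨N, fun p hp q hq => ?_⟩
      rw [dist_eq_norm]
      refine lt_of_pow_lt_pow_left₀ 2 hε.le ?_
      nlinarith [hN p hp q hq, sq_nonneg ‖u p - u q‖]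
    obtain ⟨v, hv⟩ := cauchySeq_tendsto_of_complete hcu
    obtain ⟨G, hG⟩ := cauchySeq_tendsto_of_complete hcG
    obtain ⟨H₀, hH₀, hv₀, hd⟩ := h.exists_trace_limit hH hu hv hG
    have hGm : G ∈ traceSpace C :=
      (Submodule.isClosed_topologicalClosure _).mem_of_tendsto hG
        (Eventually.of_forall fun n => density_mem C (H n))
    refine ⟨v, ⟨H₀, hH₀, hv₀⟩, ?_⟩
    have hN' : ∀ n, (traceForm C ι μ).normOne (u n - v) =
        (1 / 2) * ‖density C (H n) - G‖ ^ 2 + ‖u n - v‖ ^ 2 := by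
      intro n
      rw [h.traceForm_normOne (traceDomain_sub (hH n) hH₀) (Lp.sub_ae_eq (hu n) hv₀),
        (hH n).1.density_sub hH₀.1, hd.density_eq hGm]
    simp only [hN']
    have h₁ : Tendsto (fun n => ‖density C (H n) - G‖) atTop (𝓝 0) :=
      tendsto_iff_norm_sub_tendsto_zero.1 hG
    have h₂ : Tendsto (fun n => ‖u n - v‖) atTop (𝓝 0) := tendsto_iff_norm_sub_tendsto_zero.1 hv
    simpa only [ne_eq, OfNat.ofNat_ne_zero, not_false_eq_true, zero_pow, mul_zero, add_zero] using
      ((h₁.pow 2).const_mul (1 / 2)).add (h₂.pow 2)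
  markov := by
    rintro u ⟨H, hH, hu⟩ v hv
    have hφ : ∀ s t : ℝ, |max 0 (min s 1) - max 0 (min t 1)| ≤ |s - t| := by
      intro s t
      grind
    obtain ⟨hm, hn⟩ := traceDomain_comp hH (φ := fun t => max 0 (min t 1)) (by simp) hφ
    have hv' : v =ᵐ[μ] fun x => ((fun t => max 0 (min t 1)) ∘ H) (ι x) := by
      filter_upwards [hv, hu] with x hx hx'
      rw [hx, hx', Function.comp_apply]
    refine ⟨⟨_, hm, hv'⟩, ?_⟩
    rw [h.traceForm_form hm hm hv' hv', h.traceForm_form hH hH hu hu, real_inner_self_eq_norm_sq,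
      real_inner_self_eq_norm_sq]
    gcongr

end IsTraceEmbedding

/-! ### Topology of the space, cutoffs and uniform approximation -/

namespace IsTraceEmbedding

variable {X : Type*} [TopologicalSpace X] [MeasurableSpace X] {C : Set ℝ}
  {ι : X → ℝ} {μ : Measure X} {H H' : ℝ → ℝ} (h : IsTraceEmbedding C ι μ)

include h

/-- A closed set without finitely many points is locally closed, and so `X` is locally compact. -/
theorem range_eq : range ι = C ∩ (C \ range ι)ᶜ := by
  ext y
  constructor
  · rintro ⟨x, rfl⟩
    exact ⟨h.mem x, fun hy => hy.2 ⟨x, rfl⟩⟩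
  · rintro ⟨hy, hy'⟩
    by_contra hc
    exact hy' ⟨hy, hc⟩

theorem isLocallyClosed_range : IsLocallyClosed (range ι) := by
  rw [h.range_eq]
  exact h.isClosed.isLocallyClosed.inter h.finite.isClosed.isOpen_compl.isLocallyClosed

theorem locallyCompactSpace : LocallyCompactSpace X :=
  h.isEmbedding.isInducing.locallyCompactSpace h.isLocallyClosed_range

theorem metrizableSpace : TopologicalSpace.MetrizableSpace X := h.isEmbedding.metrizableSpace

theorem secondCountableTopology : SecondCountableTopology X :=
  h.isEmbedding.secondCountableTopology

theorem regular [BorelSpace X] : μ.Regular := by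
  have := h.locallyCompactSpace
  have := h.secondCountableTopology
  have := h.metrizableSpace
  have := h.finite_compact
  have : IsLocallyFiniteMeasure μ := isLocallyFiniteMeasure_of_isFiniteMeasureOnCompacts
  let := TopologicalSpace.metrizableSpaceMetric X
  infer_instance

theorem isCompact_preimage {K : Set ℝ} (hK : IsCompact K) (hKB : ∀ x ∈ K, x ∉ C \ range ι) :
    IsCompact (ι ⁻¹' K) := by
  have e : ι ⁻¹' K = ι ⁻¹' (K ∩ C) := by
    ext x
    exact ⟨fun hx => ⟨hx, h.mem x⟩, fun hx => hx.1⟩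
  rw [e]
  refine h.isEmbedding.isInducing.isCompact_preimage' (hK.inter_right h.isClosed) ?_
  rintro x ⟨hx, hx'⟩
  by_contra hc
  exact hKB x hx ⟨hx', hc⟩

theorem mem_traceDomain_of_hasCompactSupport [BorelSpace X] (hH : HasL2Density C H)
    (hB : ∀ x ∈ C \ range ι, H x = 0) (hc : HasCompactSupport fun x => H (ι x)) :
    H ∈ traceDomain C ι μ := by
  have := h.finite_compact
  exact ⟨hH, hB, (h.continuous_comp hH.continuousOn).memLp_of_hasCompactSupport hc⟩

/-- Cutoff functions. -/
theorem exists_cutoff {K : Set X} (hK : IsCompact K) :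
    ∃ χ G, IsDensity univ χ G ∧ (∀ x, 0 ≤ χ x ∧ χ x ≤ 1) ∧ (∀ x ∈ K, χ (ι x) = 1) ∧
      HasCompactSupport (fun x => χ (ι x)) ∧ ∀ x ∈ C \ range ι, χ x = 0 := by
  have := h.isEmbedding.t2Space
  rcases K.eq_empty_or_nonempty with rfl | hne
  · exact ⟨fun _ => 0, 0, isDensity_const _ 0, by simp, by simp, HasCompactSupport.zero, by simp⟩
  have hK' : IsCompact (ι '' K) := hK.image h.isEmbedding.continuous
  -- The finitely many missing points are off the compact image of `K`, hence off a closed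
  -- `δ`-thickening of it. A tent function of the distance to the image, of slope `1 / δ`, therefore
  -- vanishes at the missing points.
  obtain ⟨δ, hδ, hsub⟩ := hK'.exists_cthickening_subset_open h.finite.isClosed.isOpen_compl (by
    rintro _ ⟨x, -, rfl⟩ hx
    exact hx.2 ⟨x, rfl⟩)
  have hcpt : IsCompact (Metric.cthickening δ (ι '' K)) := hK'.cthickening
  obtain ⟨R, hR⟩ := hcpt.isBounded.subset_closedBall 0
  have hR0 : 0 ≤ R := by
    obtain ⟨x, hx⟩ := hne
    have := hR (Metric.self_subset_cthickening _ (mem_image_of_mem ι hx))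
    exact dist_nonneg.trans (Metric.mem_closedBall.1 this)
  set d : ℝ → ℝ := fun x => Metric.infDist x (ι '' K) with hd
  have hzero : ∀ x, x ∉ Metric.cthickening δ (ι '' K) → δ ≤ d x := by
    intro x hx
    by_contra! hlt
    obtain ⟨y, hy, hxy⟩ := (Metric.infDist_lt_iff (hne.image ι)).1 hlt
    exact hx (Metric.mem_cthickening_of_dist_le x y δ _ hy hxy.le)
  have hlip : ∀ x y, |d x - d y| ≤ |x - y| := by
    intro x y
    have := (Metric.lipschitz_infDist_pt (ι '' K)).dist_le_mul x y
    rwa [NNReal.coe_one, one_mul, Real.dist_eq, Real.dist_eq] at this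
  set χ : ℝ → ℝ := fun x => max 0 (1 - d x / δ) with hχ
  have hχ0 : ∀ x, x ∉ Metric.cthickening δ (ι '' K) → χ x = 0 := by
    intro x hx
    refine max_eq_left ?_
    rw [sub_nonpos, le_div_iff₀ hδ, one_mul]
    exact hzero x hx
  have hball : ∀ x, R + 1 ≤ |x| → χ x = 0 := by
    intro x hx
    refine hχ0 x fun hc => ?_
    have := Metric.mem_closedBall.1 (hR hc)
    rw [Real.dist_eq, sub_zero] at this
    linarith
  obtain ⟨G, hG, -⟩ := exists_isDensity_of_lipschitz (H := χ) (c := 1 / δ) (R := R + 1)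
    (by positivity) (by positivity) (by
      intro x y
      have h₁ : |χ x - χ y| ≤ |(1 - d x / δ) - (1 - d y / δ)| := by
        simp only [hχ]
        rw [max_comm 0, max_comm 0]
        exact abs_max_sub_max_le_abs _ _ _
      refine h₁.trans ?_
      have h₂ : (1 - d x / δ) - (1 - d y / δ) = -((1 / δ) * (d x - d y)) := by ring
      rw [h₂, abs_neg, abs_mul, abs_of_pos (one_div_pos.2 hδ)]
      exact mul_le_mul_of_nonneg_left (hlip x y) (by positivity)) (by
      intro x
      rcases le_or_gt (R + 1) |x| with hx | hx
      · rw [hball x hx]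
        rcases le_abs.1 hx with hx' | hx'
        · rw [min_eq_right hx', max_eq_right (by linarith), hball]
          rw [abs_of_nonneg (by linarith)]
        · rw [min_eq_left (by linarith), max_eq_left (by linarith), hball]
          rw [abs_neg, abs_of_nonneg (by linarith)]
      · have := abs_lt.1 hx
        rw [min_eq_left this.2.le, max_eq_right this.1.le])
  refine ⟨χ, G, hG, fun x => ⟨le_max_left _ _, max_le zero_le_one ?_⟩, fun x hx => ?_, ?_, ?_⟩
  · have : 0 ≤ d x / δ := div_nonneg Metric.infDist_nonneg hδ.le
    linarith
  · have : d (ι x) = 0 := Metric.infDist_zero_of_mem (mem_image_of_mem ι hx)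
    simp [hχ, this]
  · refine HasCompactSupport.intro (h.isCompact_preimage hcpt fun x hx hx' => hsub hx hx') ?_
    intro x hx
    exact hχ0 _ hx
  · intro x hx
    exact hχ0 x fun hc => hsub hc hx

/-- Compactly supported continuous functions are uniform limits of functions of the domain with
supports in a fixed compact set. -/
theorem exists_uniform_approx [BorelSpace X] {φ : X → ℝ} (hφ : Continuous φ)
    (hφc : HasCompactSupport φ) :
    ∃ K, IsCompact K ∧ Function.support φ ⊆ K ∧ ∀ ε > 0, ∃ H ∈ traceDomain C ι μ,
      Continuous (fun x => H (ι x)) ∧ HasCompactSupport (fun x => H (ι x)) ∧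
      Function.support (fun x => H (ι x)) ⊆ K ∧ ∀ x, |φ x - H (ι x)| < ε := by
  obtain ⟨χ, G, hχ, hχ1, hχK, hχc, hχB⟩ := h.exists_cutoff hφc
  have hφK : ∀ x, φ x = φ x * χ (ι x) := by
    intro x
    by_cases hx : x ∈ tsupport φ
    · rw [hχK x hx, mul_one]
    · rw [image_eq_zero_of_notMem_tsupport hx, zero_mul]
  set K := tsupport fun x => χ (ι x) with hK
  have hKc : IsCompact K := hχc
  refine ⟨K, hKc, fun x hx => subset_tsupport _ ?_, fun ε hε => ?_⟩
  · intro h0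
    apply hx
    rw [hφK]
    exact mul_eq_zero_of_right _ h0
  have : CompactSpace K := isCompact_iff_compactSpace.1 hKc
  -- Stone–Weierstrass for the algebra generated by the coordinate, which separates points because
  -- `ι` is injective: `φ` is approximated on `K` by a polynomial in `ι`.
  set g₀ : C(K, ℝ) := ⟨fun x => ι x, h.isEmbedding.continuous.comp continuous_subtype_val⟩
    with hg₀
  obtain ⟨⟨g, hg⟩, hgφ⟩ := ContinuousMap.exists_mem_subalgebra_near_continuousMap_of_separatesPoints
    (Algebra.adjoin ℝ {g₀}) (by
      intro x y hxy
      refine ⟨_, ⟨g₀, Algebra.subset_adjoin rfl, rfl⟩, fun he => hxy ?_⟩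
      exact Subtype.ext (h.isEmbedding.injective he))
    ⟨fun x => φ x, hφ.comp continuous_subtype_val⟩ ε hε
  rw [Algebra.adjoin_singleton_eq_range_aeval] at hg
  obtain ⟨p, hp⟩ := hg
  have hpφ : ∀ x ∈ K, |φ x - p.eval (ι x)| < ε := by
    intro x hx
    have h₁ := (ContinuousMap.norm_coe_le_norm _ (⟨x, hx⟩ : K)).trans_lt hgφ
    have h₂ : g ⟨x, hx⟩ = p.eval (ι x) := by
      rw [← hp]
      exact Polynomial.aeval_continuousMap_apply p g₀ ⟨x, hx⟩
    rw [ContinuousMap.sub_apply, h₂, Real.norm_eq_abs, abs_sub_comm] at h₁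
    exact h₁
  obtain ⟨R, hR⟩ := (hKc.image h.isEmbedding.continuous).isBounded.subset_closedBall 0
  have hRK : ∀ x ∈ K, |ι x| ≤ max R 0 := by
    intro x hx
    have := Metric.mem_closedBall.1 (hR (mem_image_of_mem ι hx))
    rw [Real.dist_eq, sub_zero] at this
    exact this.trans (le_max_left _ _)
  have hS0 : 0 ≤ max R 0 := le_max_right _ _
  set S := max R 0 with hS
  -- Freezing the polynomial outside `[-S, S]`, which contains the image of `K`, makes it bounded
  -- and Lipschitz. The product with `χ` then has a density and is supported in `K`, and since `φ =
  -- φ χ` the factor `χ ≤ 1` does not spoil the approximation.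
  set P : ℝ → ℝ := fun x => p.eval (max (-S) (min x S)) with hP
  have hmem : ∀ x : ℝ, max (-S) (min x S) ∈ Icc (-S) S := fun x =>
    ⟨le_max_left _ _, max_le (by linarith) (min_le_right _ _)⟩
  obtain ⟨c, hc⟩ := (isCompact_Icc (a := -S) (b := S)).exists_bound_of_continuousOn
    (Polynomial.continuous (Polynomial.derivative p)).continuousOn
  obtain ⟨b, hb⟩ := (isCompact_Icc (a := -S) (b := S)).exists_bound_of_continuousOn
    (Polynomial.continuous p).continuousOn
  have hc0 : 0 ≤ c := (norm_nonneg _).trans (hc 0 ⟨by linarith, hS0⟩)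
  obtain ⟨G', hG', -⟩ := exists_isDensity_of_lipschitz (H := P) hc0 hS0 (by
    intro x y
    have h₁ := (convex_Icc (-S) S).norm_image_sub_le_of_norm_deriv_le (f := fun x => p.eval x)
      (C := c) (fun x _ => p.differentiable x) (fun x hx => by
        rw [Polynomial.deriv]; exact hc x hx) (hmem y) (hmem x)
    refine h₁.trans (mul_le_mul_of_nonneg_left ?_ hc0)
    rw [Real.norm_eq_abs]
    grind) (by
    intro x
    simp only [hP]
    congr 1
    have := hmem x
    rw [min_eq_left this.2, max_eq_right this.1])
  obtain ⟨G'', hG'', -⟩ := hG'.mul hχ (a₁ := b) (a₂ := 1) (fun x => hb _ (hmem x)) (fun x => by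
    rw [abs_of_nonneg (hχ1 x).1]; exact (hχ1 x).2)
  have hsupp : Function.support (fun x => (P * χ) (ι x)) ⊆ K := by
    intro x hx
    refine subset_tsupport _ fun h0 => hx ?_
    simp only [Pi.mul_apply]
    rw [h0, mul_zero]
  have := h.isEmbedding.t2Space
  have hcs : HasCompactSupport (fun x => (P * χ) (ι x)) :=
    HasCompactSupport.intro hKc fun x hx => by
      by_contra hne
      exact hx (hsupp hne)
  refine ⟨P * χ, h.mem_traceDomain_of_hasCompactSupport ⟨G'', hG''.mono (subset_univ _)⟩
    (fun x hx => ?_) hcs, ?_, hcs, hsupp, fun x => ?_⟩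
  · rw [Pi.mul_apply, hχB x hx, mul_zero]
  · exact hG''.continuous.comp h.isEmbedding.continuous
  · by_cases hx : x ∈ K
    · have hPx : P (ι x) = p.eval (ι x) := by
        have := abs_le.1 (hRK x hx)
        simp only [hP]
        rw [min_eq_left this.2, max_eq_right this.1]
      rw [Pi.mul_apply, hφK x, ← sub_mul, abs_mul, hPx, abs_of_nonneg (hχ1 _).1]
      exact (mul_le_of_le_one_right (abs_nonneg _) (hχ1 _).2).trans_lt (hpφ x hx)
    · have h0 : χ (ι x) = 0 := by
        by_contra hne
        exact hx (subset_tsupport _ hne)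
      rw [Pi.mul_apply, hφK x, h0, mul_zero, mul_zero, sub_zero, abs_zero]
      exact hε

/-- `C_c` is dense in `L²` of a Radon measure, and uniform approximation with supports in one
compact set, which has finite measure, is approximation in `L²`. -/
theorem dense_dom [BorelSpace X] : Dense (traceForm C ι μ).dom := by
  have := h.locallyCompactSpace
  have := h.secondCountableTopology
  have := h.metrizableSpace
  have := h.regular
  have := h.finite_compact
  intro u
  rw [Metric.mem_closure_iff]
  intro ε hε
  obtain ⟨φ, hφc, hφu, hφ, hφm⟩ := (Lp.memLp u).exists_hasCompactSupport_eLpNorm_sub_le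
    (by simp) (ε := ENNReal.ofReal (ε / 2)) (by simpa using hε)
  obtain ⟨K, hK, hφK, happ⟩ := h.exists_uniform_approx hφ hφc
  have hKm : MeasurableSet K := hK.isClosed.measurableSet
  have hfin : μ K ^ (1 / (2 : ℝ≥0∞).toReal) ≠ ∞ :=
    ENNReal.rpow_ne_top_of_nonneg (by simp) hK.measure_lt_top.ne
  set a := (μ K ^ (1 / (2 : ℝ≥0∞).toReal)).toReal with ha
  have ha0 : 0 ≤ a := ENNReal.toReal_nonneg
  -- The `L²`-error is at most `a`, the square root of the measure of `K`, times the uniform error;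
  -- adding `1` to `a` keeps the denominator positive.
  obtain ⟨H, hH, -, -, hHK, hHφ⟩ := happ (ε / (4 * (a + 1))) (by positivity)
  refine ⟨hH.2.2.toLp _, ⟨H, hH, hH.2.2.coeFn_toLp⟩, ?_⟩
  have h₁ : eLpNorm (φ - fun x => H (ι x)) 2 μ ≤ ENNReal.ofReal (ε / 4) := by
    refine (eLpNorm_sub_le_of_dist_bdd μ (by simp) hKm (c := ε / (4 * (a + 1))) (by positivity)
      (fun x => (hHφ x).le) hφK hHK).trans ?_
    rw [← ENNReal.ofReal_toReal hfin, ← ENNReal.ofReal_mul (by positivity)]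
    refine ENNReal.ofReal_le_ofReal ?_
    rw [← ha, div_mul_eq_mul_div, div_le_div_iff₀ (by positivity) (by norm_num)]
    nlinarith
  have e : (u : X → ℝ) - (fun x => H (ι x)) = ((u : X → ℝ) - φ) + (φ - fun x => H (ι x)) := by
    rw [sub_add_sub_cancel]
  have h₂ : eLpNorm ((u : X → ℝ) - fun x => H (ι x)) 2 μ ≤ ENNReal.ofReal (3 * ε / 4) := by
    rw [e]
    refine (eLpNorm_add_le ((Lp.aestronglyMeasurable u).sub hφm.1) (hφm.1.sub hH.2.2.1)
      one_le_two).trans ((add_le_add hφu h₁).trans_eq ?_)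
    rw [← ENNReal.ofReal_add (by positivity) (by positivity)]
    congr 1
    ring
  rw [dist_eq_norm]
  have h₃ : ‖u - hH.2.2.toLp _‖ = (eLpNorm ((u : X → ℝ) - fun x => H (ι x)) 2 μ).toReal := by
    rw [Lp.norm_def]
    congr 1
    exact eLpNorm_congr_ae (Lp.sub_ae_eq EventuallyEq.rfl hH.2.2.coeFn_toLp)
  rw [h₃]
  refine (ENNReal.toReal_mono ENNReal.ofReal_ne_top h₂).trans_lt ?_
  rw [ENNReal.toReal_ofReal (by positivity)]
  linarith

end IsTraceEmbedding

/-! ### Truncations and density of the core -/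

/-- Truncation at the levels `±k` followed by a shift by `1 / k` towards zero. -/
def softClamp (k t : ℝ) : ℝ :=
  max (max (-k) (min t k) - 1 / k) 0 - max (-max (-k) (min t k) - 1 / k) 0

theorem softClamp_sub_le {k : ℝ} (hk : 0 < k) (s t : ℝ) :
    |softClamp k s - softClamp k t| ≤ |s - t| := by
  have hd : 0 < 1 / k := by positivity
  have h₁ : |max (-k) (min s k) - max (-k) (min t k)| ≤ |s - t| := by grind
  refine le_trans ?_ h₁
  unfold softClamp
  generalize max (-k) (min s k) = a
  generalize max (-k) (min t k) = b
  generalize 1 / k = d at *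
  grind

theorem softClamp_eq_zero {k t : ℝ} (hk : 1 ≤ k) (ht : |t| ≤ 1 / k) : softClamp k t = 0 := by
  have h₁ : 1 / k ≤ 1 := by rw [div_le_one (by linarith)]; exact hk
  have := abs_le.1 ht
  unfold softClamp
  generalize 1 / k = d at *
  grind

theorem abs_softClamp_le {k : ℝ} (hk : 1 ≤ k) (t : ℝ) : |softClamp k t| ≤ k := by
  have h₁ : 0 < 1 / k := by positivity
  unfold softClamp
  generalize 1 / k = d at *
  grind

theorem abs_softClamp_sub_le {k t : ℝ} (hk : 1 ≤ k) (ht : |t| ≤ k) :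
    |softClamp k t - t| ≤ 1 / k := by
  have h₁ : 0 < 1 / k := by positivity
  have := abs_le.1 ht
  unfold softClamp
  generalize 1 / k = d at *
  grind

theorem abs_softClamp_le_abs {k : ℝ} (hk : 1 ≤ k) (t : ℝ) : |softClamp k t| ≤ |t| := by
  have := softClamp_sub_le (by positivity : 0 < k) t 0
  rwa [softClamp_eq_zero (t := 0) hk (by rw [abs_zero]; positivity), sub_zero, sub_zero] at this

/-- The cutoff function equal to `1` on `[-n, n]` and to `0` off `[-2 n, 2 n]`. -/
def tentCutoff (n x : ℝ) : ℝ := max 0 (min 1 (2 - |x| / n))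

theorem tentCutoff_mem (n x : ℝ) : 0 ≤ tentCutoff n x ∧ tentCutoff n x ≤ 1 :=
  ⟨le_max_left _ _, max_le zero_le_one (min_le_left _ _)⟩

theorem tentCutoff_eq_one {n x : ℝ} (hn : 0 < n) (hx : |x| ≤ n) : tentCutoff n x = 1 := by
  have : |x| / n ≤ 1 := (div_le_one hn).2 hx
  rw [tentCutoff, min_eq_left (by linarith), max_eq_right zero_le_one]

theorem tentCutoff_eq_zero {n x : ℝ} (hn : 0 < n) (hx : 2 * n ≤ |x|) : tentCutoff n x = 0 := by
  have : 2 ≤ |x| / n := (le_div_iff₀ hn).2 hx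
  exact max_eq_left ((min_le_right _ _).trans (by linarith))

theorem tentCutoff_isDensity {n : ℝ} (hn : 0 < n) :
    ∃ G, IsDensity univ (tentCutoff n) G ∧ ‖G‖ ≤ 1 / n * √(2 * (2 * n)) := by
  refine exists_isDensity_of_lipschitz (by positivity) (by positivity) (fun x y => ?_) fun x => ?_
  · have h₁ : |tentCutoff n x - tentCutoff n y| ≤ |(2 - |x| / n) - (2 - |y| / n)| := by
      unfold tentCutoff
      generalize 2 - |x| / n = a
      generalize 2 - |y| / n = b
      grind
    refine h₁.trans ?_
    have h₂ : (2 - |x| / n) - (2 - |y| / n) = -((1 / n) * (|x| - |y|)) := by ring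
    rw [h₂, abs_neg, abs_mul, abs_of_pos (one_div_pos.2 hn)]
    exact mul_le_mul_of_nonneg_left (abs_abs_sub_abs_le_abs_sub _ _) (by positivity)
  · rcases le_or_gt (2 * n) |x| with hx | hx
    · rw [tentCutoff_eq_zero hn hx, tentCutoff_eq_zero hn]
      rcases le_abs.1 hx with hx' | hx'
      · rw [min_eq_right hx', max_eq_right (by linarith)]
        exact le_abs_self _
      · rw [min_eq_left (by linarith), max_eq_left (by linarith), abs_neg]
        exact le_abs_self _
    · have := abs_lt.1 hx
      rw [min_eq_left this.2.le, max_eq_right this.1.le]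

/-- The graph of the minimal density on the continuous compactly supported functions. -/
def coreGraph {X : Type*} [TopologicalSpace X] [MeasurableSpace X] (C : Set ℝ)
    (ι : X → ℝ) (μ : Measure X) : Submodule ℝ (WithLp 2 (LineL2 × Lp ℝ 2 μ)) where
  carrier := {w | ∃ H ∈ traceDomain C ι μ, HasCompactSupport (fun x => H (ι x)) ∧
    w.fst = density C H ∧ w.snd =ᵐ[μ] fun x => H (ι x)}
  zero_mem' := ⟨0, traceDomain_zero, HasCompactSupport.zero,
    ((isDensity_const C 0).density_eq (zero_mem _)).symm, Lp.coeFn_zero _ _ _⟩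
  add_mem' := by
    rintro v w ⟨H, hH, hc, h₁, h₂⟩ ⟨H', hH', hc', h₁', h₂'⟩
    refine ⟨H + H', traceDomain_add hH hH', hc.add hc', ?_, ?_⟩
    · rw [hH.1.density_add hH'.1, ← h₁, ← h₁']
      rfl
    · exact (Lp.coeFn_add v.snd w.snd).trans (h₂.add h₂')
  smul_mem' := by
    rintro c v ⟨H, hH, hc, h₁, h₂⟩
    refine ⟨c • H, traceDomain_smul hH c, hc.smul_left (f := fun _ => c), ?_, ?_⟩
    · rw [hH.1.density_smul, ← h₁]
      rfl
    · exact (Lp.coeFn_smul c v.snd).trans (h₂.const_smul c)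

namespace IsTraceEmbedding

variable {X : Type*} [TopologicalSpace X] [MeasurableSpace X] {C : Set ℝ}
  {ι : X → ℝ} {μ : Measure X} {H H' : ℝ → ℝ} (h : IsTraceEmbedding C ι μ)

include h

/-- Every function of the domain is a pointwise limit of dominated compactly supported functions of
bounded energy. -/
theorem exists_core_seq [BorelSpace X] (hH : H ∈ traceDomain C ι μ) :
    ∃ V : ℕ → ℝ → ℝ, (∀ k, V k ∈ traceDomain C ι μ) ∧
      (∀ k, HasCompactSupport fun x => V k (ι x)) ∧ (∀ k, ∀ x ∈ C, |V k x| ≤ |H x|) ∧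
      (∀ x ∈ C, Tendsto (fun k => V k x) atTop (𝓝 (H x))) ∧
      ∃ c, ∀ k, ‖density C (V k)‖ ≤ c := by
  have := h.isEmbedding.t2Space
  obtain ⟨H₁, he, hd⟩ := hH.1.exists_extension
  set r : ℕ → ℝ := fun k => (k : ℝ) + 1 with hr
  have hr1 : ∀ k, 1 ≤ r k := fun k => by simp [hr]
  have hr0 : ∀ k, 0 < r k := fun k => by linarith [hr1 k]
  have hrt : Tendsto r atTop atTop := tendsto_atTop_add_const_right _ _ tendsto_natCast_atTop_atTop
  -- The soft clamp removes the small values near the missing points, the tent removes infinity. In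
  -- the product rule the density of the tent is multiplied by the bound `r` of the clamp; at the
  -- scale `r ^ 2` its norm is at most `2 / r`, so the energies stay bounded.
  set V : ℕ → ℝ → ℝ := fun k => (softClamp (r k) ∘ H₁) * tentCutoff (r k ^ 2) with hV
  have hVG : ∀ k, ∃ G, IsDensity univ (V k) G ∧ ‖G‖ ≤ 2 + ‖density C H‖ := by
    intro k
    obtain ⟨G₁, hG₁, hn₁⟩ := hd.contraction (softClamp_sub_le (hr0 k))
    obtain ⟨G₂, hG₂, hn₂⟩ := tentCutoff_isDensity (n := r k ^ 2) (pow_pos (hr0 k) 2)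
    obtain ⟨G, hG, hn⟩ := hG₁.mul hG₂ (a₁ := r k) (a₂ := 1)
      (fun x => abs_softClamp_le (hr1 k) _) (fun x => by
        rw [abs_of_nonneg (tentCutoff_mem _ _).1]; exact (tentCutoff_mem _ _).2)
    refine ⟨G, hG, hn.trans ?_⟩
    have h₁ : √(2 * (2 * r k ^ 2)) = 2 * r k := by
      rw [show 2 * (2 * r k ^ 2) = (2 * r k) ^ 2 by ring, Real.sqrt_sq (by linarith [hr0 k])]
    rw [h₁] at hn₂
    have h₂ : r k * ‖G₂‖ ≤ 2 := by
      refine (mul_le_mul_of_nonneg_left hn₂ (hr0 k).le).trans_eq ?_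
      have := (hr0 k).ne'
      field_simp
    linarith
  have hle : ∀ k, ∀ x ∈ C, |V k x| ≤ |H x| := by
    intro k x hx
    simp only [hV, Pi.mul_apply, Function.comp_apply, ← he hx]
    rw [abs_mul, abs_of_nonneg (tentCutoff_mem _ _).1]
    exact (mul_le_of_le_one_right (abs_nonneg _) (tentCutoff_mem _ _).2).trans
      (abs_softClamp_le_abs (hr1 k) _)
  have hcs : ∀ k, HasCompactSupport fun x => V k (ι x) := by
    intro k
    have hcont : ContinuousOn (fun x => |H₁ x|) (C ∩ Icc (-(2 * r k ^ 2)) (2 * r k ^ 2)) :=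
      hd.continuous.abs.continuousOn
    have hcl : IsClosed {x | x ∈ C ∧ 1 / r k ≤ |H₁ x|} :=
      h.isClosed.inter (isClosed_le continuous_const hd.continuous.abs)
    -- At points of `C` off this set `V k` vanishes, and the set contains no missing point because
    -- `H` is zero there.
    have hK : IsCompact (Icc (-(2 * r k ^ 2)) (2 * r k ^ 2) ∩ {x | x ∈ C ∧ 1 / r k ≤ |H₁ x|}) :=
      isCompact_Icc.inter_right hcl
    refine HasCompactSupport.intro (h.isCompact_preimage hK ?_) ?_
    · rintro x ⟨-, hxC, hx⟩ hxB
      rw [← he hxC, hH.2.1 x hxB, abs_zero] at hx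
      exact absurd hx (not_le.2 (one_div_pos.2 (hr0 k)))
    · intro x hx
      simp only [hV, Pi.mul_apply, Function.comp_apply]
      by_cases hx1 : |H₁ (ι x)| ≤ 1 / r k
      · rw [softClamp_eq_zero (hr1 k) hx1, zero_mul]
      · rw [tentCutoff_eq_zero (pow_pos (hr0 k) 2), mul_zero]
        by_contra! hlt
        have := abs_lt.1 hlt
        exact hx ⟨⟨this.1.le, this.2.le⟩, h.mem x, (not_le.1 hx1).le⟩
  refine ⟨V, fun k => ?_, hcs, hle, fun x hx => ?_, 2 + ‖density C H‖, fun k => ?_⟩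
  · obtain ⟨G, hG, -⟩ := hVG k
    refine h.mem_traceDomain_of_hasCompactSupport ⟨G, hG.mono (subset_univ _)⟩ (fun x hx => ?_)
      (hcs k)
    have := hle k x hx.1
    rw [hH.2.1 x hx, abs_zero] at this
    exact abs_nonpos_iff.1 this
  · have h₁ : Tendsto (fun k => softClamp (r k) (H x)) atTop (𝓝 (H x)) := by
      rw [tendsto_iff_norm_sub_tendsto_zero]
      refine squeeze_zero' (Eventually.of_forall fun _ => norm_nonneg _) ?_
        ((tendsto_const_nhds (x := (1 : ℝ))).div_atTop hrt)
      filter_upwards [hrt.eventually_ge_atTop |H x|] with k hk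
      exact abs_softClamp_sub_le (hr1 k) hk
    refine h₁.congr' ?_
    filter_upwards [hrt.eventually_ge_atTop |x|] with k hk
    simp only [hV, Pi.mul_apply, Function.comp_apply, ← he hx]
    rw [tentCutoff_eq_one (pow_pos (hr0 k) 2), mul_one]
    nlinarith [hr1 k]
  · obtain ⟨G, hG, hn⟩ := hVG k
    exact (hG.mono (subset_univ C)).norm_density_le.trans hn

/-- The closure of a subspace is its double orthogonal complement, so weak approximation is enough.
Orthogonality of `w` to the graph over the core passes to the limit along the truncations: in the
first component by weak convergence of bounded densities, in the second by dominated convergence. -/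
theorem mem_closure_coreGraph [BorelSpace X] (hH : H ∈ traceDomain C ι μ) {u : Lp ℝ 2 μ}
    (hu : u =ᵐ[μ] fun x => H (ι x)) :
    WithLp.toLp 2 (density C H, u) ∈ (coreGraph C ι μ).topologicalClosure := by
  obtain ⟨V, hV, hVc, hle, hlim, c, hc⟩ := h.exists_core_seq hH
  rw [← Submodule.orthogonal_orthogonal_eq_closure, Submodule.mem_orthogonal]
  intro w hw
  have h₀ : ∀ k, inner ℝ w.fst (density C (V k)) + inner ℝ w.snd ((hV k).2.2.toLp _) = 0 := by
    intro k
    have := (Submodule.mem_orthogonal' _ _).1 hw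
      (WithLp.toLp 2 (density C (V k), (hV k).2.2.toLp _))
      ⟨V k, hV k, hVc k, rfl, (hV k).2.2.coeFn_toLp⟩
    rwa [WithLp.prod_inner_apply] at this
  rw [WithLp.prod_inner_apply]
  have h₁ := tendsto_inner_density (fun k => (hV k).1) hH.1 hc hlim w.fst
  have h₂ : Tendsto (fun k => inner ℝ w.snd ((hV k).2.2.toLp _)) atTop (𝓝 (inner ℝ w.snd u)) := by
    simp only [L2.inner_def]
    have hcont : ∀ k, ∀ᵐ x ∂μ, (hV k).2.2.toLp _ x = V k (ι x) := fun k => (hV k).2.2.coeFn_toLp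
    refine tendsto_integral_of_dominated_convergence (fun x => |w.snd x| * |u x|)
      (fun k => ((Lp.aestronglyMeasurable _).inner (Lp.aestronglyMeasurable _)))
      ?_ (fun k => ?_) ?_
    · exact MemLp.integrable_mul (p := 2) (q := 2) (Lp.memLp w.snd).abs (Lp.memLp u).abs
    · filter_upwards [hcont k, hu] with x hx hx'
      rw [hx, hx']
      exact (norm_inner_le_norm _ _).trans
        (mul_le_mul_of_nonneg_left (hle k _ (h.mem x)) (abs_nonneg _))
    · filter_upwards [ae_all_iff.2 hcont, hu] with x hx hx'
      simp only [hx, hx']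
      exact tendsto_const_nhds.inner (hlim _ (h.mem x))
  have h₃ := h₁.add h₂
  simp only [h₀] at h₃
  exact (tendsto_nhds_unique h₃ tendsto_const_nhds)

theorem exists_core_near [BorelSpace X] {u : Lp ℝ 2 μ} (hu : u ∈ (traceForm C ι μ).dom) {ε : ℝ}
    (hε : 0 < ε) : ∃ v ∈ (traceForm C ι μ).core, (traceForm C ι μ).normOne (u - v) < ε := by
  obtain ⟨H, hH, hu⟩ := hu
  obtain ⟨w, ⟨V, hV, hVc, hw₁, hw₂⟩, hw⟩ := Metric.mem_closure_iff.1
    (show _ ∈ closure (coreGraph C ι μ : Set (WithLp 2 (LineL2 × Lp ℝ 2 μ))) from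
      h.mem_closure_coreGraph hH hu) (√ε) (Real.sqrt_pos.2 hε)
  refine ⟨w.snd, ⟨⟨V, hV, hw₂⟩, _, h.continuous_comp hV.1.continuousOn, hVc, hw₂⟩, ?_⟩
  rw [h.traceForm_normOne (traceDomain_sub hH hV) (Lp.sub_ae_eq hu hw₂), hH.1.density_sub hV.1,
    ← hw₁]
  rw [WithLp.prod_dist_eq_of_L2, Real.sqrt_lt_sqrt_iff (by positivity)] at hw
  rw [dist_eq_norm, dist_eq_norm] at hw
  have := sq_nonneg ‖density C H - w.fst‖
  change ‖density C H - w.fst‖ ^ 2 + ‖u - w.snd‖ ^ 2 < ε at hw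
  linarith

theorem isRegularDirichletForm [BorelSpace X] : (traceForm C ι μ).IsRegularDirichletForm where
  locallyCompact := h.locallyCompactSpace
  separable := by
    have := h.secondCountableTopology
    infer_instance
  metrizable := h.metrizableSpace
  radon := h.regular
  fullSupport := h.open_pos
  wide := h.isWideDirichletForm
  dense := h.dense_dom
  core_dense _ hu _ hε := h.exists_core_near hu hε
  core_uniform φ hφ hφc ε hε := by
    obtain ⟨K, -, -, happ⟩ := h.exists_uniform_approx hφ hφc
    obtain ⟨H, hH, hcont, hcs, -, hlt⟩ := happ ε hε
    exact ⟨_, hcont, hcs, ⟨hH.2.2.toLp _, ⟨H, hH, hH.2.2.coeFn_toLp⟩, hH.2.2.coeFn_toLp⟩, hlt⟩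

end IsTraceEmbedding

/-! ### Gaps of a closed set -/

theorem countable_setOf_not_accPt (E : Set ℝ) : {x ∈ E | ¬AccPt x (𝓟 E)}.Countable := by
  refine (countable_setOfPred_isolated_right_within (s := E)).mono ?_
  rintro x ⟨hx, hacc⟩
  rw [accPt_principal_iff_nhdsWithin, not_neBot] at hacc
  exact ⟨hx, le_bot_iff.1 ((nhdsWithin_mono x
    (show E ∩ Ioi x ⊆ E \ {x} from fun y hy => ⟨hy.1, ne_of_gt hy.2⟩)).trans hacc.le)⟩

theorem ae_uniqueDiffWithinAt (E : Set ℝ) : ∀ᵐ x, x ∈ E → UniqueDiffWithinAt ℝ E x := by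
  filter_upwards [(countable_setOf_not_accPt E).ae_notMem volume] with x hx hxE
  rw [uniqueDiffWithinAt_iff_accPt]
  by_contra hacc
  exact hx ⟨hxE, hacc⟩

theorem IsDensity.ae_hasDerivWithinAt {E : Set ℝ} {H : ℝ → ℝ} {G : LineL2}
    (h : IsDensity E H G) : ∀ᵐ x, x ∈ E → HasDerivWithinAt H (G x) E x := by
  rcases E.eq_empty_or_nonempty with rfl | ⟨a, ha⟩
  · simp
  filter_upwards [LocallyIntegrable.ae_hasDerivAt_integral G.locallyIntegrable] with x hx hxE
  have : HasDerivAt (primitive a (H a) G) (G x) x := (hx a).const_add _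
  exact this.hasDerivWithinAt.congr (h.eqOn_primitive ha) (h.eqOn_primitive ha hxE)

/-- At almost every point of `E` both `G x` and `0` are derivatives of `H` within `E`. The
derivative within `E` is unique at accumulation points, and the other points of `E` are countably
many. -/
theorem IsDensity.ae_eq_zero {E : Set ℝ} {H : ℝ → ℝ} {G : LineL2} (h : IsDensity E H G)
    (hE : ∀ x ∈ E, H x = 0) : ∀ᵐ x, x ∈ E → G x = 0 := by
  filter_upwards [h.ae_hasDerivWithinAt, ae_uniqueDiffWithinAt E] with x hx hx' hxE
  exact (hx' hxE).eq_deriv E (hx hxE)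
    ((hasDerivWithinAt_const x E (0 : ℝ)).congr hE (hE x hxE))

/-- The pairs `(a, b)` such that the intervals `(a, b)` are the bounded components of the complement
of `C`. -/
def gapSet (C : Set ℝ) : Set (ℝ × ℝ) :=
  {g | g.1 < g.2 ∧ g.1 ∈ C ∧ g.2 ∈ C ∧ ∀ c ∈ C, c ≤ g.1 ∨ g.2 ≤ c}

/-- The smallest interval containing `C`. -/
def intervalHull (C : Set ℝ) : Set ℝ := {y | ∃ a ∈ C, ∃ b ∈ C, a ≤ y ∧ y ≤ b}

theorem measurableSet_intervalHull (C : Set ℝ) : MeasurableSet (intervalHull C) := by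
  refine OrdConnected.measurableSet ⟨?_⟩
  rintro x ⟨a, ha, -, -, hax, -⟩ y ⟨-, -, b, hb, -, hyb⟩ z hz
  exact ⟨a, ha, b, hb, hax.trans hz.1, hz.2.trans hyb⟩

theorem gapSet_pairwiseDisjoint (C : Set ℝ) :
    (gapSet C).PairwiseDisjoint fun g => Ioo g.1 g.2 := by
  rintro ⟨a, b⟩ ⟨hab, ha, hb, hC⟩ ⟨a', b'⟩ ⟨hab', ha', hb', hC'⟩ hne
  refine disjoint_left.2 fun x hx hx' => hne ?_
  simp only [mem_Ioo] at *
  have h₁ := hC a' ha'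
  have h₂ := hC b' hb'
  have h₃ := hC' a ha
  have h₄ := hC' b hb
  ext <;> simp only <;> grind

theorem gapSet_countable (C : Set ℝ) : (gapSet C).Countable :=
  (gapSet_pairwiseDisjoint C).countable_of_isOpen (fun _ _ => isOpen_Ioo)
    fun _ hg => nonempty_Ioo.2 hg.1

theorem exists_gap {C : Set ℝ} (hC : IsClosed C) {y : ℝ} (hy : y ∈ intervalHull C) (hyC : y ∉ C) :
    ∃ g ∈ gapSet C, y ∈ Ioo g.1 g.2 := by
  obtain ⟨a, ha, b, hb, hay, hyb⟩ := hy
  have h₁ : sSup (C ∩ Iic y) ∈ C ∩ Iic y :=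
    (hC.inter isClosed_Iic).csSup_mem ⟨a, ha, hay⟩ ⟨y, fun z hz => hz.2⟩
  have h₂ : sInf (C ∩ Ici y) ∈ C ∩ Ici y :=
    (hC.inter isClosed_Ici).csInf_mem ⟨b, hb, hyb⟩ ⟨y, fun z hz => hz.2⟩
  have h₁' : sSup (C ∩ Iic y) < y := lt_of_le_of_ne h₁.2 fun e => hyC (e ▸ h₁.1)
  have h₂' : y < sInf (C ∩ Ici y) := lt_of_le_of_ne h₂.2 fun e => hyC (e ▸ h₂.1)
  refine ⟨(_, _), ⟨h₁'.trans h₂', h₁.1, h₂.1, fun c hc => ?_⟩, h₁', h₂'⟩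
  rcases le_total c y with hcy | hcy
  · exact Or.inl (le_csSup ⟨y, fun z hz => hz.2⟩ ⟨hc, hcy⟩)
  · exact Or.inr (csInf_le ⟨y, fun z hz => hz.2⟩ ⟨hc, hcy⟩)

/-- Inside the hull the complement of `C` is the disjoint union of the gaps, and `f` does not
contribute outside the hull. -/
theorem hasSum_gap_integral {C : Set ℝ} (hC : IsClosed C) {f : ℝ → ℝ} (hf : Integrable f)
    (hf0 : ∀ᵐ x, x ∉ intervalHull C → f x = 0) :
    HasSum (fun g : gapSet C => ∫ x in Ioo g.1.1 g.1.2, f x) ((∫ x, f x) - ∫ x in C, f x) := by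
  have := (gapSet_countable C).to_subtype
  have h := hasSum_integral_iUnion (f := f) (μ := volume)
    (s := fun g : gapSet C => Ioo g.1.1 g.1.2) (fun _ => measurableSet_Ioo)
    (fun g g' hne => gapSet_pairwiseDisjoint C g.2 g'.2 (Subtype.coe_injective.ne hne))
    hf.integrableOn
  suffices e : (∫ x, f x) - ∫ x in C, f x = ∫ x in ⋃ g : gapSet C, Ioo g.1.1 g.1.2, f x by
    rw [e]
    exact h
  rw [← integral_add_compl hC.measurableSet hf, add_sub_cancel_left]
  refine setIntegral_eq_of_subset_of_ae_sdiff_eq_zero hC.measurableSet.compl.nullMeasurableSet ?_ ?_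
  · refine iUnion_subset fun g x hx hxC => ?_
    rcases g.2.2.2.2 x hxC with h' | h'
    · exact not_lt.2 h' hx.1
    · exact not_lt.2 h' hx.2
  · filter_upwards [hf0] with x hx hx'
    refine hx fun hxH => hx'.2 ?_
    obtain ⟨g, hg, hxg⟩ := exists_gap hC hxH hx'.1
    exact mem_iUnion.2 ⟨⟨g, hg⟩, hxg⟩

theorem LineL2.inner_eq (f g : LineL2) : inner ℝ f g = ∫ x, f x * g x := by
  rw [L2.inner_def]
  refine integral_congr_ae (Eventually.of_forall fun x => ?_)
  simp [mul_comm]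

theorem LineL2.integrable_mul (f g : LineL2) : Integrable fun x => f x * g x :=
  MemLp.integrable_mul (p := 2) (q := 2) (Lp.memLp f) (Lp.memLp g)

theorem LineL2.integrableOn_Ioo (G : LineL2) (a b : ℝ) : IntegrableOn G (Ioo a b) :=
  ((G.locallyIntegrable).integrableOn_isCompact isCompact_Icc).mono_set Ioo_subset_Icc_self

theorem LineL2.setIntegral_Ioo (G : LineL2) {a b : ℝ} (hab : a ≤ b) :
    ∫ x in Ioo a b, G x = ∫ x in a..b, G x := by
  rw [intervalIntegral.integral_of_le hab, integral_Ioc_eq_integral_Ioo]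

/-- To check that `n` is orthogonal to the trace space it suffices to consider ordered pairs. -/
theorem integral_eq_zero_of_lt {C : Set ℝ} {n : ℝ → ℝ}
    (h : ∀ x ∈ C, ∀ y ∈ C, x < y → ∫ t in Ioc x y, n t = 0) :
    ∀ x ∈ C, ∀ y ∈ C, ∫ t in x..y, n t = 0 := by
  intro x hx y hy
  rcases lt_trichotomy x y with hlt | rfl | hlt
  · rw [intervalIntegral.integral_of_le hlt.le, h x hx y hy hlt]
  · exact intervalIntegral.integral_same
  · rw [intervalIntegral.integral_of_ge hlt.le, h y hy x hx hlt, neg_zero]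

/-- Test with `G` cut down to the complement of the hull: its integral between points of `C` is
zero, and its inner product with `G` is the integral of `G ^ 2` off the hull. -/
theorem ae_eq_zero_of_notMem_hull {C : Set ℝ} {G : LineL2} (hG : G ∈ traceSpace C) :
    ∀ᵐ x, x ∉ intervalHull C → G x = 0 := by
  have hm : MemLp ((intervalHull C)ᶜ.indicator G) 2 volume :=
    (Lp.memLp G).indicator (measurableSet_intervalHull C).compl
  have h := mem_traceSpace_iff.1 hG (hm.toLp _) (integral_eq_zero_of_lt fun x hx y hy hxy => by
    rw [setIntegral_congr_ae measurableSet_Ioc (g := fun _ => (0 : ℝ)) (by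
      filter_upwards [hm.coeFn_toLp] with t ht hxt
      rw [ht, indicator_of_notMem]
      exact fun hc => hc ⟨x, hx, y, hy, hxt.1.le, hxt.2⟩)]
    simp)
  rw [LineL2.inner_eq] at h
  have h' : ∫ x, (hm.toLp _ x) ^ 2 = 0 := by
    rw [← h]
    refine integral_congr_ae ?_
    filter_upwards [hm.coeFn_toLp] with t ht
    rw [ht]
    by_cases hc : t ∈ (intervalHull C)ᶜ
    · simp only [indicator_of_mem hc]; ring
    · simp only [indicator_of_notMem hc]; ring
  rw [integral_eq_zero_iff_of_nonneg (fun x => sq_nonneg _) (Lp.memLp _).integrable_sq] at h'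
  filter_upwards [h', hm.coeFn_toLp] with x hx hx' hxc
  rw [hx', indicator_of_mem hxc] at hx
  simpa using hx

theorem setIntegral_Ioo_sub_average (G : LineL2) {a b : ℝ} (hab : a < b) :
    ∫ x in Ioo a b, (G x - (∫ t in a..b, G t) / (b - a)) = 0 := by
  rw [integral_sub (G.integrableOn_Ioo a b) (by simp), G.setIntegral_Ioo hab.le,
    setIntegral_const, Measure.real, Real.volume_Ioo, ENNReal.toReal_ofReal (by linarith),
    smul_eq_mul, mul_div_cancel₀ _ (by linarith), sub_self]

/-- Test with `G - k` on the gap, `k` the mean. An interval between points of `C` contains the gap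
or misses it, so the test function has no integral over it; orthogonality to `G` then says that the
integral of `(G - k) ^ 2` over the gap is zero. -/
theorem ae_eq_average_on_gap {C : Set ℝ} {G : LineL2} (hG : G ∈ traceSpace C) {g : ℝ × ℝ}
    (hg : g ∈ gapSet C) :
    ∀ᵐ x, x ∈ Ioo g.1 g.2 → G x = (∫ t in g.1..g.2, G t) / (g.2 - g.1) := by
  obtain ⟨a, b⟩ := g
  obtain ⟨hab, -, -, hC⟩ := hg
  simp only at *
  set k := (∫ t in a..b, G t) / (b - a) with hk
  have hmG : MemLp ((Ioo a b).indicator G) 2 volume := (Lp.memLp G).indicator measurableSet_Ioo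
  have hmk : MemLp ((Ioo a b).indicator fun _ => k) 2 volume :=
    memLp_indicator_const 2 measurableSet_Ioo k (Or.inr (by simp))
  have hm : MemLp ((Ioo a b).indicator fun x => G x - k) 2 volume := by
    have := hmG.sub hmk
    rwa [← indicator_sub'] at this
  have hzero := setIntegral_Ioo_sub_average G hab
  rw [← hk] at hzero
  have h := mem_traceSpace_iff.1 hG (hm.toLp _) (integral_eq_zero_of_lt fun x hx y hy hxy => by
    rw [setIntegral_congr_ae measurableSet_Ioc (by
      filter_upwards [hm.coeFn_toLp] with t ht hxt using ht), setIntegral_indicator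
      measurableSet_Ioo]
    by_cases hcase : x ≤ a ∧ b ≤ y
    · rw [inter_eq_self_of_subset_right, hzero]
      exact fun t ht => ⟨hcase.1.trans_lt ht.1, ht.2.le.trans hcase.2⟩
    · have : Ioc x y ∩ Ioo a b = ∅ := by
        ext t
        simp only [mem_inter_iff, mem_Ioc, mem_Ioo, mem_empty_iff_false, iff_false]
        have := hC x hx
        have := hC y hy
        grind
      rw [this, setIntegral_empty])
  rw [LineL2.inner_eq] at h
  have h' : ∫ x, (hm.toLp _ x) ^ 2 = 0 := by
    have e : ∫ x, (hm.toLp _ x) ^ 2 =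
        ∫ x, (hm.toLp _ x * G x - k * (Ioo a b).indicator (fun x => G x - k) x) := by
      refine integral_congr_ae ?_
      filter_upwards [hm.coeFn_toLp] with t ht
      rw [ht]
      by_cases hc : t ∈ Ioo a b
      · simp only [indicator_of_mem hc]; ring
      · simp only [indicator_of_notMem hc]; ring
    rw [e, integral_sub (LineL2.integrable_mul _ _) ?_, h, integral_const_mul,
      integral_indicator measurableSet_Ioo, hzero, mul_zero, sub_zero]
    refine Integrable.const_mul ?_ _
    rw [integrable_indicator_iff measurableSet_Ioo]
    exact (G.integrableOn_Ioo a b).sub (by simp)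
  rw [integral_eq_zero_iff_of_nonneg (fun x => sq_nonneg _) (Lp.memLp _).integrable_sq] at h'
  filter_upwards [h', hm.coeFn_toLp] with x hx hx' hxc
  rw [hx', indicator_of_mem hxc] at hx
  have : (G x - k) ^ 2 = 0 := hx
  exact sub_eq_zero.1 (pow_eq_zero_iff two_ne_zero |>.1 this)

theorem ae_eq_average_on_gaps {C : Set ℝ} {G : LineL2} (hG : G ∈ traceSpace C) :
    ∀ᵐ x, ∀ g ∈ gapSet C, x ∈ Ioo g.1 g.2 → G x = (∫ t in g.1..g.2, G t) / (g.2 - g.1) := by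
  have := (gapSet_countable C).to_subtype
  have h : ∀ᵐ x, ∀ g : gapSet C, x ∈ Ioo g.1.1 g.1.2 →
      G x = (∫ t in g.1.1..g.1.2, G t) / (g.1.2 - g.1.1) :=
    ae_all_iff.2 fun g => ae_eq_average_on_gap hG g.2
  filter_upwards [h] with x hx g hg
  exact hx ⟨g, hg⟩

/-- Square integrable functions that vanish off the hull of `C` and are constant on its gaps belong
to the trace space. -/
theorem mem_traceSpace_of_const {C : Set ℝ} (hC : IsClosed C) {G : LineL2}
    (h₀ : ∀ᵐ x, x ∉ intervalHull C → G x = 0)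
    (hk : ∀ g ∈ gapSet C, ∃ k : ℝ, ∀ᵐ x, x ∈ Ioo g.1 g.2 → G x = k) : G ∈ traceSpace C := by
  rw [mem_traceSpace_iff]
  intro n hn
  rw [LineL2.inner_eq]
  have hsum := hasSum_gap_integral hC (LineL2.integrable_mul n G) (by
    filter_upwards [h₀] with x hx hxc
    rw [hx hxc, mul_zero])
  -- `n` is a density along `C` of the zero function. Hence nothing comes from `C`, and on a gap `n`
  -- has integral zero while `G` is constant.
  have hnC : ∀ᵐ x, x ∈ C → n x = 0 := by
    refine IsDensity.ae_eq_zero (H := fun _ => 0) (fun x hx y hy => ?_) fun _ _ => rfl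
    rw [hn x hx y hy, sub_zero]
  have h₁ : ∫ x in C, n x * G x = 0 := by
    rw [setIntegral_congr_ae (g := fun _ => (0 : ℝ)) hC.measurableSet]
    · simp
    · filter_upwards [hnC] with x hx hxC
      rw [hx hxC, zero_mul]
  have h₂ : ∀ g : gapSet C, ∫ x in Ioo g.1.1 g.1.2, n x * G x = 0 := by
    rintro ⟨⟨a, b⟩, hg⟩
    obtain ⟨k, hk⟩ := hk _ hg
    obtain ⟨hab, ha, hb, -⟩ := hg
    simp only at *
    rw [setIntegral_congr_ae (g := fun x => n x * k) measurableSet_Ioo]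
    · rw [integral_mul_const, n.setIntegral_Ioo hab.le, hn a ha b hb, zero_mul]
    · filter_upwards [hk] with x hx hxg
      rw [hx hxg]
  simp only [h₁, h₂, sub_zero] at hsum
  exact hsum.unique hasSum_zero

/-- The inner product of two elements of the trace space, in terms of the increments of their
primitives over the gaps. -/
theorem hasSum_gap_inner {C : Set ℝ} (hC : IsClosed C) {H₁ H₂ : ℝ → ℝ} (h₁ : HasL2Density C H₁)
    (h₂ : HasL2Density C H₂) :
    HasSum (fun g : gapSet C =>
      (H₁ g.1.2 - H₁ g.1.1) * (H₂ g.1.2 - H₂ g.1.1) / (g.1.2 - g.1.1))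
      (inner ℝ (density C H₁) (density C H₂) - ∫ x in C, density C H₁ x * density C H₂ x) := by
  rw [LineL2.inner_eq]
  have hsum := hasSum_gap_integral hC (LineL2.integrable_mul (density C H₁) (density C H₂)) (by
    filter_upwards [ae_eq_zero_of_notMem_hull (density_mem C H₁)] with x hx hxc
    rw [hx hxc, zero_mul])
  convert hsum using 2 with g
  obtain ⟨⟨a, b⟩, hg⟩ := g
  have hg' := hg
  obtain ⟨hab, ha, hb, -⟩ := hg'
  simp only at *
  rw [setIntegral_congr_ae (g := fun _ => (H₁ b - H₁ a) / (b - a) * ((H₂ b - H₂ a) / (b - a)))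
    measurableSet_Ioo]
  · have : b - a ≠ 0 := by linarith
    rw [setIntegral_const, Measure.real, Real.volume_Ioo, ENNReal.toReal_ofReal (by linarith),
      smul_eq_mul]
    field_simp
  · filter_upwards [ae_eq_average_on_gap (density_mem C H₁) hg,
      ae_eq_average_on_gap (density_mem C H₂) hg] with x hx₁ hx₂ hx
    rw [hx₁ hx, hx₂ hx, h₁.isDensity a ha b hb, h₂.isDensity a ha b hb]

/-! ### Irreducibility -/

namespace L2Form

variable {X : Type*} [MeasurableSpace X] {μ : Measure X} {E : L2Form μ}
  {T : ℝ → Lp ℝ 2 μ →L[ℝ] Lp ℝ 2 μ}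

namespace IsSemigroupOf

variable (hT : IsSemigroupOf T E) (u : Lp ℝ 2 μ)

include hT

theorem inner_apply_apply {s t : ℝ} (hs : 0 ≤ s) (ht : 0 ≤ t) :
    inner ℝ (T s u) (T t u) = inner ℝ (T (s + t) u) u := by
  rw [add_comm, hT.add t s ht hs, ContinuousLinearMap.comp_apply, hT.symm t ht]

theorem inner_apply_self {t : ℝ} (ht : 0 ≤ t) :
    inner ℝ (T t u) u = ‖T (t / 2) u‖ ^ 2 := by
  rw [← real_inner_self_eq_norm_sq, hT.inner_apply_apply u (by positivity) (by positivity),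
    add_halves]

theorem inner_apply_antitone {s t : ℝ} (hs : 0 ≤ s) (hst : s ≤ t) :
    inner ℝ (T t u) u ≤ inner ℝ (T s u) u := by
  rw [hT.inner_apply_self u hs, hT.inner_apply_self u (hs.trans hst)]
  have e : T (t / 2) u = T ((t - s) / 2) (T (s / 2) u) := by
    rw [← ContinuousLinearMap.comp_apply, ← hT.add _ _ (by linarith) (by linarith)]
    congr 2
    ring
  rw [e]
  gcongr
  exact hT.contraction _ (by linarith) _

theorem inner_apply_midpoint {s t : ℝ} (hs : 0 ≤ s) (ht : 0 ≤ t) :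
    2 * inner ℝ (T ((s + t) / 2) u) u ≤ inner ℝ (T s u) u + inner ℝ (T t u) u := by
  rw [hT.inner_apply_self u hs, hT.inner_apply_self u ht, add_div,
    ← hT.inner_apply_apply u (by positivity) (by positivity)]
  have h := real_inner_le_norm (T (s / 2) u) (T (t / 2) u)
  nlinarith [sq_nonneg (‖T (s / 2) u‖ - ‖T (t / 2) u‖)]

theorem inner_sub_apply_nonneg {t : ℝ} (ht : 0 ≤ t) : 0 ≤ inner ℝ (u - T t u) u := by
  have h := hT.inner_apply_antitone u le_rfl ht
  rw [hT.zero] at h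
  rw [inner_sub_left]
  simpa using h

/-- The function `t ↦ (T_t u, u)` is midpoint convex, so its decrements over successive steps of
length `s` do not increase, and each is at most the first. -/
theorem inner_sub_apply_nat_mul_le {s : ℝ} (hs : 0 ≤ s) (n : ℕ) :
    inner ℝ (u - T (n * s) u) u ≤ n * inner ℝ (u - T s u) u := by
  have hd : ∀ k : ℕ, inner ℝ (T (k * s) u) u - inner ℝ (T ((k + 1 : ℕ) * s) u) u ≤
      inner ℝ (u - T s u) u := by
    intro k
    induction k with
    | zero => simp [hT.zero, inner_sub_left]
    | succ k ih =>
      refine le_trans ?_ ih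
      have h := hT.inner_apply_midpoint u (s := k * s) (t := (k + 1 + 1 : ℕ) * s)
        (by positivity) (by positivity)
      have e : ((k : ℝ) * s + (k + 1 + 1 : ℕ) * s) / 2 = (k + 1 : ℕ) * s := by
        push_cast
        ring
      rw [e] at h
      linarith
  induction n with
  | zero => simp [hT.zero]
  | succ k ih =>
    have := hd k
    rw [inner_sub_left] at ih ⊢
    push_cast at *
    linarith

theorem inner_sub_apply_le {s t : ℝ} (hs : 0 < s) (ht : 0 ≤ t) :
    inner ℝ (u - T t u) u ≤ (t / s + 1) * inner ℝ (u - T s u) u := by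
  set n := ⌊t / s⌋₊ + 1 with hn
  have h₁ : t / s ≤ n := by
    rw [hn]
    push_cast
    exact (Nat.lt_floor_add_one _).le
  have h₂ : (n : ℝ) ≤ t / s + 1 := by
    rw [hn]
    push_cast
    gcongr
    exact Nat.floor_le (by positivity)
  have h₃ : inner ℝ (u - T t u) u ≤ inner ℝ (u - T (n * s) u) u := by
    rw [inner_sub_left, inner_sub_left]
    gcongr
    exact hT.inner_apply_antitone u ht ((div_le_iff₀ hs).1 h₁)
  exact h₃.trans ((hT.inner_sub_apply_nat_mul_le u hs.le n).trans
    (mul_le_mul_of_nonneg_right h₂ (hT.inner_sub_apply_nonneg u hs.le)))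

theorem quotient_le {s t : ℝ} (hs : 0 < s) (ht : 0 < t) :
    t⁻¹ * inner ℝ (u - T t u) u ≤ (1 + s / t) * (s⁻¹ * inner ℝ (u - T s u) u) := by
  have h := mul_le_mul_of_nonneg_left (hT.inner_sub_apply_le u hs ht.le) (inv_pos.2 ht).le
  refine h.trans_eq ?_
  field_simp

/-- Let `s ↓ 0` in `quotient_le`. -/
theorem quotient_le_of_tendsto {a : ℝ}
    (ha : Tendsto (fun t : ℝ => t⁻¹ * inner ℝ (u - T t u) u) (𝓝[>] 0) (𝓝 a)) {t : ℝ} (ht : 0 < t) :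
    t⁻¹ * inner ℝ (u - T t u) u ≤ a := by
  have h₁ : Tendsto (fun s : ℝ => (1 + s / t) * (s⁻¹ * inner ℝ (u - T s u) u)) (𝓝[>] 0)
      (𝓝 ((1 + 0 / t) * a)) :=
    ((tendsto_const_nhds.add ((tendsto_id.mono_left nhdsWithin_le_nhds).div_const t))).mul ha
  rw [zero_div, add_zero, one_mul] at h₁
  refine ge_of_tendsto h₁ ?_
  filter_upwards [self_mem_nhdsWithin] with s hs
  exact hT.quotient_le u hs ht

/-- The quotient at small `s` is at least the quotient at `t` divided by `1 + s / t`. So it tends to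
its supremum, and boundedness alone implies membership in the domain. -/
theorem mem_dom_of_quotient_le {a : ℝ} (ha : ∀ t > 0, t⁻¹ * inner ℝ (u - T t u) u ≤ a) :
    u ∈ E.dom := by
  rw [hT.mem_dom]
  set q : ℝ → ℝ := fun t => t⁻¹ * inner ℝ (u - T t u) u with hq
  have hbdd : BddAbove (q '' Ioi 0) := ⟨a, by rintro _ ⟨t, ht, rfl⟩; exact ha t ht⟩
  refine ⟨sSup (q '' Ioi 0), tendsto_order.2 ⟨fun b hb => ?_, fun b hb => ?_⟩⟩
  · obtain ⟨_, ⟨t, ht, rfl⟩, hbt⟩ := exists_lt_of_lt_csSup ((nonempty_Ioi).image q) hb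
    have h₁ : Tendsto (fun s : ℝ => q t / (1 + s / t)) (𝓝[>] 0) (𝓝 (q t / (1 + 0 / t))) :=
      tendsto_const_nhds.div
        (tendsto_const_nhds.add ((tendsto_id.mono_left nhdsWithin_le_nhds).div_const t)) (by simp)
    rw [zero_div, add_zero, div_one] at h₁
    filter_upwards [h₁.eventually_const_lt hbt, self_mem_nhdsWithin] with s hs hs0
    refine hs.trans_le ?_
    have hpos : 0 < 1 + s / t := add_pos one_pos (div_pos hs0 ht)
    rw [div_le_iff₀ hpos, mul_comm]
    exact hT.quotient_le u hs0 ht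
  · filter_upwards [self_mem_nhdsWithin] with s hs
    exact (le_csSup hbdd ⟨s, hs, rfl⟩).trans_lt hb

end IsSemigroupOf

theorem inner_eq_zero_of_disjoint {A : Set X} {v w : Lp ℝ 2 μ} {f g : X → ℝ}
    (hv : v =ᵐ[μ] A.indicator f) (hw : w =ᵐ[μ] Aᶜ.indicator g) : inner ℝ v w = 0 := by
  rw [L2.inner_def, ← integral_zero X ℝ (μ := μ)]
  refine integral_congr_ae ?_
  filter_upwards [hv, hw] with x hx hx'
  rw [hx, hx']
  by_cases h : x ∈ A
  · rw [indicator_of_notMem (s := Aᶜ) (fun hc => hc h), inner_zero_right]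
  · rw [indicator_of_notMem h, inner_zero_left]

/-- The restriction of an element of `L²` to a measurable set. -/
def restrictTo {A : Set X} (hA : MeasurableSet A) (u : Lp ℝ 2 μ) : Lp ℝ 2 μ :=
  ((Lp.memLp u).indicator hA).toLp _

theorem restrictTo_ae_eq {A : Set X} (hA : MeasurableSet A) (u : Lp ℝ 2 μ) :
    restrictTo hA u =ᵐ[μ] A.indicator u :=
  MemLp.coeFn_toLp _

theorem restrictTo_add_compl {A : Set X} (hA : MeasurableSet A) (u : Lp ℝ 2 μ) :
    restrictTo hA u + restrictTo hA.compl u = u := by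
  refine Lp.ext ?_
  filter_upwards [Lp.coeFn_add (restrictTo hA u) (restrictTo hA.compl u), restrictTo_ae_eq hA u,
    restrictTo_ae_eq hA.compl u] with x hx h₁ h₂
  rw [hx, Pi.add_apply, h₁, h₂]
  exact congrFun (indicator_self_add_compl A u) x

theorem IsInvariantSet.apply_ae_eq {A : Set X} (hA : IsInvariantSet T A) {t : ℝ} (ht : 0 < t)
    (u : Lp ℝ 2 μ) : T t (restrictTo hA.1 u) =ᵐ[μ] A.indicator (T t u) :=
  hA.2 t ht u _ (restrictTo_ae_eq hA.1 u)

theorem IsInvariantSet.apply_compl_ae_eq {A : Set X} (hA : IsInvariantSet T A) {t : ℝ}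
    (ht : 0 < t) (u : Lp ℝ 2 μ) :
    T t (restrictTo hA.1.compl u) =ᵐ[μ] Aᶜ.indicator (T t u) := by
  have e : T t (restrictTo hA.1.compl u) = T t u - T t (restrictTo hA.1 u) := by
    rw [← map_sub]
    congr 1
    exact eq_sub_of_add_eq' (restrictTo_add_compl hA.1 u)
  rw [e]
  filter_upwards [Lp.coeFn_sub (T t u) (T t (restrictTo hA.1 u)), hA.apply_ae_eq ht u] with x hx hx'
  rw [hx, Pi.sub_apply, hx', indicator_compl, Pi.sub_apply]

theorem IsInvariantSet.compl {A : Set X} (hA : IsInvariantSet T A) : IsInvariantSet T Aᶜ := by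
  refine ⟨hA.1.compl, fun t ht u v hv => ?_⟩
  have e : v = restrictTo hA.1.compl u := Lp.ext (hv.trans (restrictTo_ae_eq hA.1.compl u).symm)
  rw [e]
  exact hA.apply_compl_ae_eq ht u

theorem IsInvariantSet.inner_sub_apply {A : Set X} (hA : IsInvariantSet T A) {t : ℝ}
    (ht : 0 < t) (u : Lp ℝ 2 μ) :
    inner ℝ (restrictTo hA.1 u - T t (restrictTo hA.1 u)) (restrictTo hA.1.compl u) = 0 := by
  rw [inner_sub_left, inner_eq_zero_of_disjoint (restrictTo_ae_eq hA.1 u)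
    (restrictTo_ae_eq hA.1.compl u), inner_eq_zero_of_disjoint (hA.apply_ae_eq ht u)
    (restrictTo_ae_eq hA.1.compl u), sub_zero]

/-- The semigroup keeps functions on `A` and on `Aᶜ` apart, so the quotient of `u` is the sum of the
quotients of its two restrictions. Both are nonnegative, hence each is bounded by that of `u`. -/
theorem IsInvariantSet.restrictTo_mem_dom {A : Set X} (hA : IsInvariantSet T A)
    (hT : IsSemigroupOf T E) {u : Lp ℝ 2 μ} (hu : u ∈ E.dom) : restrictTo hA.1 u ∈ E.dom := by
  obtain ⟨a, ha⟩ := (hT.mem_dom u).1 hu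
  refine hT.mem_dom_of_quotient_le _ (a := a) fun t ht => ?_
  refine le_trans ?_ (hT.quotient_le_of_tendsto u ha ht)
  refine mul_le_mul_of_nonneg_left ?_ (inv_pos.2 ht).le
  have h₁ := hA.inner_sub_apply ht u
  have h₂ : inner ℝ (restrictTo hA.1.compl u - T t (restrictTo hA.1.compl u))
      (restrictTo hA.1 u) = 0 := by
    rw [inner_sub_left, real_inner_comm, inner_eq_zero_of_disjoint (restrictTo_ae_eq hA.1 u)
      (restrictTo_ae_eq hA.1.compl u), real_inner_comm, inner_eq_zero_of_disjoint
      (restrictTo_ae_eq hA.1 u) (hA.apply_compl_ae_eq ht u), sub_zero]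
  have h₃ := hT.inner_sub_apply_nonneg (restrictTo hA.1.compl u) ht.le
  have e := restrictTo_add_compl hA.1 u
  set v := restrictTo hA.1 u
  set w := restrictTo hA.1.compl u
  have h₄ : inner ℝ (u - T t u) u = inner ℝ (v - T t v) v + inner ℝ (w - T t w) w +
      inner ℝ (v - T t v) w + inner ℝ (w - T t w) v := by
    rw [← e, map_add, add_sub_add_comm, inner_add_left, inner_add_right, inner_add_right]
    ring
  linarith

theorem IsInvariantSet.form_restrictTo_eq_zero {A : Set X} (hA : IsInvariantSet T A)
    (hT : IsSemigroupOf T E) {u : Lp ℝ 2 μ} (hu : u ∈ E.dom) :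
    E.form (restrictTo hA.1 u) (restrictTo hA.1.compl u) = 0 := by
  have h := hT.form_eq _ (hA.restrictTo_mem_dom hT hu) _ (hA.compl.restrictTo_mem_dom hT hu)
  refine tendsto_nhds_unique h (tendsto_const_nhds.congr' ?_)
  filter_upwards [self_mem_nhdsWithin] with t ht
  rw [hA.inner_sub_apply ht u, mul_zero]

end L2Form

namespace IsTraceEmbedding

variable {X : Type*} [TopologicalSpace X] [MeasurableSpace X] {C : Set ℝ}
  {ι : X → ℝ} {μ : Measure X} {H H' : ℝ → ℝ} (h : IsTraceEmbedding C ι μ)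

include h

/-- A missing point is the least or the greatest point of `C`, and could lie between two points of
the range only by being one of them. -/
theorem mem_range_of_mem_Icc {x y : X} {c : ℝ} (hc : c ∈ C) (hxy : c ∈ Icc (ι x) (ι y)) :
    c ∈ range ι := by
  by_contra hr
  rcases h.extremal c ⟨hc, hr⟩ with h' | h'
  · exact hr ⟨x, le_antisymm hxy.1 (h' _ (h.mem x))⟩
  · exact hr ⟨y, le_antisymm (h' _ (h.mem y)) hxy.2⟩

/-- Choose a cutoff `χ` equal to `1` over `[ι x, ι y]`. Its restrictions to `A` and `Aᶜ` lie in the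
domain and have continuous versions `H₁, H₂ ≥ 0` with `H₁ H₂ = 0` and sum `χ`; between `x` and `y`
they only take the values `0` and `1`, with `H₁ = 1` at `x` and `H₂ = 1` at `y`. So the roles are
exchanged across some gap of `C`, which makes the mutual energy negative, whereas invariance makes
it zero. -/
theorem false_of_isInvariantSet [BorelSpace X] {T : ℝ → Lp ℝ 2 μ →L[ℝ] Lp ℝ 2 μ}
    (hT : L2Form.IsSemigroupOf T (traceForm C ι μ)) {A : Set X} (hA : L2Form.IsInvariantSet T A)
    {x y : X} (hx : ∀ V ∈ 𝓝[A] x, 0 < μ V) (hy : ∀ V ∈ 𝓝[Aᶜ] y, 0 < μ V) (hxy : ι x ≤ ι y) :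
    False := by
  have := h.open_pos
  have := h.isEmbedding.t2Space
  have hK : IsCompact (ι ⁻¹' Icc (ι x) (ι y)) := h.isCompact_preimage isCompact_Icc
    fun c hc hcB => hcB.2 (h.mem_range_of_mem_Icc hcB.1 hc)
  obtain ⟨χ, G, hχ, hχ1, hχK, hχc, hχB⟩ := h.exists_cutoff hK
  have hχd := h.mem_traceDomain_of_hasCompactSupport ⟨G, hχ.mono (subset_univ C)⟩ hχB hχc
  set u : Lp ℝ 2 μ := hχd.2.2.toLp _ with hu
  have hu' : u =ᵐ[μ] fun x => χ (ι x) := hχd.2.2.coeFn_toLp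
  have hud : u ∈ (traceForm C ι μ).dom := ⟨χ, hχd, hu'⟩
  obtain ⟨H₁, hH₁, h₁⟩ := hA.restrictTo_mem_dom hT hud
  obtain ⟨H₂, hH₂, h₂⟩ := hA.compl.restrictTo_mem_dom hT hud
  have hform := hA.form_restrictTo_eq_zero hT hud
  rw [h.traceForm_form hH₁ hH₂ h₁ h₂] at hform
  have hc₁ := h.continuous_comp hH₁.1.continuousOn
  have hc₂ := h.continuous_comp hH₂.1.continuousOn
  have e₁ : ∀ᵐ z ∂μ, H₁ (ι z) = A.indicator (fun z => χ (ι z)) z := by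
    filter_upwards [h₁, L2Form.restrictTo_ae_eq hA.1 u, hu'] with z h₁ h₂ h₃
    rw [← h₁, h₂]
    by_cases hz : z ∈ A
    · rw [indicator_of_mem hz, indicator_of_mem hz, h₃]
    · rw [indicator_of_notMem hz, indicator_of_notMem hz]
  have e₂ : ∀ᵐ z ∂μ, H₂ (ι z) = Aᶜ.indicator (fun z => χ (ι z)) z := by
    filter_upwards [h₂, L2Form.restrictTo_ae_eq hA.1.compl u, hu'] with z h₁ h₂ h₃
    rw [← h₁, h₂]
    by_cases hz : z ∈ Aᶜ
    · rw [indicator_of_mem hz, indicator_of_mem hz, h₃]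
    · rw [indicator_of_notMem hz, indicator_of_notMem hz]
  have hsum : ∀ z, H₁ (ι z) + H₂ (ι z) = χ (ι z) := by
    refine congrFun (((hc₁.add hc₂).ae_eq_iff_eq μ
      (hχ.continuous.comp h.isEmbedding.continuous)).1 ?_)
    filter_upwards [e₁, e₂] with z h₁ h₂
    change H₁ (ι z) + H₂ (ι z) = χ (ι z)
    rw [h₁, h₂]
    exact congrFun (indicator_self_add_compl A fun z => χ (ι z)) z
  have hprod : ∀ z, H₁ (ι z) * H₂ (ι z) = 0 := by
    refine congrFun (((hc₁.mul hc₂).ae_eq_iff_eq μ continuous_const).1 ?_)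
    filter_upwards [e₁, e₂] with z h₁ h₂
    change H₁ (ι z) * H₂ (ι z) = 0
    rw [h₁, h₂]
    by_cases hz : z ∈ A
    · rw [indicator_of_notMem (s := Aᶜ) (fun hc => hc hz), mul_zero]
    · rw [indicator_of_notMem hz, zero_mul]
  have hnn₁ : ∀ z, 0 ≤ H₁ (ι z) := by
    have : (fun z => |H₁ (ι z)|) = fun z => H₁ (ι z) := by
      refine (hc₁.abs.ae_eq_iff_eq μ hc₁).1 ?_
      filter_upwards [e₁] with z h₁
      rw [h₁]
      exact abs_of_nonneg (indicator_nonneg (fun z _ => (hχ1 (ι z)).1) z)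
    intro z
    exact abs_eq_self.1 (congrFun this z)
  have hnn₂ : ∀ z, 0 ≤ H₂ (ι z) := by
    have : (fun z => |H₂ (ι z)|) = fun z => H₂ (ι z) := by
      refine (hc₂.abs.ae_eq_iff_eq μ hc₂).1 ?_
      filter_upwards [e₂] with z h₁
      rw [h₁]
      exact abs_of_nonneg (indicator_nonneg (fun z _ => (hχ1 (ι z)).1) z)
    intro z
    exact abs_eq_self.1 (congrFun this z)
  have hC : ∀ c ∈ C, H₁ c * H₂ c = 0 ∧ 0 ≤ H₁ c ∧ 0 ≤ H₂ c := by
    intro c hc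
    by_cases hr : c ∈ range ι
    · obtain ⟨z, rfl⟩ := hr
      exact ⟨hprod z, hnn₁ z, hnn₂ z⟩
    · rw [hH₁.2.1 c ⟨hc, hr⟩, hH₂.2.1 c ⟨hc, hr⟩]
      simp
  have hone : ∀ c ∈ C, c ∈ Icc (ι x) (ι y) → H₁ c = 1 ∧ H₂ c = 0 ∨ H₁ c = 0 ∧ H₂ c = 1 := by
    intro c hc hxyc
    obtain ⟨z, rfl⟩ := h.mem_range_of_mem_Icc hc hxyc
    have h₃ := hsum z
    rw [hχK z hxyc] at h₃
    rcases mul_eq_zero.1 (hprod z) with h₄ | h₄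
    · exact Or.inr ⟨h₄, by linarith⟩
    · exact Or.inl ⟨by linarith, h₄⟩
  -- Otherwise `H₂ > 0` near `x`, hence on a part of `A` of positive measure, although `H₂` is zero
  -- almost everywhere on `A`.
  have hx1 : H₁ (ι x) = 1 := by
    rcases hone _ (h.mem x) ⟨le_rfl, hxy⟩ with h₃ | h₃
    · exact h₃.1
    · exfalso
      have hV : {z | 0 < H₂ (ι z)} ∈ 𝓝 x :=
        (isOpen_lt continuous_const hc₂).mem_nhds (by simp [h₃.2])
      refine (hx _ (inter_mem (mem_nhdsWithin_of_mem_nhds hV) self_mem_nhdsWithin)).ne' ?_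
      refine measure_mono_null ?_ (ae_iff.1 e₂)
      rintro z ⟨hz, hzA⟩ hc
      rw [indicator_of_notMem (s := Aᶜ) (fun hc => hc hzA)] at hc
      exact (ne_of_gt hz) hc
  have hy1 : H₂ (ι y) = 1 := by
    rcases hone _ (h.mem y) ⟨hxy, le_rfl⟩ with h₃ | h₃
    · exfalso
      have hV : {z | 0 < H₁ (ι z)} ∈ 𝓝 y :=
        (isOpen_lt continuous_const hc₁).mem_nhds (by simp [h₃.1])
      refine (hy _ (inter_mem (mem_nhdsWithin_of_mem_nhds hV) self_mem_nhdsWithin)).ne' ?_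
      refine measure_mono_null ?_ (ae_iff.1 e₁)
      rintro z ⟨hz, hzA⟩ hc
      rw [indicator_of_notMem hzA] at hc
      exact (ne_of_gt hz) hc
    · exact h₃.2
  -- a gap over which `H₁` jumps from `1` to `0`
  have hcl₁ : IsCompact (Icc (ι x) (ι y) ∩ (C ∩ H₁ ⁻¹' {1})) :=
    isCompact_Icc.inter_right (hH₁.1.continuousOn.preimage_isClosed_of_isClosed h.isClosed
      isClosed_singleton)
  obtain ⟨a, ⟨haI, haC, ha1⟩, hamax⟩ := hcl₁.exists_isGreatest
    ⟨ι x, ⟨le_rfl, hxy⟩, h.mem x, hx1⟩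
  have hcl₂ : IsCompact (Icc a (ι y) ∩ (C ∩ H₂ ⁻¹' {1})) :=
    isCompact_Icc.inter_right (hH₂.1.continuousOn.preimage_isClosed_of_isClosed h.isClosed
      isClosed_singleton)
  obtain ⟨b, ⟨hbI, hbC, hb1⟩, hbmin⟩ := hcl₂.exists_isLeast
    ⟨ι y, ⟨haI.2, le_rfl⟩, h.mem y, hy1⟩
  have ha1' : H₁ a = 1 := ha1
  have hb1' : H₂ b = 1 := hb1
  have ha2 : H₂ a = 0 := by
    have := (hC a haC).1
    rwa [ha1', one_mul] at this
  have hb2 : H₁ b = 0 := by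
    have := (hC b hbC).1
    rwa [hb1', mul_one] at this
  have hab : a < b := by
    refine lt_of_le_of_ne hbI.1 fun e => ?_
    rw [e, hb2] at ha1'
    exact zero_ne_one ha1'
  have hgap : (a, b) ∈ gapSet C := by
    refine ⟨hab, haC, hbC, fun c hc => ?_⟩
    by_contra! hcc
    have hcI : c ∈ Icc (ι x) (ι y) := ⟨haI.1.trans hcc.1.le, hcc.2.le.trans hbI.2⟩
    rcases hone c hc hcI with h₃ | h₃
    · exact not_le.2 hcc.1 (hamax ⟨hcI, hc, h₃.1⟩)
    · exact not_le.2 hcc.2 (hbmin ⟨⟨hcc.1.le, hcI.2⟩, hc, h₃.2⟩)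
  -- At each point of `C` one of the functions is zero, and on the zero set of a function its
  -- density vanishes almost everywhere.
  have hint : ∫ c in C, density C H₁ c * density C H₂ c = 0 := by
    rw [setIntegral_congr_ae (g := fun _ => (0 : ℝ)) h.isClosed.measurableSet]
    · simp
    · filter_upwards [(hH₁.1.isDensity.mono (sep_subset C fun c => H₁ c = 0)).ae_eq_zero
        (fun c hc => hc.2), (hH₂.1.isDensity.mono (sep_subset C fun c => H₂ c = 0)).ae_eq_zero
        (fun c hc => hc.2)] with c h₁ h₂ hc
      rcases mul_eq_zero.1 (hC c hc).1 with h₃ | h₃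
      · rw [h₁ ⟨hc, h₃⟩, zero_mul]
      · rw [h₂ ⟨hc, h₃⟩, mul_zero]
  have hs := hasSum_gap_inner h.isClosed hH₁.1 hH₂.1
  rw [hint, (by linarith : inner ℝ (density C H₁) (density C H₂) = 0), sub_zero] at hs
  have hs' := hs.neg
  rw [neg_zero, hasSum_zero_iff_of_nonneg] at hs'
  · have := congrFun hs' ⟨(a, b), hgap⟩
    simp only [ha1', ha2, hb1', hb2, Pi.zero_apply, neg_eq_zero] at this
    rw [div_eq_zero_iff] at this
    rcases this with h₃ | h₃
    · norm_num at h₃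
    · linarith
  · rintro ⟨⟨c, d⟩, hcd, hc, hd, -⟩
    obtain ⟨h₃, h₄, h₅⟩ := hC c hc
    obtain ⟨h₆, h₇, h₈⟩ := hC d hd
    simp only at *
    -- In the product of the two increments the diagonal terms `H₁ H₂` vanish, and the mixed ones
    -- carry a minus sign.
    rw [Left.nonneg_neg_iff]
    refine div_nonpos_of_nonpos_of_nonneg ?_ (by linarith)
    nlinarith [mul_nonneg h₄ h₈, mul_nonneg h₇ h₅]

/-- By second countability a set of positive measure has a point all of whose relative
neighbourhoods have positive measure. Apply this to `A` and `Aᶜ`, and order the two points along the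
line. -/
theorem isIrreducible [BorelSpace X] : (traceForm C ι μ).IsIrreducible := by
  have := h.secondCountableTopology
  intro T hT A hA
  by_contra! hne
  obtain ⟨x, -, hx⟩ := exists_mem_forall_mem_nhdsWithin_pos_measure hne.1
  obtain ⟨y, -, hy⟩ := exists_mem_forall_mem_nhdsWithin_pos_measure hne.2
  rcases le_total (ι x) (ι y) with hxy | hxy
  · exact h.false_of_isInvariantSet hT hA hx hy hxy
  · exact h.false_of_isInvariantSet hT hA.compl hy (by rwa [compl_compl]) hxy

end IsTraceEmbedding

/-! ### Forms pulled back along a measure preserving map -/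

/-- The functions on a measure space that correspond to the functions in the domain of a trace form
under `Ψ : A → C`, and vanish off `A`. -/
def pullbackForm {X Y : Type*} [MeasurableSpace X] [MeasurableSpace Y] (C : Set ℝ) (ι : Y → ℝ)
    (ν : Measure Y) (A : Set X) (Ψ : X → ℝ) (μ : Measure X) : L2Form μ :=
  L2Form.ofFunctions μ (traceDomain C ι ν) (fun H => A.indicator fun x => H (Ψ x))
    fun H H' => (1 / 2) * inner ℝ (density C H) (density C H')

/-- The data of a measure preserving map from `A` to the space of a trace form. -/
structure IsTracePullback {X Y : Type*} [MeasurableSpace X] [MeasurableSpace Y] (C : Set ℝ)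
    (ι : Y → ℝ) (ν : Measure Y) (A : Set X) (Ψ : X → ℝ) (μ : Measure X) : Prop where
  measurableSet : MeasurableSet A
  measurable : Measurable Ψ
  mem : ∀ x ∈ A, Ψ x ∈ C
  map_eq : (μ.restrict A).map Ψ = ν.map ι

namespace IsTracePullback

variable {X Y : Type*} [MeasurableSpace X] [TopologicalSpace Y] [MeasurableSpace Y] [BorelSpace Y]
  {C : Set ℝ} {ι : Y → ℝ} {ν : Measure Y} {A : Set X} {Ψ : X → ℝ} {μ : Measure X} {H H' : ℝ → ℝ}
  (hP : IsTracePullback C ι ν A Ψ μ) (h : IsTraceEmbedding C ι ν)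

include hP

-- `H` is controlled only on `C`; a continuous function agreeing with it there provides
-- measurability.
omit [TopologicalSpace Y] [BorelSpace Y] in
theorem exists_continuous (hH : HasL2Density C H) :
    ∃ H₁ : ℝ → ℝ, Continuous H₁ ∧ EqOn H H₁ C ∧
      (A.indicator fun x => H (Ψ x)) = A.indicator fun x => H₁ (Ψ x) := by
  obtain ⟨H₁, he, hd⟩ := hH.exists_extension
  exact ⟨H₁, hd.continuous, he, indicator_congr fun x hx => he (hP.mem x hx)⟩

omit [TopologicalSpace Y] [BorelSpace Y] in
theorem aestronglyMeasurable (hH : HasL2Density C H) :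
    AEStronglyMeasurable (A.indicator fun x => H (Ψ x)) μ := by
  obtain ⟨H₁, hc, -, he⟩ := hP.exists_continuous hH
  rw [he]
  exact ((hc.measurable.comp hP.measurable).indicator hP.measurableSet).aestronglyMeasurable

include h

/-- Both sides are the norm of one continuous function on the line with respect to the common image
measure. -/
theorem eLpNorm_eq (hH : HasL2Density C H) (p : ℝ≥0∞) :
    eLpNorm (A.indicator fun x => H (Ψ x)) p μ = eLpNorm (fun y => H (ι y)) p ν := by
  obtain ⟨H₁, hc, he, hi⟩ := hP.exists_continuous hH
  have e : (fun y => H (ι y)) = H₁ ∘ ι := funext fun y => he (h.mem y)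
  rw [hi, eLpNorm_indicator_eq_eLpNorm_restrict hP.measurableSet, e,
    ← eLpNorm_map_measure hc.aestronglyMeasurable h.isEmbedding.continuous.measurable.aemeasurable,
    ← hP.map_eq, eLpNorm_map_measure hc.aestronglyMeasurable hP.measurable.aemeasurable]
  rfl

theorem memLp_iff (hH : HasL2Density C H) :
    MemLp (A.indicator fun x => H (Ψ x)) 2 μ ↔ MemLp (fun y => H (ι y)) 2 ν := by
  have h₂ : AEStronglyMeasurable (fun y => H (ι y)) ν :=
    (h.continuous_comp hH.continuousOn).measurable.aestronglyMeasurable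
  rw [MemLp, MemLp, hP.eLpNorm_eq h hH]
  exact ⟨fun k => ⟨h₂, k.2⟩, fun k => ⟨hP.aestronglyMeasurable hH, k.2⟩⟩

theorem eqOn_of_ae_eq (hH : HasL2Density C H) (hH' : HasL2Density C H')
    (he : (A.indicator fun x => H (Ψ x)) =ᵐ[μ] A.indicator fun x => H' (Ψ x)) : EqOn H H' C := by
  refine h.eqOn_of_ae_eq hH hH' ?_
  have h₁ := hP.eLpNorm_eq h (hH.sub hH') 2
  have h₂ : eLpNorm (A.indicator fun x => (H - H') (Ψ x)) 2 μ = 0 := by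
    rw [eLpNorm_eq_zero_iff (hP.aestronglyMeasurable (hH.sub hH')) (by simp)]
    filter_upwards [he] with x hx
    by_cases hxA : x ∈ A
    · rw [indicator_of_mem hxA, indicator_of_mem hxA] at hx
      rw [indicator_of_mem hxA, Pi.sub_apply, hx, sub_self]
      rfl
    · rw [indicator_of_notMem hxA]
      rfl
  rw [h₂, eq_comm, eLpNorm_eq_zero_iff (h.continuous_comp
    (hH.sub hH').continuousOn).measurable.aestronglyMeasurable (by simp)] at h₁
  filter_upwards [h₁] with y hy
  exact sub_eq_zero.1 hy

theorem form_eq {u v : Lp ℝ 2 μ} (hH : H ∈ traceDomain C ι ν)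
    (hH' : H' ∈ traceDomain C ι ν) (hu : u =ᵐ[μ] A.indicator fun x => H (Ψ x))
    (hv : v =ᵐ[μ] A.indicator fun x => H' (Ψ x)) :
    (pullbackForm C ι ν A Ψ μ).form u v = (1 / 2) * inner ℝ (density C H) (density C H') := by
  refine L2Form.ofFunctions_form (fun a ha b hb hab c _ => ?_) (fun a _ b _ => ?_) hH hH' hu hv
  · rw [ha.1.density_congr (hP.eqOn_of_ae_eq h ha.1 hb.1 hab)]
  · rw [real_inner_comm]

omit hP h [TopologicalSpace Y] [MeasurableSpace Y] [BorelSpace Y] in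
theorem add_ae_eq {u v : Lp ℝ 2 μ} (hu : u =ᵐ[μ] A.indicator fun x => H (Ψ x))
    (hv : v =ᵐ[μ] A.indicator fun x => H' (Ψ x)) :
    (u + v : Lp ℝ 2 μ) =ᵐ[μ] A.indicator fun x => (H + H') (Ψ x) :=
  ((Lp.coeFn_add u v).trans (hu.add hv)).trans
    (Eventually.of_forall fun x => congrFun (indicator_add A _ _).symm x)

omit hP h [TopologicalSpace Y] [MeasurableSpace Y] [BorelSpace Y] in
theorem smul_ae_eq {u : Lp ℝ 2 μ} (hu : u =ᵐ[μ] A.indicator fun x => H (Ψ x)) (c : ℝ) :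
    (c • u : Lp ℝ 2 μ) =ᵐ[μ] A.indicator fun x => (c • H) (Ψ x) :=
  ((Lp.coeFn_smul c u).trans (hu.const_smul c)).trans
    (Eventually.of_forall fun x => congrFun (indicator_const_smul A c _).symm x)

omit hP h [TopologicalSpace Y] [MeasurableSpace Y] [BorelSpace Y] in
theorem sub_ae_eq {u v : Lp ℝ 2 μ} (hu : u =ᵐ[μ] A.indicator fun x => H (Ψ x))
    (hv : v =ᵐ[μ] A.indicator fun x => H' (Ψ x)) :
    (u - v : Lp ℝ 2 μ) =ᵐ[μ] A.indicator fun x => (H - H') (Ψ x) :=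
  ((Lp.coeFn_sub u v).trans (hu.sub hv)).trans
    (Eventually.of_forall fun x => congrFun (indicator_sub A _ _).symm x)

theorem norm_eq {u : Lp ℝ 2 μ} {u' : Lp ℝ 2 ν} (hH : HasL2Density C H)
    (hu : u =ᵐ[μ] A.indicator fun x => H (Ψ x)) (hu' : u' =ᵐ[ν] fun y => H (ι y)) :
    ‖u‖ = ‖u'‖ := by
  rw [Lp.norm_def, Lp.norm_def, eLpNorm_congr_ae hu, eLpNorm_congr_ae hu', hP.eLpNorm_eq h hH]

theorem normOne_eq {u : Lp ℝ 2 μ} {u' : Lp ℝ 2 ν} (hH : H ∈ traceDomain C ι ν)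
    (hu : u =ᵐ[μ] A.indicator fun x => H (Ψ x)) (hu' : u' =ᵐ[ν] fun y => H (ι y)) :
    (pullbackForm C ι ν A Ψ μ).normOne u = (traceForm C ι ν).normOne u' := by
  rw [L2Form.normOne, L2Form.normOne, hP.form_eq h hH hH hu hu, h.traceForm_form hH hH hu' hu',
    hP.norm_eq h hH.1 hu hu']

theorem isWideDirichletForm : (pullbackForm C ι ν A Ψ μ).IsWideDirichletForm where
  zero_mem := by
    refine ⟨0, traceDomain_zero, (Lp.coeFn_zero _ _ _).trans (Eventually.of_forall fun x => ?_)⟩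
    simp
  add_mem := by
    rintro u ⟨H, hH, hu⟩ v ⟨H', hH', hv⟩
    exact ⟨H + H', traceDomain_add hH hH', add_ae_eq hu hv⟩
  smul_mem := by
    rintro c u ⟨H, hH, hu⟩
    exact ⟨c • H, traceDomain_smul hH c, smul_ae_eq hu c⟩
  form_add := by
    rintro u ⟨H, hH, hu⟩ v ⟨H', hH', hv⟩ w ⟨K, hK, hw⟩
    rw [hP.form_eq h hH hK hu hw, hP.form_eq h hH' hK hv hw,
      hP.form_eq h (traceDomain_add hH hH') hK (add_ae_eq hu hv) hw,
      hH.1.density_add hH'.1, inner_add_left]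
    ring
  form_smul := by
    rintro c u ⟨H, hH, hu⟩ w ⟨K, hK, hw⟩
    rw [hP.form_eq h hH hK hu hw, hP.form_eq h (traceDomain_smul hH c) hK (smul_ae_eq hu c) hw,
      hH.1.density_smul, real_inner_smul_left]
    ring
  symm := by
    rintro u ⟨H, hH, hu⟩ v ⟨H', hH', hv⟩
    rw [hP.form_eq h hH hH' hu hv, hP.form_eq h hH' hH hv hu, real_inner_comm]
  nonneg := by
    rintro u ⟨H, hH, hu⟩
    rw [hP.form_eq h hH hH hu hu]
    exact mul_nonneg (by norm_num) real_inner_self_nonneg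
  closed := by
    intro u hu hcauchy
    choose H hH hu using hu
    have hu' : ∀ n, (hH n).2.2.toLp _ =ᵐ[ν] fun y => H n (ι y) := fun n => MemLp.coeFn_toLp _
    obtain ⟨v', ⟨H₀, hH₀, hv'⟩, hlim⟩ := h.isWideDirichletForm.closed
      (fun n => (hH n).2.2.toLp _) (fun n => ⟨H n, hH n, hu' n⟩) (by
        intro ε hε
        obtain ⟨N, hN⟩ := hcauchy ε hε
        refine ⟨N, fun p hp q hq => ?_⟩
        rw [← hP.normOne_eq h (traceDomain_sub (hH p) (hH q)) (sub_ae_eq (hu p) (hu q))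
          (Lp.sub_ae_eq (hu' p) (hu' q))]
        exact hN p hp q hq)
    have hv := ((hP.memLp_iff h hH₀.1).2 hH₀.2.2).coeFn_toLp
    refine ⟨_, ⟨H₀, hH₀, hv⟩, hlim.congr fun n => ?_⟩
    exact (hP.normOne_eq h (traceDomain_sub (hH n) hH₀) (sub_ae_eq (hu n) hv)
      (Lp.sub_ae_eq (hu' n) hv')).symm
  markov := by
    rintro u ⟨H, hH, hu⟩ v hv
    have hφ : ∀ s t : ℝ, |max 0 (min s 1) - max 0 (min t 1)| ≤ |s - t| := by
      intro s t
      grind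
    obtain ⟨hm, hn⟩ := traceDomain_comp hH (φ := fun t => max 0 (min t 1)) (by simp) hφ
    have hv' : v =ᵐ[μ] A.indicator fun x => ((fun t => max 0 (min t 1)) ∘ H) (Ψ x) := by
      filter_upwards [hv, hu] with x hx hx'
      rw [hx, hx']
      by_cases hxA : x ∈ A
      · rw [indicator_of_mem hxA, indicator_of_mem hxA, Function.comp_apply]
      · rw [indicator_of_notMem hxA, indicator_of_notMem hxA]
        simp
    refine ⟨⟨_, hm, hv'⟩, ?_⟩
    rw [hP.form_eq h hm hm hv' hv', hP.form_eq h hH hH hu hu, real_inner_self_eq_norm_sq,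
      real_inner_self_eq_norm_sq]
    gcongr

omit hP [BorelSpace Y] in
theorem _root_.IsTraceEmbedding.exists_bound (hH : HasL2Density C H)
    (hb : eLpNorm (fun y => H (ι y)) ∞ ν < ∞) : ∃ N, ∀ c ∈ C, |H c| ≤ N := by
  have := h.open_pos
  have hc := h.continuous_comp hH.continuousOn
  refine ⟨(eLpNorm (fun y => H (ι y)) ∞ ν).toReal, fun c hcC => ?_⟩
  have h₁ : ∀ᵐ y ∂ν, |H (ι y)| ≤ (eLpNorm (fun y => H (ι y)) ∞ ν).toReal := by
    filter_upwards [ae_le_eLpNormEssSup (f := fun y => H (ι y)) (μ := ν)] with y hy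
    rw [← eLpNorm_exponent_top] at hy
    have := ENNReal.toReal_mono hb.ne hy
    simpa using this
  generalize (eLpNorm (fun y => H (ι y)) ∞ ν).toReal = N at h₁ ⊢
  have h₂ : ∀ y, |H (ι y)| ≤ N := by
    have hcl : IsClosed {y | |H (ι y)| ≤ N} := isClosed_le hc.abs continuous_const
    have hd : Dense {y | |H (ι y)| ≤ N} := Measure.dense_of_ae h₁
    intro y
    have := hd y
    rwa [hcl.closure_eq] at this
  obtain ⟨H₁, he, hd⟩ := hH.exists_extension
  rw [he hcC]
  refine closure_minimal ?_ (isClosed_le hd.continuous.abs continuous_const)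
    (h.subset_closure hcC)
  rintro _ ⟨y, rfl⟩
  change |H₁ (ι y)| ≤ N
  rw [← he (h.mem y)]
  exact h₂ y

omit hP [BorelSpace Y] in
/-- The bounded functions in the domain of a trace form are an algebra. -/
theorem _root_.IsTraceEmbedding.traceDomain_mul (hH : H ∈ traceDomain C ι ν)
    (hH' : H' ∈ traceDomain C ι ν) (hb : eLpNorm (fun y => H (ι y)) ∞ ν < ∞)
    (hb' : eLpNorm (fun y => H' (ι y)) ∞ ν < ∞) :
    H * H' ∈ traceDomain C ι ν ∧ eLpNorm (fun y => (H * H') (ι y)) ∞ ν < ∞ := by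
  obtain ⟨N, hN⟩ := h.exists_bound hH.1 hb
  obtain ⟨N', hN'⟩ := h.exists_bound hH'.1 hb'
  -- Clamping at the bounds changes nothing on `C` but makes the extensions bounded on the whole
  -- line, as the product rule requires. The absolute value is there because the sign of the bounds
  -- is not known.
  have hclamp : ∀ a s t : ℝ, |max (-|a|) (min s |a|) - max (-|a|) (min t |a|)| ≤ |s - t| := by
    intro a s t
    generalize |a| = b
    grind
  have hle : ∀ a s : ℝ, |max (-|a|) (min s |a|)| ≤ |a| := by
    intro a s
    have := abs_nonneg a
    generalize |a| = b at *
    grind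
  have hid : ∀ a s : ℝ, |s| ≤ a → max (-|a|) (min s |a|) = s := by
    intro a s hs
    have := abs_nonneg a
    grind
  obtain ⟨H₁, he, hd⟩ := hH.1.exists_extension
  obtain ⟨H₁', he', hd'⟩ := hH'.1.exists_extension
  obtain ⟨G, hG, -⟩ := hd.contraction (hclamp N)
  obtain ⟨G', hG', -⟩ := hd'.contraction (hclamp N')
  obtain ⟨K, hK, -⟩ := hG.mul hG' (fun x => hle N _) (fun x => hle N' _)
  have hbd : ∀ y, |H (ι y)| ≤ N := fun y => hN _ (h.mem y)
  refine ⟨⟨⟨K, (hK.mono (subset_univ C)).congr fun x hx => ?_⟩, fun x hx => ?_, ?_⟩, ?_⟩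
  · simp only [Pi.mul_apply, Function.comp_apply]
    rw [← he hx, ← he' hx, hid N _ (hN x hx), hid N' _ (hN' x hx)]
  · rw [Pi.mul_apply, hH.2.1 x hx, zero_mul]
  · refine MemLp.of_le_mul (c := N) hH'.2.2
      (hH.2.2.aestronglyMeasurable.mul hH'.2.2.aestronglyMeasurable)
      (Eventually.of_forall fun y => ?_)
    rw [Pi.mul_apply, norm_mul]
    exact mul_le_mul_of_nonneg_right (hbd y) (norm_nonneg _)
  · refine (eLpNormEssSup_le_of_ae_bound (C := N * N') (Eventually.of_forall fun y => ?_)).trans_lt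
      ENNReal.ofReal_lt_top
    rw [Pi.mul_apply, norm_mul]
    exact mul_le_mul (hbd y) (hN' _ (h.mem y)) (norm_nonneg _) ((abs_nonneg _).trans (hbd y))

/-- The isomorphism exchanges the two realizations of the same `H`. Either realization determines
`H` on `C`, so the map is well defined and injective, and all norms agree because `Ψ` preserves
measure on `A`. -/
theorem equivalent : (pullbackForm C ι ν A Ψ μ).Equivalent (traceForm C ι ν) := by
  classical
  -- Outside the domain the value is irrelevant and set to `0`.
  have key : ∀ u : Lp ℝ 2 μ, ∃ u' : Lp ℝ 2 ν, ∀ H ∈ traceDomain C ι ν,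
      (u =ᵐ[μ] A.indicator fun x => H (Ψ x)) → u' =ᵐ[ν] fun y => H (ι y) := by
    intro u
    by_cases hu : ∃ H ∈ traceDomain C ι ν, u =ᵐ[μ] A.indicator fun x => H (Ψ x)
    · obtain ⟨H, hH, hu⟩ := hu
      refine ⟨hH.2.2.toLp _, fun H' hH' hu' => (MemLp.coeFn_toLp _).trans ?_⟩
      have := hP.eqOn_of_ae_eq h hH.1 hH'.1 (hu.symm.trans hu')
      exact Eventually.of_forall fun y => this (h.mem y)
    · exact ⟨0, fun H hH hu' => (hu ⟨H, hH, hu'⟩).elim⟩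
  choose Φ hΦ using key
  have hbd : ∀ u, ∀ H ∈ traceDomain C ι ν, (u =ᵐ[μ] A.indicator fun x => H (Ψ x)) →
      eLpNorm u ∞ μ = eLpNorm (fun y => H (ι y)) ∞ ν := fun u H hH hu => by
    rw [eLpNorm_congr_ae hu, hP.eLpNorm_eq h hH.1]
  refine ⟨Φ, ⟨?_, ?_, ?_⟩, ?_, ?_, ?_, ?_⟩
  · rintro u ⟨⟨H, hH, hu⟩, hb⟩
    refine ⟨⟨H, hH, hΦ u H hH hu⟩, ?_⟩
    rwa [eLpNorm_congr_ae (hΦ u H hH hu), ← hbd u H hH hu]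
  · rintro u ⟨⟨H, hH, hu⟩, hb⟩ v ⟨⟨H', hH', hv⟩, hb'⟩ huv
    have h₁ := hΦ u H hH hu
    rw [huv] at h₁
    have h₂ := h.eqOn_of_ae_eq hH.1 hH'.1 (h₁.symm.trans (hΦ v H' hH' hv))
    refine Lp.ext (hu.trans (.trans (Eventually.of_forall fun x => ?_) hv.symm))
    exact congrFun (indicator_congr fun x hx => h₂ (hP.mem x hx)) x
  · rintro u' ⟨⟨H, hH, hu'⟩, hb⟩
    have hm := ((hP.memLp_iff h hH.1).2 hH.2.2).coeFn_toLp
    refine ⟨_, ⟨⟨H, hH, hm⟩, ?_⟩, Lp.ext ((hΦ _ H hH hm).trans hu'.symm)⟩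
    rwa [hbd _ H hH hm, ← eLpNorm_congr_ae hu']
  · rintro u ⟨⟨H, hH, hu⟩, hb⟩ v ⟨⟨H', hH', hv⟩, hb'⟩
    refine Lp.ext ((hΦ _ _ (traceDomain_add hH hH') (add_ae_eq hu hv)).trans ?_)
    exact (((Lp.coeFn_add _ _).trans ((hΦ u H hH hu).add (hΦ v H' hH' hv)))).symm
  · rintro c u ⟨⟨H, hH, hu⟩, hb⟩
    refine Lp.ext ((hΦ _ _ (traceDomain_smul hH c) (smul_ae_eq hu c)).trans ?_)
    exact ((Lp.coeFn_smul _ _).trans ((hΦ u H hH hu).const_smul c)).symm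
  · rintro u ⟨⟨H, hH, hu⟩, hb⟩ v ⟨⟨H', hH', hv⟩, hb'⟩
    rw [hbd u H hH hu] at hb
    rw [hbd v H' hH' hv] at hb'
    obtain ⟨hm, hb''⟩ := h.traceDomain_mul hH hH' hb hb'
    have hw := ((hP.memLp_iff h hm.1).2 hm.2.2).coeFn_toLp
    refine ⟨_, ⟨⟨_, hm, hw⟩, ?_⟩, ?_, ?_⟩
    · rwa [hbd _ _ hm hw]
    · filter_upwards [hw, hu, hv] with x h₁ h₂ h₃
      rw [h₁, h₂, h₃]
      exact congrFun (indicator_mul A (fun x => H (Ψ x)) fun x => H' (Ψ x)) x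
    · filter_upwards [hΦ _ _ hm hw, hΦ u H hH hu, hΦ v H' hH' hv] with y h₁ h₂ h₃
      rw [h₁, h₂, h₃, Pi.mul_apply]
  · rintro u ⟨⟨H, hH, hu⟩, hb⟩
    have h₁ := hΦ u H hH hu
    refine ⟨?_, hP.norm_eq h hH.1 hu h₁, ?_⟩
    · rw [hbd u H hH hu, eLpNorm_congr_ae h₁]
    · rw [hP.form_eq h hH hH hu hu, h.traceForm_form hH hH h₁ h₁]

theorem isRegularRepresentation :
    (pullbackForm C ι ν A Ψ μ).IsRegularRepresentation (traceForm C ι ν) :=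
  ⟨hP.isWideDirichletForm h, h.isRegularDirichletForm, hP.equivalent h⟩

end IsTracePullback

/-- The energy as an integral of the squared derivative and a sum over the gaps. -/
theorem IsTraceEmbedding.energy_formula {C D : Set ℝ} (hC : IsClosed C) (hDC : D ⊆ C)
    (hD : (C \ D).Finite) {H K : ℝ → ℝ} (hH : HasL2Density C H) (hK : EqOn K H D) :
    (∀ᵐ x ∂volume.restrict D, DifferentiableWithinAt ℝ K D x) ∧
    IntegrableOn (fun x => derivWithin K D x ^ 2) D ∧
    HasSum (fun g : gapSet C => (H g.1.2 - H g.1.1) * (H g.1.2 - H g.1.1) / (g.1.2 - g.1.1))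
      (inner ℝ (density C H) (density C H) - ∫ x in D, derivWithin K D x ^ 2) := by
  have hDm : MeasurableSet D := by
    have : D = C \ (C \ D) := by rw [sdiff_sdiff_right_self, inter_eq_right.2 hDC]
    rw [this]
    exact hC.measurableSet.diff hD.measurableSet
  have hder : ∀ᵐ x, x ∈ D → HasDerivWithinAt K (density C H x) D x :=
    ((hH.isDensity.mono hDC).congr hK.symm).ae_hasDerivWithinAt
  have hder' : ∀ᵐ x, x ∈ D → derivWithin K D x = density C H x := by
    filter_upwards [hder, ae_uniqueDiffWithinAt D] with x h₁ h₂ hx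
    exact (h₁ hx).derivWithin (h₂ hx)
  have hsq : EqOn (fun x => density C H x * density C H x) (fun x => density C H x ^ 2) D :=
    fun x _ => (sq _).symm
  refine ⟨?_, ?_, ?_⟩
  · rw [ae_restrict_iff' hDm]
    filter_upwards [hder] with x hx hxD
    exact (hx hxD).differentiableWithinAt
  · refine ((LineL2.integrable_mul (density C H) (density C H)).integrableOn (s := D)).congr ?_
    rw [EventuallyEq, ae_restrict_iff' hDm]
    filter_upwards [hder'] with x hx hxD
    rw [hx hxD, sq]
  · have := hasSum_gap_inner hC hH hH
    have hCD : C =ᵐ[volume] D := by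
      refine (ae_eq_set.2 ⟨hD.measure_zero _, ?_⟩)
      rw [sdiff_eq_empty.2 hDC, measure_empty]
    rw [setIntegral_congr_set hCD] at this
    convert this using 2
    refine setIntegral_congr_ae hDm ?_
    filter_upwards [hder'] with x hx hxD
    rw [hx hxD, sq]

/-! ### The scale extended to `I`, and its flat intervals -/

namespace ScaleTriple

variable (T : ScaleTriple) {x y z : ℝ}

theorem zero_mem_openPart : (0 : ℝ) ∈ T.openPart := ⟨T.l_neg, T.r_pos⟩

theorem l_lt_r : T.l < T.r := T.l_neg.trans T.r_pos

theorem isOpen_openPart : IsOpen T.openPart :=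
  isOpen_Ioo.preimage continuous_coe_real_ereal

theorem ordConnected_openPart : T.openPart.OrdConnected :=
  ⟨fun _ hx _ hy _ hz => ⟨hx.1.trans_le (EReal.coe_le_coe_iff.2 hz.1),
    (EReal.coe_le_coe_iff.2 hz.2).trans_lt hy.2⟩⟩

variable {T}

theorem exists_mem_openPart {x : EReal} (hl : T.l < x) (hr : x < T.r) :
    ∃ y ∈ T.openPart, (y : EReal) = x := by
  induction x with
  | bot => exact (not_lt_bot hl).elim
  | top => exact (not_top_lt hr).elim
  | coe x => exact ⟨x, ⟨hl, hr⟩, rfl⟩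

theorem scale_coe (hx : x ∈ T.openPart) : T.scale x = T.s x := by
  rw [scale, if_neg (not_le.2 hx.1), if_neg (not_le.2 hx.2), EReal.toReal_coe]

theorem scale_left : T.scale T.l = ⨅ y ∈ T.openPart, (T.s y : EReal) := by
  rw [scale, if_pos le_rfl]

theorem scale_right : T.scale T.r = ⨆ y ∈ T.openPart, (T.s y : EReal) := by
  rw [scale, if_neg (not_le.2 T.l_lt_r), if_pos le_rfl]

theorem scale_of_le_left {x : EReal} (hx : x ≤ T.l) : T.scale x = T.scale T.l := by
  rw [scale, if_pos hx, scale_left]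

theorem scale_of_right_le {x : EReal} (hx : T.r ≤ x) : T.scale x = T.scale T.r := by
  rw [scale, if_neg (not_le.2 (T.l_lt_r.trans_le hx)), if_pos hx, scale_right]

theorem scale_left_le (hx : x ∈ T.openPart) : T.scale T.l ≤ T.s x := by
  rw [scale_left]
  exact iInf₂_le x hx

theorem le_scale_right (hx : x ∈ T.openPart) : (T.s x : EReal) ≤ T.scale T.r := by
  rw [scale_right]
  exact le_iSup₂ (f := fun y (_ : y ∈ T.openPart) => (T.s y : EReal)) x hx

theorem exists_s_lt {b : EReal} (hb : T.scale T.l < b) : ∃ x ∈ T.openPart, (T.s x : EReal) < b := by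
  rw [scale_left] at hb
  simpa only [iInf_lt_iff, exists_prop] using hb

theorem exists_lt_s {b : EReal} (hb : b < T.scale T.r) : ∃ x ∈ T.openPart, b < (T.s x : EReal) := by
  rw [scale_right] at hb
  simpa only [lt_iSup_iff, exists_prop] using hb

theorem eq_left_or_right_or_coe (x : EReal) :
    x ≤ T.l ∨ T.r ≤ x ∨ ∃ y ∈ T.openPart, (y : EReal) = x := by
  rcases le_or_gt x T.l with h | h
  · exact Or.inl h
  rcases le_or_gt T.r x with h' | h'
  · exact Or.inr (Or.inl h')
  exact Or.inr (Or.inr (exists_mem_openPart h h'))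

theorem scale_left_le_scale (x : EReal) : T.scale T.l ≤ T.scale x := by
  rcases T.eq_left_or_right_or_coe x with h | h | ⟨y, hy, rfl⟩
  · rw [scale_of_le_left h]
  · rw [scale_of_right_le h]
    exact (scale_left_le T.zero_mem_openPart).trans (le_scale_right T.zero_mem_openPart)
  · rw [scale_coe hy]
    exact scale_left_le hy

theorem scale_le_scale_right (x : EReal) : T.scale x ≤ T.scale T.r := by
  rcases T.eq_left_or_right_or_coe x with h | h | ⟨y, hy, rfl⟩
  · rw [scale_of_le_left h]
    exact (scale_left_le T.zero_mem_openPart).trans (le_scale_right T.zero_mem_openPart)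
  · rw [scale_of_right_le h]
  · rw [scale_coe hy]
    exact le_scale_right hy

theorem scale_mono : Monotone T.scale := by
  intro x y hxy
  rcases T.eq_left_or_right_or_coe x with h | h | ⟨x, hx, rfl⟩
  · rw [scale_of_le_left h]
    exact scale_left_le_scale y
  · rw [scale_of_right_le h, scale_of_right_le (h.trans hxy)]
  rcases T.eq_left_or_right_or_coe y with h' | h' | ⟨y, hy, rfl⟩
  · exact (not_lt.2 (hxy.trans h') hx.1).elim
  · rw [scale_of_right_le h']
    exact scale_le_scale_right _
  · rw [scale_coe hx, scale_coe hy, EReal.coe_le_coe_iff]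
    exact T.s_mono hx hy (EReal.coe_le_coe_iff.1 hxy)

theorem scale_left_lt_scale_right : T.scale T.l < T.scale T.r := by
  obtain ⟨x, y, hx, hx', hy, hy', hne⟩ := T.s_nonconst
  rcases lt_or_gt_of_ne hne with h | h
  · exact (scale_left_le ⟨hx, hx'⟩).trans_lt
      ((EReal.coe_lt_coe_iff.2 h).trans_le (le_scale_right ⟨hy, hy'⟩))
  · exact (scale_left_le ⟨hy, hy'⟩).trans_lt
      ((EReal.coe_lt_coe_iff.2 h).trans_le (le_scale_right ⟨hx, hx'⟩))

theorem scale_left_le_zero : T.scale T.l ≤ (0 : ℝ) := by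
  simpa [T.s_zero] using scale_left_le T.zero_mem_openPart

theorem zero_le_scale_right : ((0 : ℝ) : EReal) ≤ T.scale T.r := by
  simpa [T.s_zero] using le_scale_right T.zero_mem_openPart

theorem scale_left_ne_top : T.scale T.l ≠ ⊤ :=
  (scale_left_le_zero.trans_lt (EReal.coe_lt_top 0)).ne

theorem scale_right_ne_bot : T.scale T.r ≠ ⊥ :=
  ((EReal.bot_lt_coe 0).trans_le zero_le_scale_right).ne'

/-- The value at `l` is the infimum of the values inside, and the scale is constant below `l`. In
particular the endpoints of `I` are never discontinuity points. -/
theorem continuousAt_scale_left : ContinuousAt T.scale T.l := by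
  refine tendsto_order.2 ⟨fun a ha => Eventually.of_forall fun x =>
    ha.trans_le (scale_left_le_scale x), fun b hb => ?_⟩
  obtain ⟨x, hx, hxb⟩ := exists_s_lt hb
  filter_upwards [Iio_mem_nhds hx.1] with y hy
  exact (scale_mono (le_of_lt hy)).trans_lt (by rwa [scale_coe hx])

theorem continuousAt_scale_right : ContinuousAt T.scale T.r := by
  refine tendsto_order.2 ⟨fun a ha => ?_, fun a ha => Eventually.of_forall fun x =>
    (scale_le_scale_right x).trans_lt ha⟩
  obtain ⟨x, hx, hxb⟩ := exists_lt_s ha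
  filter_upwards [Ioi_mem_nhds hx.2] with y hy
  exact lt_of_lt_of_le (by rwa [scale_coe hx]) (scale_mono (le_of_lt hy))

theorem continuousAt_scale {x : EReal} (hx : x ∈ T.I) (hp : x ∉ T.Dplus) (hm : x ∉ T.Dminus) :
    ContinuousAt T.scale x := by
  have h₁ : T.scale x = Function.rightLim T.scale x := by_contra fun h => hp ⟨hx, h⟩
  have h₂ : T.scale x = Function.leftLim T.scale x := by_contra fun h => hm ⟨hx, h⟩
  rw [scale_mono.continuousAt_iff_leftLim_eq_rightLim, ← h₁, ← h₂]

theorem ne_of_mem_Dplus {x : EReal} (hx : x ∈ T.Dplus) : T.l < x ∧ x < T.r := by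
  have h : ¬ContinuousAt T.scale x := fun h =>
    hx.2 (scale_mono.continuousWithinAt_Ioi_iff_rightLim_eq.1 h.continuousWithinAt).symm
  exact ⟨lt_of_le_of_ne hx.1.1 fun e => h (e ▸ continuousAt_scale_left),
    lt_of_le_of_ne hx.1.2 fun e => h (e ▸ continuousAt_scale_right)⟩

theorem ne_of_mem_Dminus {x : EReal} (hx : x ∈ T.Dminus) : T.l < x ∧ x < T.r := by
  have h : ¬ContinuousAt T.scale x := fun h =>
    hx.2 (scale_mono.continuousWithinAt_Iio_iff_leftLim_eq.1 h.continuousWithinAt).symm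
  exact ⟨lt_of_le_of_ne hx.1.1 fun e => h (e ▸ continuousAt_scale_left),
    lt_of_le_of_ne hx.1.2 fun e => h (e ▸ continuousAt_scale_right)⟩

theorem isOpen_U : IsOpen (T.U \ {T.l, T.r}) := by
  rw [isOpen_iff_mem_nhds]
  rintro x ⟨⟨hxI, V, hV, hc⟩, hne⟩
  simp only [mem_insert_iff, mem_singleton_iff, not_or] at hne
  have hx : x ∈ Ioo T.l T.r :=
    ⟨lt_of_le_of_ne hxI.1 (Ne.symm hne.1), lt_of_le_of_ne hxI.2 hne.2⟩
  filter_upwards [interior_mem_nhds.2 hV, isOpen_Ioo.mem_nhds hx] with y hy hy'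
  refine ⟨⟨Ioo_subset_Icc_self hy', V, mem_interior_iff_mem_nhds.1 hy, hc⟩, ?_⟩
  simp only [mem_insert_iff, mem_singleton_iff, not_or]
  exact ⟨hy'.1.ne', hy'.2.ne⟩

theorem Ioo_subset_U {a b : EReal} (hab : Ioo a b ⊆ Ioo T.l T.r)
    (hc : ∀ x ∈ Ioo a b, ∀ y ∈ Ioo a b, T.scale x = T.scale y) : Ioo a b ⊆ T.U \ {T.l, T.r} := by
  intro x hx
  refine ⟨⟨Ioo_subset_Icc_self (hab hx), Ioo a b, isOpen_Ioo.mem_nhds hx,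
    fun y hy z hz => hc y hy.1 z hz.1⟩, ?_⟩
  simp only [mem_insert_iff, mem_singleton_iff, not_or]
  exact ⟨(hab hx).1.ne', (hab hx).2.ne⟩

/-- Every point of `U` inside `(l, r)` lies in one of the flat intervals. -/
theorem exists_isFlat {e : EReal} (he : e ∈ T.U \ {T.l, T.r}) :
    ∃ c d, T.IsFlat c d ∧ e ∈ Ioo c d := by
  set O := T.U \ {T.l, T.r} with hO
  have hcl : IsClosed Oᶜ := T.isOpen_U.isClosed_compl
  have hl : T.l ∈ Oᶜ := fun h => h.2 (mem_insert _ _)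
  have hr : T.r ∈ Oᶜ := fun h => h.2 (mem_insert_of_mem _ rfl)
  obtain ⟨c, ⟨hcO, hce⟩, hcm⟩ := (hcl.inter isClosed_Iic).isCompact.exists_isGreatest
    (s := Oᶜ ∩ Iic e) ⟨T.l, hl, he.1.1.1⟩
  obtain ⟨d, ⟨hdO, hde⟩, hdm⟩ := (hcl.inter isClosed_Ici).isCompact.exists_isLeast
    (s := Oᶜ ∩ Ici e) ⟨T.r, hr, he.1.1.2⟩
  have hce' : c < e := lt_of_le_of_ne hce fun h => hcO (h ▸ he)
  have hde' : e < d := lt_of_le_of_ne hde fun h => hdO (h ▸ he)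
  refine ⟨c, d, ⟨hce'.trans hde', fun x hx => ?_, hcO, hdO⟩, hce', hde'⟩
  by_contra hxO
  rcases le_total x e with h | h
  · exact not_le.2 hx.1 (hcm ⟨hxO, h⟩)
  · exact not_le.2 hx.2 (hdm ⟨hxO, h⟩)

theorem IsFlat.Ioo_subset {c d : EReal} (h : T.IsFlat c d) : Ioo c d ⊆ Ioo T.l T.r := by
  intro x hx
  have hx' := h.2.1 hx
  have := hx'.2
  simp only [mem_insert_iff, mem_singleton_iff, not_or] at this
  exact ⟨lt_of_le_of_ne hx'.1.1.1 (Ne.symm this.1), lt_of_le_of_ne hx'.1.1.2 this.2⟩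

theorem IsFlat.left_le {c d : EReal} (h : T.IsFlat c d) : T.l ≤ c :=
  le_of_forall_gt_imp_ge_of_dense fun x hx => by
    by_contra! hxl
    obtain ⟨y, hy, hy'⟩ := exists_between (lt_min hx h.1)
    rcases lt_or_ge x d with hd | hd
    · exact lt_asymm (h.Ioo_subset ⟨hx, hd⟩).1 hxl
    · rw [lt_min_iff] at hy'
      exact lt_asymm (h.Ioo_subset ⟨hy, hy'.2⟩).1 (hy'.1.trans hxl)

theorem IsFlat.le_right {c d : EReal} (h : T.IsFlat c d) : d ≤ T.r :=
  le_of_forall_lt_imp_le_of_dense fun x hx => by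
    by_contra! hxl
    obtain ⟨y, hy, hy'⟩ := exists_between (max_lt hx h.1)
    rcases lt_or_ge c x with hd | hd
    · exact lt_asymm (h.Ioo_subset ⟨hd, hx⟩).2 hxl
    · rw [max_lt_iff] at hy
      exact lt_asymm (h.Ioo_subset ⟨hy.2, hy'⟩).2 (hxl.trans hy.1)

end ScaleTriple

namespace ScaleTriple

variable {T : ScaleTriple}

/-! ### The darned space -/

/-- The map `x ↦ (arctan x, arctan s(x))`. -/
def graphMap (T : ScaleTriple) (x : T.ScaleSpace) : ℝ × ℝ := (arctanE x.1, arctanE (T.scale x.1))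

/-- The metric is equivalent to the one induced by this map into a square. So the space is totally
bounded, and its completion is compact. -/
theorem isUniformInducing_graphMap : IsUniformInducing T.graphMap := by
  have hd : ∀ x y : T.ScaleSpace, dist x y = |arctanE x.1 - arctanE y.1| +
      |arctanE (T.scale x.1) - arctanE (T.scale y.1)| := fun _ _ => rfl
  have hg : ∀ x y : T.ScaleSpace, dist (T.graphMap x) (T.graphMap y) =
      max |arctanE x.1 - arctanE y.1| |arctanE (T.scale x.1) - arctanE (T.scale y.1)| :=
    fun _ _ => rfl
  have hL : LipschitzWith 1 T.graphMap := LipschitzWith.of_dist_le_mul fun x y => by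
    rw [hd, hg, NNReal.coe_one, one_mul]
    exact max_le (le_add_of_nonneg_right (abs_nonneg _)) (le_add_of_nonneg_left (abs_nonneg _))
  have hA : AntilipschitzWith 2 T.graphMap := AntilipschitzWith.of_le_mul_dist fun x y => by
    rw [hd, hg, NNReal.coe_ofNat, two_mul]
    exact add_le_add (le_max_left _ _) (le_max_right _ _)
  exact hA.isUniformInducing hL.uniformContinuous

instance : CompactSpace T.ScaleCompletion := by
  have h₁ : TotallyBounded (univ : Set T.ScaleSpace) := by
    have hb : TotallyBounded (Icc (-(Real.pi / 2)) (Real.pi / 2) ×ˢ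
        Icc (-(Real.pi / 2)) (Real.pi / 2)) :=
      (isCompact_Icc.prod isCompact_Icc).totallyBounded
    refine (totallyBounded_preimage isUniformInducing_graphMap hb).subset fun x _ => ?_
    exact ⟨arctanE_mem _, arctanE_mem _⟩
  have h₂ := (h₁.image (UniformSpace.Completion.uniformContinuous_coe T.ScaleSpace)).closure
  rw [image_univ, UniformSpace.Completion.denseRange_coe.closure_range] at h₂
  exact ⟨isCompact_iff_totallyBounded_isComplete.2 ⟨h₂, isClosed_univ.isComplete⟩⟩

/-- The position of a point of the scale completion: its value is `x` at `x` and `x±`. -/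
def position (T : ScaleTriple) : T.ScaleCompletion → ℝ :=
  UniformSpace.Completion.extension fun x : T.ScaleSpace => arctanE x.1

theorem position_continuous : Continuous T.position := UniformSpace.Completion.continuous_extension

theorem position_coe (x : T.ScaleSpace) : T.position x = arctanE x.1 :=
  UniformSpace.Completion.extension_coe
    (uniformContinuous_fst.comp isUniformInducing_graphMap.uniformContinuous) x

theorem position_mem (p : T.ScaleCompletion) :
    T.position p ∈ Icc (arctanE T.l) (arctanE T.r) := by
  have hcl : IsClosed (T.position ⁻¹' Icc (arctanE T.l) (arctanE T.r)) :=
    isClosed_Icc.preimage position_continuous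
  refine UniformSpace.Completion.induction_on p hcl fun x => ?_
  rw [position_coe]
  exact ⟨arctanE_strictMono.monotone x.2.1, arctanE_strictMono.monotone x.2.2⟩

/-- A point of the completion is determined by its position and the value of the scale. -/
theorem scaleCompletion_ext {p q : T.ScaleCompletion} (h₁ : T.position p = T.position q)
    (h₂ : T.scaleBar p = T.scaleBar q) : p = q := by
  -- Both sides are continuous and agree on the dense image of `I`.
  have hd : ∀ p q : T.ScaleCompletion, dist p q = |T.position p - T.position q| +
      |arctanE (T.scaleBar p) - arctanE (T.scaleBar q)| := by
    intro p q
    have hs : Continuous fun p => arctanE (T.scaleBar p) :=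
      arctanE_continuous.comp T.scaleBar_continuous
    refine UniformSpace.Completion.induction_on₂ p q (isClosed_eq (by fun_prop) ?_) fun x y => ?_
    · exact (((position_continuous.comp continuous_fst).sub
        (position_continuous.comp continuous_snd)).abs).add
        ((hs.comp continuous_fst).sub (hs.comp continuous_snd)).abs
    · rw [UniformSpace.Completion.dist_eq, position_coe, position_coe, T.scaleBar_coe,
        T.scaleBar_coe]
      rfl
  rw [← dist_eq_zero, hd, h₁, h₂]
  simp

theorem exists_position (p : T.ScaleCompletion) :
    ∃ a ∈ T.I, arctanE a = T.position p := by
  obtain ⟨h₁, h₂⟩ := position_mem p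
  obtain ⟨a, ha⟩ := arctanE_surj ⟨(arctanE_mem _).1.trans h₁, h₂.trans (arctanE_mem _).2⟩
  rw [← ha] at h₁ h₂
  exact ⟨a, ⟨arctanE_strictMono.le_iff_le.1 h₁, arctanE_strictMono.le_iff_le.1 h₂⟩, ha⟩

/-- If this failed, it would fail on a nonempty open set of points positioned before `x`; this set
contains a point of `I`, where it contradicts monotonicity. -/
theorem scaleBar_le_of_position_lt {p : T.ScaleCompletion} {x : EReal}
    (h : T.position p < arctanE x) : T.scaleBar p ≤ T.scale x := by
  have hcl : IsClosed {p | T.scaleBar p ≤ T.scale x} :=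
    isClosed_le T.scaleBar_continuous continuous_const
  have hop : IsOpen {p | T.position p < arctanE x} :=
    isOpen_lt position_continuous continuous_const
  by_contra hp
  obtain ⟨_, ⟨h₁, h₂⟩, ⟨y, rfl⟩⟩ := UniformSpace.Completion.denseRange_coe.inter_open_nonempty _
    (hop.inter hcl.isOpen_compl) ⟨p, h, hp⟩
  refine h₂ ?_
  change T.position y < _ at h₁
  change T.scaleBar y ≤ _
  rw [position_coe] at h₁
  rw [T.scaleBar_coe]
  exact scale_mono (arctanE_strictMono.lt_iff_lt.1 h₁).le

theorem le_scaleBar_of_lt_position {p : T.ScaleCompletion} {x : EReal}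
    (h : arctanE x < T.position p) : T.scale x ≤ T.scaleBar p := by
  have hcl : IsClosed {p | T.scale x ≤ T.scaleBar p} :=
    isClosed_le continuous_const T.scaleBar_continuous
  have hop : IsOpen {p | arctanE x < T.position p} :=
    isOpen_lt continuous_const position_continuous
  by_contra hp
  obtain ⟨_, ⟨h₁, h₂⟩, ⟨y, rfl⟩⟩ := UniformSpace.Completion.denseRange_coe.inter_open_nonempty _
    (hop.inter hcl.isOpen_compl) ⟨p, h, hp⟩
  refine h₂ ?_
  change _ < T.position y at h₁
  change _ ≤ T.scaleBar y
  rw [position_coe] at h₁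
  rw [T.scaleBar_coe]
  exact scale_mono (arctanE_strictMono.lt_iff_lt.1 h₁).le

/-- Between the positions `a < b` of the two points the scale is constant, so a flat interval
contains `(a, b)`. By compactness the closure of `(a, b)` in the completion has points at every
position in `[a, b]`, all on the same level; as position and level determine a point, `p` and `q`
are among them. -/
theorem darn_of_lt {p q : T.ScaleCompletion} (hpq : T.position p < T.position q)
    (h : T.scaleBar p = T.scaleBar q) : T.darn p q := by
  obtain ⟨a, haI, ha⟩ := exists_position p
  obtain ⟨b, hbI, hb⟩ := exists_position q
  rw [← ha, ← hb, arctanE_strictMono.lt_iff_lt] at hpq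
  have hconst : ∀ x ∈ Ioo a b, T.scale x = T.scaleBar p := by
    intro x hx
    refine le_antisymm ?_ (scaleBar_le_of_position_lt ?_)
    · rw [h]
      refine le_scaleBar_of_lt_position ?_
      rw [← hb]
      exact arctanE_strictMono hx.2
    · rw [← ha]
      exact arctanE_strictMono hx.1
  have hsub : Ioo a b ⊆ Ioo T.l T.r := fun x hx => ⟨haI.1.trans_lt hx.1, hx.2.trans_le hbI.2⟩
  have hU := Ioo_subset_U hsub fun x hx y hy => (hconst x hx).trans (hconst y hy).symm
  obtain ⟨e, hae, heb⟩ := exists_between hpq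
  obtain ⟨c, d, hcd, he⟩ := exists_isFlat (hU ⟨hae, heb⟩)
  have hca : c ≤ a := not_lt.1 fun hac => hcd.2.2.1 (hU ⟨hac, he.1.trans heb⟩)
  have hbd : b ≤ d := not_lt.1 fun hdb => hcd.2.2.2 (hU ⟨hae.trans he.2, hdb⟩)
  -- the points of the completion with position in `[a, b]` on the level of `p`
  have key : ∀ z : T.ScaleCompletion, T.scaleBar z = T.scaleBar p →
      T.position z ∈ Icc (arctanE a) (arctanE b) → z ∈ T.flatClosure c d := by
    intro z hz hzp
    have hK : IsCompact (closure ((fun x : T.ScaleSpace => (x : T.ScaleCompletion)) ''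
        {x | a < x.1 ∧ x.1 < b})) := isClosed_closure.isCompact
    have hIcc : Icc (arctanE a) (arctanE b) ⊆ T.position '' closure
        ((fun x : T.ScaleSpace => (x : T.ScaleCompletion)) '' {x | a < x.1 ∧ x.1 < b}) := by
      rw [← closure_Ioo (arctanE_strictMono hpq).ne]
      refine closure_minimal (fun t ht => ?_) (hK.image position_continuous).isClosed
      obtain ⟨x, rfl⟩ := arctanE_surj
        ⟨(arctanE_mem a).1.trans ht.1.le, ht.2.le.trans (arctanE_mem b).2⟩
      have hx : x ∈ Ioo a b :=
        ⟨arctanE_strictMono.lt_iff_lt.1 ht.1, arctanE_strictMono.lt_iff_lt.1 ht.2⟩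
      let x' : T.ScaleSpace := ⟨x, Ioo_subset_Icc_self (hsub hx)⟩
      exact ⟨x', subset_closure ⟨x', hx, rfl⟩, position_coe x'⟩
    obtain ⟨w, hw, hwz⟩ := hIcc hzp
    have hwp : T.scaleBar w = T.scaleBar p := by
      have : closure ((fun x : T.ScaleSpace => (x : T.ScaleCompletion)) ''
          {x | a < x.1 ∧ x.1 < b}) ⊆ T.scaleBar ⁻¹' {T.scaleBar p} := by
        refine closure_minimal ?_ (isClosed_singleton.preimage T.scaleBar_continuous)
        rintro _ ⟨x, hx, rfl⟩
        change T.scaleBar x = _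
        rw [T.scaleBar_coe]
        exact hconst _ hx
      exact this hw
    rw [← scaleCompletion_ext hwz (hwp.trans hz.symm)]
    refine closure_mono (image_mono fun x hx => ?_) hw
    exact ⟨hca.trans_lt hx.1, hx.2.trans_le hbd⟩
  refine ⟨c, d, hcd, key p rfl ?_, key q h.symm ?_⟩
  · rw [← ha]
    exact ⟨le_rfl, (arctanE_strictMono hpq).le⟩
  · rw [← hb]
    exact ⟨(arctanE_strictMono hpq).le, le_rfl⟩

theorem sStar_injective : Function.Injective T.sStar := by
  rintro ⟨p⟩ ⟨q⟩ h
  change T.scaleBar p = T.scaleBar q at h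
  rcases lt_trichotomy (T.position p) (T.position q) with hlt | he | hlt
  · exact Quot.sound (darn_of_lt hlt h)
  · rw [scaleCompletion_ext he h]
  · exact (Quot.sound (darn_of_lt hlt h.symm)).symm

/-- A continuous injection of a compact space into a Hausdorff space. It identifies the darned space
topologically with a set of extended reals. -/
theorem sStar_isClosedEmbedding : IsClosedEmbedding T.sStar := by
  have hc : Continuous T.sStar := continuous_quot_lift T.scaleBar_eq_of_darn T.scaleBar_continuous
  have : CompactSpace T.DarnedSpace := inferInstanceAs (CompactSpace (Quot T.darn))
  exact hc.isClosedEmbedding sStar_injective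

theorem range_sStar :
    range T.sStar = closure ((fun x : ℝ => (T.s x : EReal)) '' T.openPart) := by
  refine Subset.antisymm ?_ (closure_minimal ?_ sStar_isClosedEmbedding.isClosed_range)
  · have hI : ∀ x : EReal, T.scale x ∈ closure ((fun x : ℝ => (T.s x : EReal)) '' T.openPart) := by
      intro x
      rw [mem_closure_iff_nhds]
      intro V hV
      rcases T.eq_left_or_right_or_coe x with h | h | ⟨y, hy, rfl⟩
      · rw [scale_of_le_left h] at hV
        have h₁ := continuousAt_scale_left.mono_left (nhdsWithin_le_nhds (s := Ioi T.l)) hV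
        have h₂ := Ioo_mem_nhdsGT T.l_lt_r
        have : (𝓝[>] T.l).NeBot := nhdsGT_neBot_of_exists_gt ⟨T.r, T.l_lt_r⟩
        obtain ⟨z, hz, hz'⟩ := Filter.nonempty_of_mem (inter_mem (mem_map.1 h₁) h₂)
        obtain ⟨w, hw, rfl⟩ := exists_mem_openPart hz'.1 hz'.2
        exact ⟨_, hz, w, hw, (scale_coe hw).symm⟩
      · rw [scale_of_right_le h] at hV
        have h₁ := continuousAt_scale_right.mono_left (nhdsWithin_le_nhds (s := Iio T.r)) hV
        have h₂ := Ioo_mem_nhdsLT T.l_lt_r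
        have : (𝓝[<] T.r).NeBot := nhdsLT_neBot_of_exists_lt ⟨T.l, T.l_lt_r⟩
        obtain ⟨z, hz, hz'⟩ := Filter.nonempty_of_mem (inter_mem (mem_map.1 h₁) h₂)
        obtain ⟨w, hw, rfl⟩ := exists_mem_openPart hz'.1 hz'.2
        exact ⟨_, hz, w, hw, (scale_coe hw).symm⟩
      · exact ⟨_, mem_of_mem_nhds hV, y, hy, (scale_coe hy).symm⟩
    rintro _ ⟨⟨p⟩, rfl⟩
    change T.scaleBar p ∈ _
    refine UniformSpace.Completion.induction_on p
      (isClosed_closure.preimage T.scaleBar_continuous) fun x => ?_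
    rw [T.scaleBar_coe]
    exact hI _
  · rintro _ ⟨x, hx, rfl⟩
    let x' : T.ScaleSpace := ⟨x, hx.1.le, hx.2.le⟩
    refine ⟨Quot.mk _ (x' : T.ScaleCompletion), ?_⟩
    change T.scaleBar x' = _
    rw [T.scaleBar_coe]
    exact scale_coe hx

/-! ### The set `Î` -/

/-- The closure in `ℝ` of the set of values of the scale. -/
def traceSet (T : ScaleTriple) : Set ℝ := closure (T.s '' T.openPart)

theorem s_mem_traceSet {x : ℝ} (hx : x ∈ T.openPart) : T.s x ∈ T.traceSet :=
  subset_closure ⟨x, hx, rfl⟩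

theorem mem_traceSet_iff {y : ℝ} : y ∈ T.traceSet ↔ (y : EReal) ∈ range T.sStar := by
  rw [range_sStar, traceSet,
    EReal.isEmbedding_coe.isInducing.closure_eq_preimage_closure_image, ← image_comp]
  rfl

theorem mem_hatI_iff {y : ℝ} : y ∈ T.hatI ↔ y ∈ T.traceSet ∧
    ((y : EReal) = T.scale T.l → T.LeftReflecting) ∧
    ((y : EReal) = T.scale T.r → T.RightReflecting) := by
  rw [mem_traceSet_iff]
  constructor
  · rintro ⟨p, hp, he⟩
    exact ⟨⟨p, he⟩, fun h => hp.1 (he.trans h), fun h => hp.2 (he.trans h)⟩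
  · rintro ⟨⟨p, he⟩, h₁, h₂⟩
    exact ⟨p, ⟨fun h => h₁ (he.symm.trans h), fun h => h₂ (he.symm.trans h)⟩, he⟩

theorem hatI_subset : T.hatI ⊆ T.traceSet := fun _ h => (mem_hatI_iff.1 h).1

theorem sStar_mem_Icc (p : T.DarnedSpace) : T.sStar p ∈ Icc (T.scale T.l) (T.scale T.r) := by
  have h : T.sStar p ∈ range T.sStar := mem_range_self p
  rw [range_sStar] at h
  refine closure_minimal ?_ isClosed_Icc h
  rintro _ ⟨x, hx, rfl⟩
  exact ⟨scale_left_le hx, le_scale_right hx⟩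

theorem traceSet_subset {y : ℝ} (hy : y ∈ T.traceSet) :
    (y : EReal) ∈ Icc (T.scale T.l) (T.scale T.r) := by
  obtain ⟨p, hp⟩ := mem_traceSet_iff.1 hy
  rw [← hp]
  exact sStar_mem_Icc p

theorem coe_toReal_sStar (p : T.IStar) : ((T.sStar p).toReal : EReal) = T.sStar p := by
  obtain ⟨h₁, h₂⟩ := sStar_mem_Icc p.1
  refine EReal.coe_toReal (fun h => ?_) fun h => ?_
  · rw [h, top_le_iff] at h₂
    exact (p.2.2 (h.trans h₂.symm)).1.1 h₂
  · rw [h, le_bot_iff] at h₁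
    exact (p.2.1 (h.trans h₁.symm)).1.1 h₁

theorem isEmbedding_toReal_sStar : IsEmbedding fun p : T.IStar => (T.sStar p).toReal := by
  rw [← EReal.isEmbedding_coe.of_comp_iff]
  have : ((↑) : ℝ → EReal) ∘ (fun p : T.IStar => (T.sStar p).toReal) =
    T.sStar ∘ ((↑) : T.IStar → T.DarnedSpace) := funext fun p => coe_toReal_sStar p
  rw [this]
  exact sStar_isClosedEmbedding.isEmbedding.comp .subtypeVal

theorem range_toReal_sStar : (range fun p : T.IStar => (T.sStar p).toReal) = T.hatI := by
  ext y
  constructor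
  · rintro ⟨p, rfl⟩
    exact ⟨p, p.2, (coe_toReal_sStar p).symm⟩
  · rintro ⟨p, hp, he⟩
    refine ⟨⟨p, hp⟩, ?_⟩
    change (T.sStar p).toReal = y
    rw [he, EReal.toReal_coe]

end ScaleTriple

/-! ### Local finiteness of the image measure -/

namespace ScaleTriple

variable {T : ScaleTriple}

theorem m_Iio_left : T.m (Iio T.l) = 0 :=
  measure_mono_null (t := (Icc T.l T.r)ᶜ) (fun _ hx h => not_le.2 hx h.1) T.m_compl

theorem m_Ioi_right : T.m (Ioi T.r) = 0 :=
  measure_mono_null (t := (Icc T.l T.r)ᶜ) (fun _ hx h => not_le.2 hx h.2) T.m_compl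

theorem LeftReflecting.measure_Iic_lt_top (h : T.LeftReflecting) {b : EReal} (hb : b < T.r) :
    T.m (Iic b) < ∞ := by
  obtain ⟨⟨-, c, hc, hc'⟩, hl⟩ := h
  have hsub : Iic b ⊆ Iio T.l ∪ ({T.l} ∪ (Ioo T.l c ∪ Icc c b)) := by
    intro x hx
    rcases lt_trichotomy x T.l with h | h | h
    · exact Or.inl h
    · exact Or.inr (Or.inl h)
    · rcases lt_or_ge x c with h' | h'
      · exact Or.inr (Or.inr (Or.inl ⟨h, h'⟩))
      · exact Or.inr (Or.inr (Or.inr ⟨h', hx⟩))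
  refine (measure_mono hsub).trans_lt ?_
  refine measure_union_lt_top (by simp [m_Iio_left]) (measure_union_lt_top hl
    (measure_union_lt_top hc' (T.m_radon c b hc hb)))

theorem RightReflecting.measure_Ici_lt_top (h : T.RightReflecting) {b : EReal} (hb : T.l < b) :
    T.m (Ici b) < ∞ := by
  obtain ⟨⟨-, c, hc, hc'⟩, hl⟩ := h
  have hsub : Ici b ⊆ Ioi T.r ∪ ({T.r} ∪ (Ioo c T.r ∪ Icc b c)) := by
    intro x hx
    rcases lt_trichotomy x T.r with h | h | h
    · rcases lt_or_ge c x with h' | h'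
      · exact Or.inr (Or.inr (Or.inl ⟨h', h⟩))
      · exact Or.inr (Or.inr (Or.inr ⟨hx, h'⟩))
    · exact Or.inr (Or.inl h)
    · exact Or.inl h
  refine (measure_mono hsub).trans_lt ?_
  refine measure_union_lt_top (by simp [m_Ioi_right]) (measure_union_lt_top hl
    (measure_union_lt_top hc' (T.m_radon b c hb hc)))

/-- The image of `m` under the scale is finite near the points of `Î`. -/
theorem exists_nhds_measure_lt_top {y : ℝ} (hy : y ∈ T.hatI) :
    ∃ N ∈ 𝓝 (y : EReal), IsOpen N ∧ T.m (T.scale ⁻¹' N) < ∞ := by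
  obtain ⟨hyC, hyl, hyr⟩ := mem_hatI_iff.1 hy
  obtain ⟨h₁, h₂⟩ := traceSet_subset hyC
  -- A value strictly between `s(l)` and `s(r)` has a neighbourhood with preimage in a compact part
  -- of `(l, r)`. A value equal to `s(l)` or `s(r)` belongs to `Î` only if the endpoint is
  -- reflecting, and then `m` is finite near that endpoint.
  rcases h₁.lt_or_eq with h₁ | h₁
  · obtain ⟨a, ha, hay⟩ := exists_s_lt h₁
    rw [← scale_coe ha] at hay
    rcases h₂.lt_or_eq with h₂ | h₂
    · obtain ⟨b, hb, hby⟩ := exists_lt_s h₂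
      rw [← scale_coe hb] at hby
      refine ⟨_, Ioo_mem_nhds hay hby, isOpen_Ioo, (measure_mono fun x hx => ?_).trans_lt
        (T.m_radon a b ha.1 hb.2)⟩
      exact ⟨(scale_mono.reflect_lt hx.1).le, (scale_mono.reflect_lt hx.2).le⟩
    · exact ⟨_, Ioi_mem_nhds hay, isOpen_Ioi, (measure_mono fun x hx =>
        (scale_mono.reflect_lt hx).le).trans_lt ((hyr h₂).measure_Ici_lt_top ha.1)⟩
  · have h₂ : (y : EReal) < T.scale T.r := h₁ ▸ scale_left_lt_scale_right
    obtain ⟨b, hb, hby⟩ := exists_lt_s h₂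
    rw [← scale_coe hb] at hby
    exact ⟨_, Iio_mem_nhds hby, isOpen_Iio, (measure_mono fun x hx =>
      (scale_mono.reflect_lt hx).le).trans_lt ((hyl h₁.symm).measure_Iic_lt_top hb.2)⟩

/-! ### Full support -/

theorem measure_pos_of_mem_nhds (hDM : T.DM) {N : Set EReal} {x : EReal} (hx : x ∈ T.I)
    (hxU : x ∉ T.U) (hN : T.scale ⁻¹' N ∈ 𝓝 x) : 0 < T.m (T.scale ⁻¹' N) :=
  (Measure.mem_support_iff_forall x).1 (hDM.1 ⟨hx, hxU⟩) _ hN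

theorem IsFlat.scale_left_eq {c d e : EReal} (h : T.IsFlat c d) (he : e ∈ Ioo c d)
    (hc : c ∉ T.Dplus) : T.scale c = T.scale e := by
  have hcI : c ∈ T.I := ⟨h.left_le, h.1.le.trans h.le_right⟩
  have h₁ : T.scale c = Function.rightLim T.scale c := by_contra fun hne => hc ⟨hcI, hne⟩
  have : (𝓝[>] c).NeBot := nhdsGT_neBot_of_exists_gt ⟨d, h.1⟩
  rw [h₁]
  refine tendsto_nhds_unique (scale_mono.tendsto_rightLim c) (tendsto_const_nhds.congr' ?_)
  filter_upwards [Ioo_mem_nhdsGT h.1] with z hz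
  exact T.scale_eq_of_isFlat h he hz

theorem IsFlat.scale_right_eq {c d e : EReal} (h : T.IsFlat c d) (he : e ∈ Ioo c d)
    (hd : d ∉ T.Dminus) : T.scale d = T.scale e := by
  have hdI : d ∈ T.I := ⟨h.left_le.trans h.1.le, h.le_right⟩
  have h₁ : T.scale d = Function.leftLim T.scale d := by_contra fun hne => hd ⟨hdI, hne⟩
  have : (𝓝[<] d).NeBot := nhdsLT_neBot_of_exists_lt ⟨c, h.1⟩
  rw [h₁]
  refine tendsto_nhds_unique (scale_mono.tendsto_leftLim d) (tendsto_const_nhds.congr' ?_)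
  filter_upwards [Ioo_mem_nhdsLT h.1] with z hz
  exact T.scale_eq_of_isFlat h he hz

/-- If both ends are discontinuities or endpoints of `I`, the interval is isolated and DM charges
its hull, on which the scale has the same value. Otherwise one end is a continuity point outside
`U`, again with this value, and it lies in the support of `m`. -/
theorem measure_pos_of_isFlat (hDM : T.DM) {N : Set EReal} (hN : IsOpen N) {c d e : EReal}
    (h : T.IsFlat c d) (he : e ∈ Ioo c d) (heN : T.scale e ∈ N) : 0 < T.m (T.scale ⁻¹' N) := by
  by_cases hc : c ∈ T.Dplus ∪ T.Dminus ∪ {T.l, T.r}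
  · by_cases hd : d ∈ T.Dplus ∪ T.Dminus ∪ {T.l, T.r}
    · refine (hDM.2.2 c d ⟨h, hc, hd⟩).trans_le (measure_mono ?_)
      rintro x (hx | ⟨rfl, hx⟩ | ⟨rfl, hx⟩)
      · rwa [mem_preimage, T.scale_eq_of_isFlat h hx he]
      · rwa [mem_preimage, h.scale_left_eq he hx]
      · rwa [mem_preimage, h.scale_right_eq he hx]
    · simp only [mem_union, not_or] at hd
      have hdI : d ∈ T.I := ⟨h.left_le.trans h.1.le, h.le_right⟩
      refine measure_pos_of_mem_nhds hDM hdI (fun hU => h.2.2.2 ⟨hU, hd.2⟩)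
        ((continuousAt_scale hdI hd.1.1 hd.1.2).preimage_mem_nhds (hN.mem_nhds ?_))
      rwa [h.scale_right_eq he hd.1.2]
  · simp only [mem_union, not_or] at hc
    have hcI : c ∈ T.I := ⟨h.left_le, h.1.le.trans h.le_right⟩
    refine measure_pos_of_mem_nhds hDM hcI (fun hU => h.2.2.1 ⟨hU, hc.2⟩)
      ((continuousAt_scale hcI hc.1.1 hc.1.2).preimage_mem_nhds (hN.mem_nhds ?_))
    rwa [h.scale_left_eq he hc.1.1]

/-- The point may be an endpoint of `I`; a nearby interior point has the same scale value and lies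
in a flat interval. -/
theorem measure_pos_of_mem_U (hDM : T.DM) {N : Set EReal} (hN : IsOpen N) {x : EReal}
    (hx : x ∈ T.U) (hxN : T.scale x ∈ N) : 0 < T.m (T.scale ⁻¹' N) := by
  obtain ⟨hxI, V, hV, hc⟩ := id hx
  have hcl : x ∈ closure (Ioo T.l T.r) := by rwa [closure_Ioo T.l_lt_r.ne]
  obtain ⟨z, hzV, hz⟩ := mem_closure_iff_nhds.1 hcl _ (interior_mem_nhds.2 hV)
  have hzI : z ∈ T.I := Ioo_subset_Icc_self hz
  have hzU : z ∈ T.U \ {T.l, T.r} := by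
    refine ⟨⟨hzI, V, mem_interior_iff_mem_nhds.1 hzV, hc⟩, ?_⟩
    simp only [mem_insert_iff, mem_singleton_iff, not_or]
    exact ⟨hz.1.ne', hz.2.ne⟩
  obtain ⟨c, d, hcd, hzcd⟩ := exists_isFlat hzU
  refine measure_pos_of_isFlat hDM hN hcd hzcd ?_
  rwa [hc z ⟨interior_subset hzV, hzI⟩ x ⟨mem_of_mem_nhds hV, hxI⟩]

/-- At a continuity point the preimage of `N` is a neighbourhood of `x`. Under continuity from one
side it is a neighbourhood of points next to `x` on that side. If the scale jumps on both sides, DM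
gives `x` positive mass. -/
theorem measure_pos (hDM : T.DM) {N : Set EReal} (hN : IsOpen N) {x : EReal} (hx : x ∈ T.I)
    (hxN : T.scale x ∈ N) : 0 < T.m (T.scale ⁻¹' N) := by
  have hint : ∀ z ∈ T.I, T.scale ⁻¹' N ∈ 𝓝 z → 0 < T.m (T.scale ⁻¹' N) := by
    intro z hz hzN
    by_cases hU : z ∈ T.U
    · exact measure_pos_of_mem_U hDM hN hU (mem_of_mem_nhds hzN : z ∈ T.scale ⁻¹' N)
    · exact measure_pos_of_mem_nhds hDM hz hU hzN
  by_cases hp : x ∈ T.Dplus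
  · by_cases hm : x ∈ T.Dminus
    · refine (hDM.2.1 x ⟨hp, hm⟩).trans_le (measure_mono ?_)
      rwa [singleton_subset_iff]
    · obtain ⟨h₁, h₂⟩ := ne_of_mem_Dplus hp
      have hl : Function.leftLim T.scale x = T.scale x :=
        (by_contra fun h => hm ⟨hx, fun e => h e.symm⟩)
      have : T.scale ⁻¹' N ∈ 𝓝[<] x :=
        (scale_mono.continuousWithinAt_Iio_iff_leftLim_eq.2 hl) (hN.mem_nhds hxN)
      obtain ⟨a, ha, hsub⟩ := (mem_nhdsLT_iff_exists_Ioo_subset' h₁).1 this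
      obtain ⟨z, hz, hzx⟩ := exists_between (max_lt h₁ ha)
      rw [max_lt_iff] at hz
      exact hint z ⟨hz.1.le, hzx.le.trans hx.2⟩
        (mem_of_superset (Ioo_mem_nhds hz.2 hzx) hsub)
  · by_cases hm : x ∈ T.Dminus
    · obtain ⟨h₁, h₂⟩ := ne_of_mem_Dminus hm
      have hl : Function.rightLim T.scale x = T.scale x :=
        (by_contra fun h => hp ⟨hx, fun e => h e.symm⟩)
      have : T.scale ⁻¹' N ∈ 𝓝[>] x :=
        (scale_mono.continuousWithinAt_Ioi_iff_rightLim_eq.2 hl) (hN.mem_nhds hxN)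
      obtain ⟨a, ha, hsub⟩ := (mem_nhdsGT_iff_exists_Ioo_subset' h₂).1 this
      obtain ⟨z, hzx, hz⟩ := exists_between (lt_min h₂ ha)
      rw [lt_min_iff] at hz
      exact hint z ⟨hx.1.trans hzx.le, hz.1.le⟩
        (mem_of_superset (Ioo_mem_nhds hzx hz.2) hsub)
    · exact hint x hx ((continuousAt_scale hx hp hm).preimage_mem_nhds (hN.mem_nhds hxN))

/-! ### Missing endpoints -/

/-- The finite endpoints of `Î` that do not belong to it. -/
def missing (T : ScaleTriple) : Set ℝ :=
  {y | ((y : EReal) = T.scale T.l ∧ ¬T.LeftReflecting) ∨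
    ((y : EReal) = T.scale T.r ∧ ¬T.RightReflecting)}

theorem finite_missing : T.missing.Finite := by
  refine (toFinite {(T.scale T.l).toReal, (T.scale T.r).toReal}).subset ?_
  rintro y (⟨h, -⟩ | ⟨h, -⟩)
  · rw [← h]
    simp
  · rw [← h]
    simp

theorem hatI_eq : T.hatI = T.traceSet \ T.missing := by
  ext y
  rw [mem_hatI_iff, Set.mem_sdiff, missing, mem_ofPred_eq]
  tauto

theorem left_mem_traceSet {j : ℝ} (hj : (j : EReal) = T.scale T.l) : j ∈ T.traceSet := by
  refine mem_closure_iff_nhds.2 fun V hV => ?_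
  obtain ⟨b, hb, hbV⟩ := exists_Ico_subset_of_mem_nhds hV ⟨j + 1, by simp⟩
  obtain ⟨x, hx, hxb⟩ := exists_s_lt (T := T) (b := (b : EReal)) (by rw [← hj]; exact_mod_cast hb)
  have h₁ := scale_left_le hx
  rw [← hj, EReal.coe_le_coe_iff] at h₁
  exact ⟨T.s x, hbV ⟨h₁, EReal.coe_lt_coe_iff.1 hxb⟩, x, hx, rfl⟩

theorem right_mem_traceSet {j : ℝ} (hj : (j : EReal) = T.scale T.r) : j ∈ T.traceSet := by
  refine mem_closure_iff_nhds.2 fun V hV => ?_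
  obtain ⟨b, hb, hbV⟩ := exists_Ioc_subset_of_mem_nhds hV ⟨j - 1, by simp⟩
  obtain ⟨x, hx, hxb⟩ := exists_lt_s (T := T) (b := (b : EReal)) (by rw [← hj]; exact_mod_cast hb)
  have h₁ := le_scale_right hx
  rw [← hj, EReal.coe_le_coe_iff] at h₁
  exact ⟨T.s x, hbV ⟨EReal.coe_lt_coe_iff.1 hxb, h₁⟩, x, hx, rfl⟩

/-- If the scale takes no values slightly above `s(l)`, then `l` is the endpoint of an isolated
interval. -/
theorem leftReflecting_of_gap (hDK : T.DK) {b : EReal} (hb : T.scale T.l < b)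
    (h : ∀ x ∈ T.openPart, (T.s x : EReal) < b → (T.s x : EReal) = T.scale T.l) :
    T.LeftReflecting := by
  have h' : ∀ x : EReal, T.scale x < b → x < T.r → T.scale x = T.scale T.l := by
    intro x hx hxr
    rcases le_or_gt x T.l with hxl | hxl
    · exact scale_of_le_left hxl
    · obtain ⟨y, hy, rfl⟩ := exists_mem_openPart hxl hxr
      rw [scale_coe hy] at hx ⊢
      exact h y hy hx
  -- `d` is the right end of the level of `s(l)`; the claim is that `(l, d)` is an isolated
  -- interval, so that DK applies.
  set d := sSup {x : EReal | x ≤ T.r ∧ T.scale x = T.scale T.l} with hd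
  have hdr : d ≤ T.r := sSup_le fun x hx => hx.1
  have hlt : ∀ x < d, T.scale x = T.scale T.l := by
    intro x hx
    obtain ⟨y, hy, hxy⟩ := lt_sSup_iff.1 hx
    exact le_antisymm ((scale_mono hxy.le).trans_eq hy.2) (scale_left_le_scale x)
  have hld : T.l < d := by
    obtain ⟨x, hx, hxb⟩ := exists_s_lt hb
    refine hx.1.trans_le (le_sSup ⟨hx.2.le, ?_⟩)
    rw [scale_coe hx]
    exact h x hx hxb
  have hsub : Ioo T.l d ⊆ Ioo T.l T.r := Ioo_subset_Ioo_right hdr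
  have hflat : T.IsFlat T.l d := by
    refine ⟨hld, Ioo_subset_U hsub fun x hx y hy => (hlt x hx.2).trans (hlt y hy.2).symm,
      fun hc => hc.2 (mem_insert _ _), ?_⟩
    rintro ⟨⟨hdI, V, hV, hc⟩, hne⟩
    simp only [mem_insert_iff, mem_singleton_iff, not_or] at hne
    have hdr' : d < T.r := lt_of_le_of_ne hdr hne.2
    obtain ⟨u, hu, hVu⟩ := exists_Ico_subset_of_mem_nhds hV ⟨T.r, hdr'⟩
    obtain ⟨w, hw, hwd⟩ := exists_Ioc_subset_of_mem_nhds hV ⟨T.l, hld⟩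
    obtain ⟨z, hdz, hz⟩ := exists_between (lt_min hu hdr')
    obtain ⟨z', hz', hdz'⟩ := exists_between (max_lt hw hld)
    rw [lt_min_iff] at hz
    rw [max_lt_iff] at hz'
    refine not_le.2 hdz (le_sSup ⟨hz.2.le, ?_⟩)
    rw [hc z ⟨hVu ⟨hdz.le, hz.1⟩, hld.le.trans hdz.le, hz.2.le⟩ z'
      ⟨hwd ⟨hz'.1, hdz'.le⟩, hz'.2.le, hdz'.le.trans hdr⟩]
    exact hlt z' hdz'
  refine (hDK T.l d ⟨hflat, Or.inr (mem_insert _ _), ?_⟩).1 rfl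
  -- If the scale were continuous at `d < r`, its value there would be `s(l)` and the values
  -- slightly beyond would be below `b`, hence again `s(l)`, against the choice of `d`.
  by_contra hdD
  simp only [mem_union, mem_insert_iff, mem_singleton_iff, not_or] at hdD
  obtain ⟨⟨hp, hm⟩, -, hdr''⟩ := hdD
  have hdr' : d < T.r := lt_of_le_of_ne hdr hdr''
  have hcont := continuousAt_scale ⟨hld.le, hdr⟩ hp hm
  obtain ⟨e, hle, hed⟩ := exists_between hld
  have hdl : T.scale d = T.scale T.l := by
    rw [hflat.scale_right_eq ⟨hle, hed⟩ hm, hlt e hed]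
  have hnb : T.scale ⁻¹' Iio b ∈ 𝓝 d :=
    hcont.preimage_mem_nhds (Iio_mem_nhds (by rwa [hdl]))
  obtain ⟨u, hu, hbu⟩ := exists_Ico_subset_of_mem_nhds hnb ⟨T.r, hdr'⟩
  obtain ⟨z, hdz, hz⟩ := exists_between (lt_min hu hdr')
  rw [lt_min_iff] at hz
  exact not_le.2 hdz (le_sSup ⟨hz.2.le, h' z (hbu ⟨hdz.le, hz.1⟩) hz.2⟩)

theorem rightReflecting_of_gap (hDK : T.DK) {b : EReal} (hb : b < T.scale T.r)
    (h : ∀ x ∈ T.openPart, b < (T.s x : EReal) → (T.s x : EReal) = T.scale T.r) :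
    T.RightReflecting := by
  have h' : ∀ x : EReal, b < T.scale x → T.l < x → T.scale x = T.scale T.r := by
    intro x hx hxr
    rcases le_or_gt T.r x with hxl | hxl
    · exact scale_of_right_le hxl
    · obtain ⟨y, hy, rfl⟩ := exists_mem_openPart hxr hxl
      rw [scale_coe hy] at hx ⊢
      exact h y hy hx
  set d := sInf {x : EReal | T.l ≤ x ∧ T.scale x = T.scale T.r} with hd
  have hdr : T.l ≤ d := le_sInf fun x hx => hx.1
  have hlt : ∀ x, d < x → T.scale x = T.scale T.r := by
    intro x hx
    obtain ⟨y, hy, hxy⟩ := sInf_lt_iff.1 hx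
    exact le_antisymm (scale_le_scale_right x) (hy.2.symm.trans_le (scale_mono hxy.le))
  have hld : d < T.r := by
    obtain ⟨x, hx, hxb⟩ := exists_lt_s hb
    have hxr : T.scale x = T.scale T.r := by
      rw [scale_coe hx]
      exact h x hx hxb
    exact (sInf_le (show (x : EReal) ∈ {x : EReal | T.l ≤ x ∧ T.scale x = T.scale T.r} from
      ⟨hx.1.le, hxr⟩)).trans_lt hx.2
  have hsub : Ioo d T.r ⊆ Ioo T.l T.r := Ioo_subset_Ioo_left hdr
  have hflat : T.IsFlat d T.r := by
    refine ⟨hld, Ioo_subset_U hsub fun x hx y hy => (hlt x hx.1).trans (hlt y hy.1).symm,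
      ?_, fun hc => hc.2 (mem_insert_of_mem _ rfl)⟩
    rintro ⟨⟨hdI, V, hV, hc⟩, hne⟩
    simp only [mem_insert_iff, mem_singleton_iff, not_or] at hne
    have hdr' : T.l < d := lt_of_le_of_ne hdr (Ne.symm hne.1)
    obtain ⟨u, hu, hVu⟩ := exists_Ico_subset_of_mem_nhds hV ⟨T.r, hld⟩
    obtain ⟨w, hw, hwd⟩ := exists_Ioc_subset_of_mem_nhds hV ⟨T.l, hdr'⟩
    obtain ⟨z, hdz, hz⟩ := exists_between (lt_min hu hld)
    obtain ⟨z', hz', hdz'⟩ := exists_between (max_lt hw hdr')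
    rw [lt_min_iff] at hz
    rw [max_lt_iff] at hz'
    refine not_le.2 hdz' (sInf_le ⟨hz'.2.le, ?_⟩)
    rw [hc z' ⟨hwd ⟨hz'.1, hdz'.le⟩, hz'.2.le, hdz'.le.trans hld.le⟩ z
      ⟨hVu ⟨hdz.le, hz.1⟩, hdr.trans hdz.le, hz.2.le⟩]
    exact hlt z hdz
  refine (hDK d T.r ⟨hflat, ?_, Or.inr (mem_insert_of_mem _ rfl)⟩).2 rfl
  by_contra hdD
  simp only [mem_union, mem_insert_iff, mem_singleton_iff, not_or] at hdD
  obtain ⟨⟨hp, hm⟩, hdr'', -⟩ := hdD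
  have hdr' : T.l < d := lt_of_le_of_ne hdr (Ne.symm hdr'')
  have hcont := continuousAt_scale ⟨hdr, hld.le⟩ hp hm
  obtain ⟨e, hle, hed⟩ := exists_between hld
  have hdl : T.scale d = T.scale T.r := by
    rw [hflat.scale_left_eq ⟨hle, hed⟩ hp, hlt e hle]
  have hnb : T.scale ⁻¹' Ioi b ∈ 𝓝 d :=
    hcont.preimage_mem_nhds (Ioi_mem_nhds (by rwa [hdl]))
  obtain ⟨u, hu, hbu⟩ := exists_Ioc_subset_of_mem_nhds hnb ⟨T.l, hdr'⟩
  obtain ⟨z, hz, hdz⟩ := exists_between (max_lt hu hdr')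
  rw [max_lt_iff] at hz
  exact not_le.2 hdz (sInf_le ⟨hz.2.le, h' z (hbu ⟨hz.1, hdz.le⟩) hz.2⟩)

theorem s_mem_hatI {x : ℝ} (hx : x ∈ T.openPart) (hl : T.scale T.l < T.s x)
    (hr : (T.s x : EReal) < T.scale T.r) : T.s x ∈ T.hatI :=
  mem_hatI_iff.2 ⟨s_mem_traceSet hx, fun h => (hl.ne' h).elim, fun h => (hr.ne h).elim⟩

/-- Here DK is needed: a missing endpoint that is not a limit of `Î` would have a gap next to it,
and then would be reflecting. -/
theorem traceSet_subset_closure (hDK : T.DK) : T.traceSet ⊆ closure T.hatI := by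
  intro y hy
  by_cases hm : y ∈ T.missing
  · refine mem_closure_iff_nhds.2 fun V hV => ?_
    rcases hm with ⟨he, hn⟩ | ⟨he, hn⟩
    · obtain ⟨b, hb, hbV⟩ := exists_Ico_subset_of_mem_nhds hV ⟨y + 1, by simp⟩
      by_contra hemp
      -- The minimum with `s(r)` keeps the values found strictly between the endpoint values, hence
      -- in `Î`.
      refine hn (leftReflecting_of_gap hDK (b := min (b : EReal) (T.scale T.r))
        (lt_min (by rw [← he]; exact_mod_cast hb) scale_left_lt_scale_right) fun x hx hxb => ?_)
      rw [lt_min_iff] at hxb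
      by_contra hne
      have hl := lt_of_le_of_ne (scale_left_le hx) (Ne.symm hne)
      refine hemp ⟨T.s x, hbV ⟨?_, EReal.coe_lt_coe_iff.1 hxb.1⟩, s_mem_hatI hx hl hxb.2⟩
      rw [← he, EReal.coe_lt_coe_iff] at hl
      exact hl.le
    · obtain ⟨b, hb, hbV⟩ := exists_Ioc_subset_of_mem_nhds hV ⟨y - 1, by simp⟩
      by_contra hemp
      refine hn (rightReflecting_of_gap hDK (b := max (b : EReal) (T.scale T.l))
        (max_lt (by rw [← he]; exact_mod_cast hb) scale_left_lt_scale_right) fun x hx hxb => ?_)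
      rw [max_lt_iff] at hxb
      by_contra hne
      have hl := lt_of_le_of_ne (le_scale_right hx) hne
      refine hemp ⟨T.s x, hbV ⟨EReal.coe_lt_coe_iff.1 hxb.1, ?_⟩, s_mem_hatI hx hxb.2 hl⟩
      rw [← he, EReal.coe_lt_coe_iff] at hl
      exact hl.le
  · exact subset_closure (hatI_eq ▸ ⟨hy, hm⟩)

/-! ### The two trace embeddings -/

theorem measurableSet_hatI : MeasurableSet T.hatI := by
  rw [hatI_eq]
  exact isClosed_closure.measurableSet.diff finite_missing.measurableSet

section Embedding

variable {X : Type*} [TopologicalSpace X] [MeasurableSpace X] [BorelSpace X] {ι : X → ℝ}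

theorem measurableEmbedding_coe (hι : IsEmbedding ι) (hr : range ι = T.hatI) :
    MeasurableEmbedding fun x => (ι x : EReal) := by
  have h₁ : MeasurableEmbedding ι :=
    hι.measurableEmbedding (by rw [hr]; exact measurableSet_hatI)
  exact EReal.measurableEmbedding_coe.comp h₁

theorem comap_apply (hι : IsEmbedding ι) (hr : range ι = T.hatI) {B : Set ℝ}
    (hB : MeasurableSet B) :
    ((T.m.map T.scale).comap fun x => (ι x : EReal)) (ι ⁻¹' B) =
      T.m (T.scale ⁻¹' (Real.toEReal '' (B ∩ T.hatI))) := by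
  have he := measurableEmbedding_coe hι hr
  have himg : (fun x => (ι x : EReal)) '' (ι ⁻¹' B) = Real.toEReal '' (B ∩ T.hatI) := by
    rw [← hr, ← image_preimage_eq_inter_range, ← image_comp]
    rfl
  rw [he.comap_apply, himg, Measure.map_apply scale_mono.measurable]
  exact EReal.measurableEmbedding_coe.measurableSet_image.2 (hB.inter measurableSet_hatI)

/-- Stated for an arbitrary space embedded onto `Î`, so that it serves both `I*` and `Î` itself. -/
theorem isTraceEmbedding (hDK : T.DK) (hDM : T.DM) (hι : IsEmbedding ι) (hr : range ι = T.hatI) :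
    IsTraceEmbedding T.traceSet ι ((T.m.map T.scale).comap fun x => (ι x : EReal)) where
  nonempty := by
    have h : (closure T.hatI).Nonempty :=
      ⟨_, traceSet_subset_closure hDK (s_mem_traceSet T.zero_mem_openPart)⟩
    rw [closure_nonempty_iff, ← hr] at h
    exact range_nonempty_iff_nonempty.1 h
  isClosed := isClosed_closure
  isEmbedding := hι
  mem x := hatI_subset (hr ▸ mem_range_self x)
  finite := by
    rw [hr, hatI_eq]
    refine (finite_missing (T := T)).subset fun y hy => ?_
    by_contra h
    exact hy.2 ⟨hy.1, h⟩
  subset_closure := by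
    rw [hr]
    exact traceSet_subset_closure hDK
  extremal := by
    rintro b ⟨hb, hb'⟩
    rw [hr, hatI_eq] at hb'
    have hm : b ∈ T.missing := by_contra fun h => hb' ⟨hb, h⟩
    rcases hm with ⟨he, -⟩ | ⟨he, -⟩
    · refine Or.inl fun c hc => ?_
      have := (traceSet_subset hc).1
      rwa [← he, EReal.coe_le_coe_iff] at this
    · refine Or.inr fun c hc => ?_
      have := (traceSet_subset hc).2
      rwa [← he, EReal.coe_le_coe_iff] at this
  finite_compact := by
    have : IsLocallyFiniteMeasure ((T.m.map T.scale).comap fun x => (ι x : EReal)) := by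
      refine ⟨fun x => ?_⟩
      obtain ⟨N, hN, hNo, hlt⟩ := exists_nhds_measure_lt_top (T := T) (y := ι x)
        (hr ▸ mem_range_self x)
      refine ⟨ι ⁻¹' (Real.toEReal ⁻¹' N), ?_, ?_⟩
      · exact (continuous_coe_real_ereal.comp hι.continuous).continuousAt.preimage_mem_nhds hN
      · rw [comap_apply hι hr (hNo.preimage continuous_coe_real_ereal).measurableSet]
        refine (measure_mono (preimage_mono ?_)).trans_lt hlt
        rintro _ ⟨y, hy, rfl⟩
        exact hy.1
    infer_instance
  open_pos := by
    refine ⟨fun W hW ⟨x, hx⟩ => ?_⟩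
    obtain ⟨W', hW', rfl⟩ := hι.isInducing.isOpen_iff.1 hW
    rw [comap_apply hι hr hW'.measurableSet]
    have hxh : ι x ∈ T.hatI := hr ▸ mem_range_self x
    -- The mass over a missing endpoint does not count on `Î`, so these points are removed from the
    -- open set before positivity is applied.
    set O : Set ℝ := W' \ T.missing with hO
    have hOo : IsOpen O := hW'.sdiff finite_missing.isClosed
    have hN : IsOpen (Real.toEReal '' O) := EReal.isOpenEmbedding_coe.isOpenMap _ hOo
    have hxO : ι x ∈ O := ⟨hx, (hatI_eq ▸ hxh).2⟩
    obtain ⟨_, hsO, z, hz, rfl⟩ := mem_closure_iff.1 (hatI_subset hxh) O hOo hxO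
    have hpos := measure_pos hDM hN (x := (z : EReal)) ⟨hz.1.le, hz.2.le⟩
      (by rw [scale_coe hz]; exact ⟨_, hsO, rfl⟩)
    refine ne_of_gt (hpos.trans_le ?_)
    have hnull : T.m (T.scale ⁻¹' (Real.toEReal '' O) \ Icc T.l T.r) = 0 :=
      measure_mono_null (t := (Icc T.l T.r)ᶜ) (fun w hw => hw.2) T.m_compl
    rw [← measure_inter_add_sdiff _ (measurableSet_Icc (a := T.l) (b := T.r)), hnull, add_zero]
    refine measure_mono ?_
    rintro w ⟨⟨y, hy, he⟩, hwI⟩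
    refine ⟨y, ⟨hy.1, ?_⟩, he⟩
    rw [hatI_eq]
    refine ⟨?_, hy.2⟩
    rcases T.eq_left_or_right_or_coe w with h | h | ⟨v, hv, rfl⟩
    · rw [scale_of_le_left h] at he
      exact left_mem_traceSet he
    · rw [scale_of_right_le h] at he
      exact right_mem_traceSet he
    · rw [scale_coe hv, EReal.coe_eq_coe_iff] at he
      rw [he]
      exact s_mem_traceSet hv

end Embedding

theorem isTraceEmbedding_val (hDK : T.DK) (hDM : T.DM) :
    IsTraceEmbedding T.traceSet (Subtype.val : T.hatI → ℝ) T.hatM :=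
  isTraceEmbedding hDK hDM .subtypeVal Subtype.range_val

theorem isTraceEmbedding_sStar (hDK : T.DK) (hDM : T.DM) :
    IsTraceEmbedding T.traceSet (fun p : T.IStar => (T.sStar p).toReal) T.mStar := by
  have h := isTraceEmbedding hDK hDM isEmbedding_toReal_sStar range_toReal_sStar
  simp only [coe_toReal_sStar] at h
  exact h

end ScaleTriple

namespace ScaleTriple

variable {T : ScaleTriple} {x y z : ℝ}

/-! ### One-sided limits of the scale -/

theorem tendsto_coe_nhdsGT (x : ℝ) :
    Tendsto Real.toEReal (𝓝[>] x) (𝓝[>] (x : EReal)) := by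
  refine tendsto_nhdsWithin_of_tendsto_nhds_of_eventually_within _
    (continuous_coe_real_ereal.continuousAt.mono_left nhdsWithin_le_nhds) ?_
  filter_upwards [self_mem_nhdsWithin] with z hz
  exact EReal.coe_lt_coe_iff.2 hz

theorem tendsto_coe_nhdsLT (x : ℝ) :
    Tendsto Real.toEReal (𝓝[<] x) (𝓝[<] (x : EReal)) := by
  refine tendsto_nhdsWithin_of_tendsto_nhds_of_eventually_within _
    (continuous_coe_real_ereal.continuousAt.mono_left nhdsWithin_le_nhds) ?_
  filter_upwards [self_mem_nhdsWithin] with z hz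
  exact EReal.coe_lt_coe_iff.2 hz

theorem exists_gt_mem (hx : x ∈ T.openPart) : ∃ z ∈ T.openPart, x < z := by
  obtain ⟨z, hz, hz'⟩ := exists_between hx.2
  obtain ⟨w, hw, rfl⟩ := exists_mem_openPart (hx.1.trans hz) hz'
  exact ⟨w, hw, EReal.coe_lt_coe_iff.1 hz⟩

theorem exists_lt_mem (hx : x ∈ T.openPart) : ∃ z ∈ T.openPart, z < x := by
  obtain ⟨z, hz, hz'⟩ := exists_between hx.1
  obtain ⟨w, hw, rfl⟩ := exists_mem_openPart hz (hz'.trans hx.2)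
  exact ⟨w, hw, EReal.coe_lt_coe_iff.1 hz'⟩

theorem tendsto_s_coe_right (hx : x ∈ T.openPart) :
    Tendsto (fun z => (T.s z : EReal)) (𝓝[>] x) (𝓝 (Function.rightLim T.scale x)) := by
  refine ((scale_mono.tendsto_rightLim (x : EReal)).comp (tendsto_coe_nhdsGT x)).congr' ?_
  filter_upwards [mem_nhdsWithin_of_mem_nhds (T.isOpen_openPart.mem_nhds hx)] with z hz
  exact scale_coe hz

theorem tendsto_s_coe_left (hx : x ∈ T.openPart) :
    Tendsto (fun z => (T.s z : EReal)) (𝓝[<] x) (𝓝 (Function.leftLim T.scale x)) := by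
  refine ((scale_mono.tendsto_leftLim (x : EReal)).comp (tendsto_coe_nhdsLT x)).congr' ?_
  filter_upwards [mem_nhdsWithin_of_mem_nhds (T.isOpen_openPart.mem_nhds hx)] with z hz
  exact scale_coe hz

theorem coe_toReal_rightLim_scale (hx : x ∈ T.openPart) :
    ((Function.rightLim T.scale x).toReal : EReal) = Function.rightLim T.scale x := by
  obtain ⟨z, hz, hxz⟩ := exists_gt_mem hx
  refine EReal.coe_toReal (fun h => ?_) fun h => ?_
  · have := (scale_mono (T := T)).rightLim_le (EReal.coe_lt_coe_iff.2 hxz)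
    rw [h, scale_coe hz, top_le_iff] at this
    exact EReal.coe_ne_top _ this
  · have := (scale_mono (T := T)).le_rightLim (le_refl (x : EReal))
    rw [h, scale_coe hx, le_bot_iff] at this
    exact EReal.coe_ne_bot _ this

theorem coe_toReal_leftLim_scale (hx : x ∈ T.openPart) :
    ((Function.leftLim T.scale x).toReal : EReal) = Function.leftLim T.scale x := by
  obtain ⟨z, hz, hxz⟩ := exists_lt_mem hx
  refine EReal.coe_toReal (fun h => ?_) fun h => ?_
  · have := (scale_mono (T := T)).leftLim_le (le_refl (x : EReal))
    rw [h, scale_coe hx, top_le_iff] at this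
    exact EReal.coe_ne_top _ this
  · have := (scale_mono (T := T)).le_leftLim (EReal.coe_lt_coe_iff.2 hxz)
    rw [h, scale_coe hz, le_bot_iff] at this
    exact EReal.coe_ne_bot _ this

theorem tendsto_s_right (hx : x ∈ T.openPart) :
    Tendsto T.s (𝓝[>] x) (𝓝 (Function.rightLim T.scale x).toReal) := by
  have := tendsto_s_coe_right hx
  rwa [← coe_toReal_rightLim_scale hx, EReal.tendsto_coe] at this

theorem tendsto_s_left (hx : x ∈ T.openPart) :
    Tendsto T.s (𝓝[<] x) (𝓝 (Function.leftLim T.scale x).toReal) := by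
  have := tendsto_s_coe_left hx
  rwa [← coe_toReal_leftLim_scale hx, EReal.tendsto_coe] at this

theorem rightLim_s (hx : x ∈ T.openPart) :
    Function.rightLim T.s x = (Function.rightLim T.scale x).toReal :=
  rightLim_eq_of_tendsto (tendsto_s_right hx)

theorem leftLim_s (hx : x ∈ T.openPart) :
    Function.leftLim T.s x = (Function.leftLim T.scale x).toReal :=
  leftLim_eq_of_tendsto (tendsto_s_left hx)

theorem tendsto_rightLim_s (hx : x ∈ T.openPart) :
    Tendsto T.s (𝓝[>] x) (𝓝 (Function.rightLim T.s x)) := by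
  rw [rightLim_s hx]
  exact tendsto_s_right hx

theorem tendsto_leftLim_s (hx : x ∈ T.openPart) :
    Tendsto T.s (𝓝[<] x) (𝓝 (Function.leftLim T.s x)) := by
  rw [leftLim_s hx]
  exact tendsto_s_left hx

theorem rightLim_s_le (hx : x ∈ T.openPart) (hz : z ∈ T.openPart) (hxz : x < z) :
    Function.rightLim T.s x ≤ T.s z := by
  refine le_of_tendsto (tendsto_rightLim_s hx) ?_
  filter_upwards [Ioo_mem_nhdsGT hxz] with w hw
  exact T.s_mono (T.ordConnected_openPart.out hx hz ⟨hw.1.le, hw.2.le⟩) hz hw.2.le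

theorem le_leftLim_s (hx : x ∈ T.openPart) (hz : z ∈ T.openPart) (hxz : z < x) :
    T.s z ≤ Function.leftLim T.s x := by
  refine ge_of_tendsto (tendsto_leftLim_s hx) ?_
  filter_upwards [Ioo_mem_nhdsLT hxz] with w hw
  exact T.s_mono hz (T.ordConnected_openPart.out hz hx ⟨hw.1.le, hw.2.le⟩) hw.1.le

theorem le_rightLim_s (hx : x ∈ T.openPart) (h : ∀ z ∈ T.openPart, x < z → y ≤ T.s z) :
    y ≤ Function.rightLim T.s x := by
  refine ge_of_tendsto (tendsto_rightLim_s hx) ?_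
  filter_upwards [self_mem_nhdsWithin,
    mem_nhdsWithin_of_mem_nhds (T.isOpen_openPart.mem_nhds hx)] with z hz hz'
  exact h z hz' hz

theorem leftLim_s_le (hx : x ∈ T.openPart) (h : ∀ z ∈ T.openPart, z < x → T.s z ≤ y) :
    Function.leftLim T.s x ≤ y := by
  refine le_of_tendsto (tendsto_leftLim_s hx) ?_
  filter_upwards [self_mem_nhdsWithin,
    mem_nhdsWithin_of_mem_nhds (T.isOpen_openPart.mem_nhds hx)] with z hz hz'
  exact h z hz' hz

/-! ### The inverse of the scale -/

/-- The values strictly between those at the endpoints. -/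
def valueRange (T : ScaleTriple) : Set ℝ :=
  {y | T.scale T.l < (y : EReal) ∧ (y : EReal) < T.scale T.r}

/-- The supremum in the extended reals is monotone in `y` without restriction, hence measurable; it
is a point of `(l, r)` for `y` in `valueRange`. -/
def quantileE (T : ScaleTriple) (y : ℝ) : EReal := sSup {x | T.scale x < y}

/-- The generalized inverse of the scale. -/
def quantile (T : ScaleTriple) (y : ℝ) : ℝ := (T.quantileE y).toReal

theorem quantileE_mono : Monotone T.quantileE := fun _ _ h =>
  sSup_le_sSup fun _ hx => lt_of_lt_of_le hx (EReal.coe_le_coe_iff.2 h)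

theorem measurable_quantile : Measurable T.quantile :=
  measurable_ereal_toReal.comp quantileE_mono.measurable

theorem measurableSet_valueRange : MeasurableSet T.valueRange :=
  (isOpen_Ioo.preimage continuous_coe_real_ereal).measurableSet

theorem quantile_spec (hy : y ∈ T.valueRange) :
    T.quantile y ∈ T.openPart ∧ (T.quantile y : EReal) = T.quantileE y := by
  obtain ⟨a, ha, hay⟩ := exists_s_lt hy.1
  obtain ⟨b, hb, hyb⟩ := exists_lt_s hy.2
  have h₁ : (a : EReal) ≤ T.quantileE y :=
    le_sSup (by rwa [mem_ofPred_eq, scale_coe ha])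
  have h₂ : T.quantileE y ≤ b := sSup_le fun x hx => by
    rw [← scale_coe hb] at hyb
    exact (scale_mono.reflect_lt (hx.trans hyb)).le
  obtain ⟨z, hz, he⟩ := exists_mem_openPart (ha.1.trans_le h₁) (h₂.trans_lt hb.2)
  have : T.quantile y = z := by rw [quantile, ← he, EReal.toReal_coe]
  rw [this]
  exact ⟨hz, he⟩

theorem quantile_mem (hy : y ∈ T.valueRange) : T.quantile y ∈ T.openPart := (quantile_spec hy).1

theorem s_lt_of_lt_quantile (hy : y ∈ T.valueRange) (hx : x ∈ T.openPart)
    (h : x < T.quantile y) : T.s x < y := by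
  rw [← EReal.coe_lt_coe_iff, (quantile_spec hy).2] at h
  obtain ⟨z, hz, hxz⟩ := lt_sSup_iff.1 h
  have := (scale_mono hxz.le).trans_lt hz
  rwa [scale_coe hx, EReal.coe_lt_coe_iff] at this

theorem le_quantile (hy : y ∈ T.valueRange) (hx : x ∈ T.openPart) (h : T.s x < y) :
    x ≤ T.quantile y := by
  rw [← EReal.coe_le_coe_iff, (quantile_spec hy).2]
  exact le_sSup (by rwa [mem_ofPred_eq, scale_coe hx, EReal.coe_lt_coe_iff])

theorem quantile_le (hy : y ∈ T.valueRange) (hx : x ∈ T.openPart) (h : y ≤ T.s x) :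
    T.quantile y ≤ x :=
  not_lt.1 fun h' => not_lt.2 h (s_lt_of_lt_quantile hy hx h')

theorem le_s_of_quantile_lt (hy : y ∈ T.valueRange) (hx : x ∈ T.openPart)
    (h : T.quantile y < x) : y ≤ T.s x :=
  not_lt.1 fun h' => not_lt.2 (le_quantile hy hx h') h

theorem mem_valueRange_of_lt {a b : ℝ} (ha : a ∈ T.openPart) (hb : b ∈ T.openPart)
    (h₁ : T.s a < y) (h₂ : y < T.s b) : y ∈ T.valueRange :=
  ⟨(scale_left_le ha).trans_lt (EReal.coe_lt_coe_iff.2 h₁),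
    (EReal.coe_lt_coe_iff.2 h₂).trans_le (le_scale_right hb)⟩

/-- The values that are attained at the generalized inverse. -/
def contPart (T : ScaleTriple) : Set ℝ := {y | y ∈ T.valueRange ∧ T.scale (T.quantileE y) = y}

/-- The values skipped by a jump to the right. -/
def plusPart (T : ScaleTriple) : Set ℝ := {y | y ∈ T.valueRange ∧ T.scale (T.quantileE y) < y}

/-- The values skipped by a jump from the left. -/
def minusPart (T : ScaleTriple) : Set ℝ := {y | y ∈ T.valueRange ∧ y < T.scale (T.quantileE y)}

theorem scale_quantileE (hy : y ∈ T.valueRange) : T.scale (T.quantileE y) = T.s (T.quantile y) := by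
  rw [← (quantile_spec hy).2, scale_coe (quantile_mem hy)]

theorem mem_contPart_iff : y ∈ T.contPart ↔ y ∈ T.valueRange ∧ T.s (T.quantile y) = y :=
  and_congr_right fun hy => by rw [scale_quantileE hy, EReal.coe_eq_coe_iff]

theorem mem_plusPart_iff : y ∈ T.plusPart ↔ y ∈ T.valueRange ∧ T.s (T.quantile y) < y :=
  and_congr_right fun hy => by rw [scale_quantileE hy, EReal.coe_lt_coe_iff]

theorem mem_minusPart_iff : y ∈ T.minusPart ↔ y ∈ T.valueRange ∧ y < T.s (T.quantile y) :=
  and_congr_right fun hy => by rw [scale_quantileE hy, EReal.coe_lt_coe_iff]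

theorem measurable_scale_quantileE : Measurable fun y => T.scale (T.quantileE y) :=
  scale_mono.measurable.comp quantileE_mono.measurable

theorem measurableSet_contPart : MeasurableSet T.contPart :=
  measurableSet_valueRange.inter
    (measurableSet_eq_fun measurable_scale_quantileE measurable_coe_real_ereal)

theorem measurableSet_plusPart : MeasurableSet T.plusPart :=
  measurableSet_valueRange.inter
    (measurableSet_lt measurable_scale_quantileE measurable_coe_real_ereal)

theorem measurableSet_minusPart : MeasurableSet T.minusPart :=
  measurableSet_valueRange.inter
    (measurableSet_lt measurable_coe_real_ereal measurable_scale_quantileE)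

/-- These equivalences turn domains of integration bounded by `x` into domains bounded by `s(x)`.
The strict form for the continuous and plus parts suits `∫_{(0,x)}`, the weak form for the minus
part suits `∫_{(0,x]}`; excluding the single value `s(x)` costs nothing. -/
theorem quantile_lt_iff_of_contPart (hy : y ∈ T.contPart) (hx : x ∈ T.openPart)
    (hne : y ≠ T.s x) : T.quantile y < x ↔ y < T.s x := by
  obtain ⟨hy, he⟩ := mem_contPart_iff.1 hy
  refine ⟨fun h => lt_of_le_of_ne (le_s_of_quantile_lt hy hx h) hne, fun h => ?_⟩
  refine lt_of_le_of_ne (quantile_le hy hx h.le) fun h' => ?_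
  rw [← h', he] at h
  exact lt_irrefl _ h

theorem quantile_le_iff_of_contPart (hy : y ∈ T.contPart) (hx : x ∈ T.openPart)
    (hne : y ≠ T.s x) : T.quantile y ≤ x ↔ y < T.s x := by
  rw [← quantile_lt_iff_of_contPart hy hx hne]
  refine ⟨fun h => lt_of_le_of_ne h fun h' => hne ?_, le_of_lt⟩
  rw [← h', (mem_contPart_iff.1 hy).2]

theorem quantile_lt_iff_of_plusPart (hy : y ∈ T.plusPart) (hx : x ∈ T.openPart)
    (hne : y ≠ T.s x) : T.quantile y < x ↔ y < T.s x := by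
  obtain ⟨hy, he⟩ := mem_plusPart_iff.1 hy
  refine ⟨fun h => lt_of_le_of_ne (le_s_of_quantile_lt hy hx h) hne, fun h => ?_⟩
  refine lt_of_le_of_ne (quantile_le hy hx h.le) fun h' => ?_
  rw [h'] at he
  exact lt_asymm he h

theorem quantile_le_iff_of_minusPart (hy : y ∈ T.minusPart) (hx : x ∈ T.openPart) :
    T.quantile y ≤ x ↔ y < T.s x := by
  obtain ⟨hy, he⟩ := mem_minusPart_iff.1 hy
  refine ⟨fun h => ?_, fun h => quantile_le hy hx h.le⟩
  exact he.trans_le (T.s_mono (quantile_mem hy) hx h)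

/-- The scale is continuous at `0` with value `0`, so only the value `0` can sit over the point `0`.
Thus it does not matter whether `0` belongs to a domain of integration. -/
theorem quantile_ne_zero (hy : y ∈ T.valueRange) (hne : y ≠ 0) : T.quantile y ≠ 0 := by
  intro h
  have h0 := T.zero_mem_openPart
  have hc : Tendsto T.s (𝓝 0) (𝓝 0) := by simpa [ContinuousAt, T.s_zero] using T.s_cont_zero
  rcases lt_or_gt_of_ne hne with hlt | hlt
  · have h₁ : Function.leftLim T.s 0 ≤ y := leftLim_s_le h0 fun z hz hz0 =>
      (s_lt_of_lt_quantile hy hz (h ▸ hz0)).le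
    rw [leftLim_eq_of_tendsto (hc.mono_left nhdsWithin_le_nhds)] at h₁
    linarith
  · have h₁ : y ≤ Function.rightLim T.s 0 := le_rightLim_s h0 fun z hz hz0 =>
      le_s_of_quantile_lt hy hz (h ▸ hz0)
    rw [rightLim_eq_of_tendsto (hc.mono_left nhdsWithin_le_nhds)] at h₁
    linarith

/-! ### The jump measures as images of Lebesgue measure -/

/-- The fibres of `ξ` in `J` are disjoint, so only countably many have positive length. Those of
weight zero are empty, so the image measure is the sum of its atoms. -/
theorem sum_smul_dirac_eq_map {J O : Set ℝ} (hJ : MeasurableSet J) {ξ : ℝ → ℝ}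
    (hξ : Measurable ξ) {w : ℝ → ℝ≥0∞} (hO : ∀ y ∈ J, ξ y ∈ O)
    (hw : ∀ x ∈ O, volume (J ∩ ξ ⁻¹' {x}) = w x)
    (h0 : ∀ x ∈ O, w x = 0 → J ∩ ξ ⁻¹' {x} = ∅) :
    (Measure.sum fun x : O => w x • Measure.dirac (x : ℝ)) = (volume.restrict J).map ξ := by
  have hm : ∀ x, MeasurableSet (J ∩ ξ ⁻¹' {x}) := fun x => hJ.inter (hξ (measurableSet_singleton x))
  have hdisj : Pairwise (Function.onFun Disjoint fun x : ℝ => J ∩ ξ ⁻¹' {x}) := by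
    intro x x' hne
    refine disjoint_left.2 ?_
    rintro y ⟨-, h₁⟩ ⟨-, h₂⟩
    exact hne (h₁.symm.trans h₂)
  have hcount : {x | 0 < volume (J ∩ ξ ⁻¹' {x})}.Countable :=
    Measure.countable_meas_pos_of_disjoint_iUnion hm hdisj
  ext B hB
  rw [Measure.sum_apply _ hB, Measure.map_apply hξ hB, Measure.restrict_apply (hξ hB)]
  set P : Set ℝ := {x | x ∈ B ∧ 0 < volume (J ∩ ξ ⁻¹' {x})} with hP
  have hunion : ξ ⁻¹' B ∩ J = ⋃ x ∈ P, J ∩ ξ ⁻¹' {x} := by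
    ext y
    simp only [mem_iUnion, exists_prop]
    constructor
    · rintro ⟨hyB, hyJ⟩
      refine ⟨ξ y, ⟨hyB, ?_⟩, hyJ, rfl⟩
      rw [hw _ (hO y hyJ), pos_iff_ne_zero]
      intro h
      have : y ∈ J ∩ ξ ⁻¹' {ξ y} := ⟨hyJ, rfl⟩
      rw [h0 _ (hO y hyJ) h] at this
      exact this
    · rintro ⟨x, hx, hyJ, rfl⟩
      exact ⟨hx.1, hyJ⟩
  rw [hunion, measure_biUnion (hcount.mono fun x hx => hx.2) (fun x _ x' _ hne => hdisj hne)
    fun x _ => hm x]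
  have h₁ : ∀ x : O, (w x • Measure.dirac (x : ℝ)) B = B.indicator w x := by
    intro x
    rw [Measure.smul_apply, Measure.dirac_apply' _ hB, smul_eq_mul]
    by_cases hx : (x : ℝ) ∈ B
    · simp [hx]
    · simp [hx]
  simp only [h₁]
  rw [tsum_subtype O (B.indicator w), tsum_subtype P fun x => volume (J ∩ ξ ⁻¹' {x})]
  refine tsum_congr fun x => ?_
  by_cases hxO : x ∈ O
  · rw [indicator_of_mem hxO]
    by_cases hxB : x ∈ B
    · rw [indicator_of_mem hxB, ← hw x hxO]
      by_cases hxP : 0 < volume (J ∩ ξ ⁻¹' {x})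
      · rw [indicator_of_mem (show x ∈ P from ⟨hxB, hxP⟩)]
      · rw [indicator_of_notMem (show x ∉ P from fun h => hxP h.2)]
        simpa using hxP
    · rw [indicator_of_notMem hxB, indicator_of_notMem (show x ∉ P from fun h => hxB h.1)]
  · rw [indicator_of_notMem hxO, indicator_of_notMem]
    rintro ⟨-, hx⟩
    obtain ⟨y, hyJ, rfl⟩ := nonempty_of_measure_ne_zero hx.ne'
    exact hxO (hO y hyJ)

theorem volume_of_Ioo_subset_of_subset_Icc {A : Set ℝ} {a b : ℝ} (h₁ : Ioo a b ⊆ A)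
    (h₂ : A ⊆ Icc a b) : volume A = ENNReal.ofReal (b - a) := by
  refine le_antisymm ?_ ?_
  · rw [← Real.volume_Icc]
    exact measure_mono h₂
  · rw [← Real.volume_Ioo]
    exact measure_mono h₁

theorem plusPart_fibre (hx : x ∈ T.openPart) :
    Ioo (T.s x) (Function.rightLim T.s x) ⊆ T.plusPart ∩ T.quantile ⁻¹' {x} ∧
      T.plusPart ∩ T.quantile ⁻¹' {x} ⊆ Ioc (T.s x) (Function.rightLim T.s x) := by
  constructor
  · intro y hy
    obtain ⟨b, hb, hxb⟩ := exists_gt_mem hx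
    have hJ : y ∈ T.valueRange :=
      mem_valueRange_of_lt hx hb hy.1 (hy.2.trans_le (rightLim_s_le hx hb hxb))
    have hq : T.quantile y = x := by
      refine le_antisymm (le_of_forall_gt_imp_ge_of_dense fun z hz => ?_) (le_quantile hJ hx hy.1)
      rcases le_or_gt b z with h | h
      · exact (quantile_le hJ hb (hy.2.le.trans (rightLim_s_le hx hb hxb))).trans h
      · have hz' := T.ordConnected_openPart.out hx hb ⟨hz.le, h.le⟩
        exact quantile_le hJ hz' (hy.2.le.trans (rightLim_s_le hx hz' hz))
    exact ⟨mem_plusPart_iff.2 ⟨hJ, by rw [hq]; exact hy.1⟩, hq⟩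
  · rintro y ⟨hy, rfl⟩
    obtain ⟨hJ, hlt⟩ := mem_plusPart_iff.1 hy
    exact ⟨hlt, le_rightLim_s hx fun z hz hxz => le_s_of_quantile_lt hJ hz hxz⟩

theorem minusPart_fibre (hx : x ∈ T.openPart) :
    Ioo (Function.leftLim T.s x) (T.s x) ⊆ T.minusPart ∩ T.quantile ⁻¹' {x} ∧
      T.minusPart ∩ T.quantile ⁻¹' {x} ⊆ Ico (Function.leftLim T.s x) (T.s x) := by
  constructor
  · intro y hy
    obtain ⟨b, hb, hxb⟩ := exists_lt_mem hx
    have hJ : y ∈ T.valueRange :=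
      mem_valueRange_of_lt hb hx ((le_leftLim_s hx hb hxb).trans_lt hy.1) hy.2
    have hq : T.quantile y = x := by
      refine le_antisymm (quantile_le hJ hx hy.2.le)
        (le_of_forall_lt_imp_le_of_dense fun z hz => ?_)
      rcases le_or_gt z b with h | h
      · exact h.trans (le_quantile hJ hb ((le_leftLim_s hx hb hxb).trans_lt hy.1))
      · have hz' := T.ordConnected_openPart.out hb hx ⟨h.le, hz.le⟩
        exact le_quantile hJ hz' ((le_leftLim_s hx hz' hz).trans_lt hy.1)
    exact ⟨mem_minusPart_iff.2 ⟨hJ, by rw [hq]; exact hy.2⟩, hq⟩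
  · rintro y ⟨hy, rfl⟩
    obtain ⟨hJ, hlt⟩ := mem_minusPart_iff.1 hy
    exact ⟨leftLim_s_le hx fun z hz hxz => (s_lt_of_lt_quantile hJ hz hxz).le, hlt⟩

theorem muPlus_eq : T.muPlus = (volume.restrict T.plusPart).map T.quantile := by
  refine sum_smul_dirac_eq_map (w := fun x => ENNReal.ofReal (Function.rightLim T.s x - T.s x))
    measurableSet_plusPart measurable_quantile
    (fun y hy => quantile_mem hy.1) (fun x hx => ?_) fun x hx h => ?_
  · exact volume_of_Ioo_subset_of_subset_Icc (plusPart_fibre hx).1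
      ((plusPart_fibre hx).2.trans Ioc_subset_Icc_self)
  · rw [ENNReal.ofReal_eq_zero, sub_nonpos] at h
    exact subset_eq_empty (plusPart_fibre hx).2 (Ioc_eq_empty (not_lt.2 h))

theorem muMinus_eq : T.muMinus = (volume.restrict T.minusPart).map T.quantile := by
  refine sum_smul_dirac_eq_map (w := fun x => ENNReal.ofReal (T.s x - Function.leftLim T.s x))
    measurableSet_minusPart measurable_quantile
    (fun y hy => quantile_mem hy.1) (fun x hx => ?_) fun x hx h => ?_
  · exact volume_of_Ioo_subset_of_subset_Icc (minusPart_fibre hx).1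
      ((minusPart_fibre hx).2.trans Ico_subset_Icc_self)
  · rw [ENNReal.ofReal_eq_zero, sub_nonpos] at h
    exact subset_eq_empty (minusPart_fibre hx).2 (Ico_eq_empty (not_lt.2 h))

end ScaleTriple

/-! ### Uniqueness of Lebesgue–Stieltjes measures and a change of variables -/

theorem IsLebesgueStieltjes.eq {F : ℝ → ℝ} {J : Set ℝ} (hJ : IsOpen J) (hJ' : J.OrdConnected)
    {μ ν : Measure ℝ} (hμ : IsLebesgueStieltjes F J μ) (hν : IsLebesgueStieltjes F J ν) :
    μ = ν := by
  -- Countably many rational intervals cover `J`; on each both measures are finite and agree on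
  -- half-open intervals.
  let S : Type := {p : ℚ × ℚ // (p.1 : ℝ) ∈ J ∧ (p.2 : ℝ) ∈ J}
  have hcover : (⋃ p : S, Ioc (p.1.1 : ℝ) (p.1.2 : ℝ)) ∪ Jᶜ = univ := by
    refine eq_univ_of_forall fun x => ?_
    by_cases hx : x ∈ J
    · obtain ⟨a, b, hab, hsub⟩ := (mem_nhds_iff_exists_Ioo_subset).1 (hJ.mem_nhds hx)
      obtain ⟨p, hp, hp'⟩ := exists_rat_btwn hab.1
      obtain ⟨q, hq, hq'⟩ := exists_rat_btwn hab.2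
      exact Or.inl (mem_iUnion.2 ⟨⟨(p, q), hsub ⟨hp, hp'.trans hab.2⟩, hsub ⟨hab.1.trans hq, hq'⟩⟩,
        hp', hq.le⟩)
    · exact Or.inr hx
  have hloc : ∀ p : S, μ.restrict (Ioc (p.1.1 : ℝ) (p.1.2 : ℝ)) =
      ν.restrict (Ioc (p.1.1 : ℝ) (p.1.2 : ℝ)) := by
    rintro ⟨⟨p, q⟩, hp, hq⟩
    simp only at *
    have key : ∀ a b : ℝ, μ (Ioc a b ∩ Ioc p q) = ν (Ioc a b ∩ Ioc p q) := by
      intro a b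
      rw [Ioc_inter_Ioc]
      rcases le_or_gt (min b (q : ℝ)) (max a p) with h | h
      · rw [Ioc_eq_empty (not_lt.2 h), measure_empty, measure_empty]
      · rw [max_lt_iff, lt_min_iff, lt_min_iff] at h
        have h₁ : max a (p : ℝ) ∈ J :=
          hJ'.out hp hq ⟨le_max_right _ _, max_le h.1.2.le h.2.2.le⟩
        have h₂ : min b (q : ℝ) ∈ J :=
          hJ'.out hp hq ⟨le_min h.2.1.le h.2.2.le, min_le_right _ _⟩
        have h₃ : max a (p : ℝ) ≤ min b (q : ℝ) :=
          max_le (le_min h.1.1.le h.1.2.le) (le_min h.2.1.le h.2.2.le)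
        rw [hμ.2 _ h₁ _ h₂ h₃, hν.2 _ h₁ _ h₂ h₃]
    have hfin : IsFiniteMeasure (μ.restrict (Ioc (p : ℝ) q)) := by
      refine ⟨?_⟩
      rw [Measure.restrict_apply_univ]
      rcases le_or_gt (q : ℝ) p with h | h
      · rw [Ioc_eq_empty (not_lt.2 h), measure_empty]
        exact ENNReal.zero_lt_top
      · rw [hμ.2 _ hp _ hq h.le]
        exact ENNReal.ofReal_lt_top
    refine Measure.ext_of_Ioc _ _ fun a b _ => ?_
    rw [Measure.restrict_apply measurableSet_Ioc, Measure.restrict_apply measurableSet_Ioc]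
    exact key a b
  have hJc : μ.restrict Jᶜ = ν.restrict Jᶜ := by
    rw [Measure.restrict_eq_zero.2 hμ.1, Measure.restrict_eq_zero.2 hν.1]
  have : Countable S := inferInstanceAs (Countable {p : ℚ × ℚ // _})
  rw [← Measure.restrict_univ (μ := μ), ← Measure.restrict_univ (μ := ν), ← hcover,
    Measure.restrict_union_congr]
  exact ⟨Measure.restrict_iUnion_congr.2 hloc, hJc⟩

theorem setIntegral_map_eq_intervalIntegral {J B : Set ℝ} (hJ : MeasurableSet J)
    (hB : MeasurableSet B) {ξ g : ℝ → ℝ} (hξ : Measurable ξ)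
    (hg : AEStronglyMeasurable g ((volume.restrict J).map ξ)) {a b : ℝ} (hab : a ≤ b)
    (h : ∀ᵐ y, y ∈ J → (ξ y ∈ B ↔ y ∈ Ioc a b)) :
    ∫ x in B, g x ∂(volume.restrict J).map ξ = ∫ y in a..b, J.indicator (g ∘ ξ) y := by
  rw [setIntegral_map hB hg hξ.aemeasurable, Measure.restrict_restrict (hξ hB),
    intervalIntegral.integral_of_le hab, setIntegral_indicator hJ]
  refine setIntegral_congr_set ?_
  filter_upwards [h] with y hy
  refine propext ⟨fun k => ⟨(hy k.2).1 k.1, k.2⟩, fun k => ⟨(hy k.2).2 k.1, k.2⟩⟩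

theorem memLp_map_restrict_iff {J : Set ℝ} (hJ : MeasurableSet J) {ξ g : ℝ → ℝ}
    (hξ : Measurable ξ) (hg : AEStronglyMeasurable g ((volume.restrict J).map ξ)) :
    MemLp g 2 ((volume.restrict J).map ξ) ↔ MemLp (J.indicator (g ∘ ξ)) 2 volume := by
  rw [memLp_map_measure_iff hg hξ.aemeasurable, memLp_indicator_iff_restrict hJ]

theorem ae_ne (c : ℝ) : ∀ᵐ y : ℝ, y ≠ c := Measure.ae_ne volume c

/-! ### Integrals against the three measures in the variable `s(x)` -/

namespace ScaleTriple

variable {T : ScaleTriple} {x y z : ℝ} {g : ℝ → ℝ} {J : Set ℝ}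

theorem s_nonneg (hx : x ∈ T.openPart) (h : 0 ≤ x) : 0 ≤ T.s x := by
  have := T.s_mono T.zero_mem_openPart hx h
  rwa [T.s_zero] at this

theorem s_nonpos (hx : x ∈ T.openPart) (h : x ≤ 0) : T.s x ≤ 0 := by
  have := T.s_mono hx T.zero_mem_openPart h
  rwa [T.s_zero] at this

theorem integralOpen_map (hJ : MeasurableSet J) (hJv : J ⊆ T.valueRange)
    (h : ∀ x ∈ T.openPart, ∀ y ∈ J, y ≠ T.s x → (T.quantile y < x ↔ y < T.s x))
    (hg : AEStronglyMeasurable g ((volume.restrict J).map T.quantile)) (hx : x ∈ T.openPart) :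
    integralOpen ((volume.restrict J).map T.quantile) g x =
      ∫ y in 0..T.s x, J.indicator (g ∘ T.quantile) y := by
  have h0 := h 0 T.zero_mem_openPart
  rw [T.s_zero] at h0
  rw [integralOpen]
  split_ifs with hx0
  · refine setIntegral_map_eq_intervalIntegral hJ measurableSet_Ioo measurable_quantile hg
      (s_nonneg hx hx0) ?_
    filter_upwards [ae_ne 0, ae_ne (T.s x)] with y hy0 hyx hy
    have h₁ := h x hx y hy hyx
    have h₂ := h0 y hy hy0
    have h₃ := quantile_ne_zero (hJv hy) hy0
    simp only [mem_Ioo, mem_Ioc]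
    grind
  · rw [intervalIntegral.integral_symm]
    congr 1
    refine setIntegral_map_eq_intervalIntegral hJ measurableSet_Ico measurable_quantile hg
      (s_nonpos hx (not_le.1 hx0).le) ?_
    filter_upwards [ae_ne 0, ae_ne (T.s x)] with y hy0 hyx hy
    have h₁ := h x hx y hy hyx
    have h₂ := h0 y hy hy0
    have h₃ := quantile_ne_zero (hJv hy) hy0
    simp only [mem_Ico, mem_Ioc]
    grind

theorem integralClosed_map (hJ : MeasurableSet J) (hJv : J ⊆ T.valueRange)
    (h : ∀ x ∈ T.openPart, ∀ y ∈ J, (T.quantile y ≤ x ↔ y < T.s x))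
    (hg : AEStronglyMeasurable g ((volume.restrict J).map T.quantile)) (hx : x ∈ T.openPart) :
    integralClosed ((volume.restrict J).map T.quantile) g x =
      ∫ y in 0..T.s x, J.indicator (g ∘ T.quantile) y := by
  have h0 := h 0 T.zero_mem_openPart
  rw [T.s_zero] at h0
  rw [integralClosed]
  split_ifs with hx0
  · refine setIntegral_map_eq_intervalIntegral hJ measurableSet_Ioc measurable_quantile hg
      (s_nonneg hx hx0) ?_
    filter_upwards [ae_ne 0, ae_ne (T.s x)] with y hy0 hyx hy
    have h₁ := h x hx y hy
    have h₂ := h0 y hy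
    have h₃ := quantile_ne_zero (hJv hy) hy0
    simp only [mem_Ioc]
    grind
  · rw [intervalIntegral.integral_symm]
    congr 1
    refine setIntegral_map_eq_intervalIntegral hJ measurableSet_Ioo measurable_quantile hg
      (s_nonpos hx (not_le.1 hx0).le) ?_
    filter_upwards [ae_ne 0, ae_ne (T.s x)] with y hy0 hyx hy
    have h₁ := h x hx y hy
    have h₂ := h0 y hy
    have h₃ := quantile_ne_zero (hJv hy) hy0
    simp only [mem_Ioo, mem_Ioc]
    grind

theorem contPart_subset : T.contPart ⊆ T.valueRange := fun _ h => h.1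
theorem plusPart_subset : T.plusPart ⊆ T.valueRange := fun _ h => h.1
theorem minusPart_subset : T.minusPart ⊆ T.valueRange := fun _ h => h.1

theorem integralOpen_muPlus (hg : AEStronglyMeasurable g T.muPlus) (hx : x ∈ T.openPart) :
    integralOpen T.muPlus g x = ∫ y in 0..T.s x, T.plusPart.indicator (g ∘ T.quantile) y := by
  rw [muPlus_eq] at hg ⊢
  exact integralOpen_map measurableSet_plusPart plusPart_subset
    (fun x hx y hy hne => quantile_lt_iff_of_plusPart hy hx hne) hg hx

theorem integralClosed_muMinus (hg : AEStronglyMeasurable g T.muMinus) (hx : x ∈ T.openPart) :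
    integralClosed T.muMinus g x = ∫ y in 0..T.s x, T.minusPart.indicator (g ∘ T.quantile) y := by
  rw [muMinus_eq] at hg ⊢
  exact integralClosed_map measurableSet_minusPart minusPart_subset
    (fun x hx y hy => quantile_le_iff_of_minusPart hy hx) hg hx

theorem intervalIntegrable_indicator_one (hJ : MeasurableSet J) (a b : ℝ) :
    IntervalIntegrable (J.indicator fun _ => (1 : ℝ)) volume a b :=
  ⟨Integrable.indicator (intervalIntegrable_const (μ := volume)).1 hJ,
    Integrable.indicator (intervalIntegrable_const (μ := volume)).2 hJ⟩

theorem sPlus_eq (hx : x ∈ T.openPart) :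
    T.sPlus x = ∫ y in 0..T.s x, T.plusPart.indicator (fun _ => (1 : ℝ)) y := by
  have h := integralOpen_muPlus (T := T) (g := fun _ => 1) aestronglyMeasurable_const hx
  rw [show (fun _ => (1 : ℝ)) = (fun _ => (1 : ℝ)) ∘ T.quantile from rfl, ← h]
  simp [sPlus, integralOpen, Measure.real]

theorem sMinus_eq (hx : x ∈ T.openPart) :
    T.sMinus x = ∫ y in 0..T.s x, T.minusPart.indicator (fun _ => (1 : ℝ)) y := by
  have h := integralClosed_muMinus (T := T) (g := fun _ => 1) aestronglyMeasurable_const hx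
  rw [show (fun _ => (1 : ℝ)) = (fun _ => (1 : ℝ)) ∘ T.quantile from rfl, ← h]
  simp [sMinus, integralClosed, Measure.real]

theorem mem_valueRange_of_mem_uIoc (hx : x ∈ T.openPart) (hy : y ∈ uIoc 0 (T.s x)) (hy0 : y ≠ 0)
    (hyx : y ≠ T.s x) : y ∈ T.valueRange := by
  have h0 := T.zero_mem_openPart
  rcases mem_uIoc.1 hy with h | h
  · exact mem_valueRange_of_lt h0 hx (by rw [T.s_zero]; exact h.1) (lt_of_le_of_ne h.2 hyx)
  · exact mem_valueRange_of_lt hx h0 h.1 (by rw [T.s_zero]; exact lt_of_le_of_ne h.2 hy0)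

/-- A function on the range of the scale, glued from its three parts. -/
def glue (T : ScaleTriple) (g₁ g₂ g₃ : ℝ → ℝ) (y : ℝ) : ℝ :=
  T.contPart.indicator g₁ y + T.plusPart.indicator g₂ y + T.minusPart.indicator g₃ y

variable {g₁ g₂ g₃ : ℝ → ℝ}

theorem glue_of_mem_contPart (hy : y ∈ T.contPart) : T.glue g₁ g₂ g₃ y = g₁ y := by
  rw [glue, indicator_of_mem hy, indicator_of_notMem (fun h => h.2.ne hy.2),
    indicator_of_notMem (fun h => h.2.ne' hy.2), add_zero, add_zero]

theorem glue_of_mem_plusPart (hy : y ∈ T.plusPart) : T.glue g₁ g₂ g₃ y = g₂ y := by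
  rw [glue, indicator_of_mem hy, indicator_of_notMem (fun h => hy.2.ne h.2),
    indicator_of_notMem (fun h => lt_asymm hy.2 h.2), zero_add, add_zero]

theorem glue_of_mem_minusPart (hy : y ∈ T.minusPart) : T.glue g₁ g₂ g₃ y = g₃ y := by
  rw [glue, indicator_of_mem hy, indicator_of_notMem (fun h => hy.2.ne' h.2),
    indicator_of_notMem (fun h => lt_asymm hy.2 h.2), zero_add, zero_add]

theorem glue_of_notMem (hy : y ∉ T.valueRange) : T.glue g₁ g₂ g₃ y = 0 := by
  rw [glue, indicator_of_notMem (fun h => hy h.1), indicator_of_notMem (fun h => hy h.1),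
    indicator_of_notMem (fun h => hy h.1), add_zero, add_zero]

theorem mem_parts (hy : y ∈ T.valueRange) : y ∈ T.contPart ∨ y ∈ T.plusPart ∨ y ∈ T.minusPart := by
  rcases lt_trichotomy (T.scale (T.quantileE y)) y with h | h | h
  · exact Or.inr (Or.inl ⟨hy, h⟩)
  · exact Or.inl ⟨hy, h⟩
  · exact Or.inr (Or.inr ⟨hy, h⟩)

/-- The three parts fill the interval between `0` and `s(x)` up to its ends, so their signed lengths
add up to `s(x)`; removing the jump parts leaves the length of the continuous part. -/
theorem sCont_eq (hx : x ∈ T.openPart) :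
    T.sCont x = ∫ y in 0..T.s x, T.contPart.indicator (fun _ => (1 : ℝ)) y := by
  have h₁ := intervalIntegrable_indicator_one (T.measurableSet_contPart) 0 (T.s x)
  have h₂ := intervalIntegrable_indicator_one (T.measurableSet_plusPart) 0 (T.s x)
  have h₃ := intervalIntegrable_indicator_one (T.measurableSet_minusPart) 0 (T.s x)
  have hs : T.s x = ∫ y in 0..T.s x, T.glue (fun _ => 1) (fun _ => 1) (fun _ => 1) y := by
    rw [intervalIntegral.integral_congr_ae (g := fun _ => (1 : ℝ))]
    · simp
    · filter_upwards [ae_ne 0, ae_ne (T.s x)] with y hy0 hyx hy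
      rcases mem_parts (mem_valueRange_of_mem_uIoc hx hy hy0 hyx) with h | h | h
      · rw [glue_of_mem_contPart h]
      · rw [glue_of_mem_plusPart h]
      · rw [glue_of_mem_minusPart h]
  simp only [glue] at hs
  rw [intervalIntegral.integral_add (h₁.add h₂) h₃, intervalIntegral.integral_add h₁ h₂,
    ← sPlus_eq hx, ← sMinus_eq hx] at hs
  rw [sCont]
  linarith

/-- Since `μ_c` is defined by choice, this together with uniqueness identifies it. -/
theorem isLebesgueStieltjes_sCont :
    IsLebesgueStieltjes T.sCont T.openPart ((volume.restrict T.contPart).map T.quantile) := by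
  refine ⟨?_, fun a ha b hb hab => ?_⟩
  · rw [Measure.map_apply measurable_quantile T.isOpen_openPart.measurableSet.compl,
      Measure.restrict_apply
        (measurable_quantile T.isOpen_openPart.measurableSet.compl)]
    refine measure_mono_null (fun y hy => ?_) measure_empty
    exact hy.1 (quantile_mem hy.2.1)
  · have hsab := T.s_mono ha hb hab
    have hi := fun a b => intervalIntegrable_indicator_one (T.measurableSet_contPart) a b
    rw [sCont_eq ha, sCont_eq hb,
      intervalIntegral.integral_interval_sub_left (hi _ _) (hi _ _),
      intervalIntegral.integral_of_le hsab, setIntegral_indicator T.measurableSet_contPart,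
      setIntegral_const, smul_eq_mul, mul_one, Measure.real,
      ENNReal.ofReal_toReal ((measure_mono inter_subset_left).trans_lt measure_Ioc_lt_top).ne,
      Measure.map_apply measurable_quantile measurableSet_Ioc,
      Measure.restrict_apply (measurable_quantile measurableSet_Ioc)]
    refine measure_congr ?_
    filter_upwards [ae_ne (T.s a), ae_ne (T.s b)] with y hya hyb
    refine propext (and_congr_left fun hy => ?_)
    have h₁ := quantile_le_iff_of_contPart hy ha hya
    have h₂ := quantile_le_iff_of_contPart hy hb hyb
    change (a < T.quantile y ∧ T.quantile y ≤ b) ↔ T.s a < y ∧ y ≤ T.s b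
    grind

theorem muCont_eq : T.muCont = (volume.restrict T.contPart).map T.quantile := by
  have h : ∃ μ, IsLebesgueStieltjes T.sCont T.openPart μ := ⟨_, isLebesgueStieltjes_sCont⟩
  rw [muCont, lebesgueStieltjes, dif_pos h]
  exact h.choose_spec.eq T.isOpen_openPart T.ordConnected_openPart isLebesgueStieltjes_sCont

theorem integralOpen_muCont (hg : AEStronglyMeasurable g T.muCont) (hx : x ∈ T.openPart) :
    integralOpen T.muCont g x = ∫ y in 0..T.s x, T.contPart.indicator (g ∘ T.quantile) y := by
  rw [muCont_eq] at hg ⊢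
  exact integralOpen_map measurableSet_contPart contPart_subset
    (fun x hx y hy hne => quantile_lt_iff_of_contPart hy hx hne) hg hx

end ScaleTriple

/-! ### Functions in `S` as functions of the scale -/

namespace ScaleTriple

variable {T : ScaleTriple} {x y z : ℝ} {f f' H H' : ℝ → ℝ} {g g' : Density}

/-- The square integrability of the three densities. -/
def IsSquareIntegrable (T : ScaleTriple) (g : Density) : Prop :=
  MemLp g.cont 2 T.muCont ∧ MemLp g.plus 2 T.muPlus ∧ MemLp g.minus 2 T.muMinus

/-- A triple of densities, as a function on the range of the scale. -/
def pulled (T : ScaleTriple) (g : Density) : ℝ → ℝ :=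
  T.glue (g.cont ∘ T.quantile) (g.plus ∘ T.quantile) (g.minus ∘ T.quantile)

theorem isSquareIntegrable_iff (h₁ : AEStronglyMeasurable g.cont T.muCont)
    (h₂ : AEStronglyMeasurable g.plus T.muPlus) (h₃ : AEStronglyMeasurable g.minus T.muMinus) :
    T.IsSquareIntegrable g ↔ MemLp (T.contPart.indicator (g.cont ∘ T.quantile)) 2 volume ∧
      MemLp (T.plusPart.indicator (g.plus ∘ T.quantile)) 2 volume ∧
      MemLp (T.minusPart.indicator (g.minus ∘ T.quantile)) 2 volume := by
  rw [IsSquareIntegrable]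
  rw [muCont_eq] at *
  rw [muPlus_eq] at *
  rw [muMinus_eq] at *
  rw [memLp_map_restrict_iff measurableSet_contPart measurable_quantile h₁,
    memLp_map_restrict_iff measurableSet_plusPart measurable_quantile h₂,
    memLp_map_restrict_iff measurableSet_minusPart measurable_quantile h₃]

theorem IsSquareIntegrable.memLp_parts (h : T.IsSquareIntegrable g) :
    MemLp (T.contPart.indicator (g.cont ∘ T.quantile)) 2 volume ∧
      MemLp (T.plusPart.indicator (g.plus ∘ T.quantile)) 2 volume ∧
      MemLp (T.minusPart.indicator (g.minus ∘ T.quantile)) 2 volume :=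
  (isSquareIntegrable_iff h.1.1 h.2.1.1 h.2.2.1).1 h

theorem IsSquareIntegrable.memLp_pulled (h : T.IsSquareIntegrable g) :
    MemLp (T.pulled g) 2 volume :=
  (h.memLp_parts.1.add h.memLp_parts.2.1).add h.memLp_parts.2.2

theorem memLp_two_intervalIntegrable {h : ℝ → ℝ} (hh : MemLp h 2 volume) (a b : ℝ) :
    IntervalIntegrable h volume a b :=
  (LineL2.intervalIntegrable (hh.toLp h) a b).congr_ae
    (ae_restrict_of_ae hh.coeFn_toLp)

/-- The three integrals become integrals over disjoint sets of values and merge into one: `f` is a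
primitive in the variable `s(x)`. -/
theorem hasDensity_iff : T.HasDensity f g ↔ T.IsSquareIntegrable g ∧
    ∃ c₀ : ℝ, ∀ x ∈ T.openPart, f x = c₀ + ∫ y in 0..T.s x, T.pulled g y := by
  rw [HasDensity, IsSquareIntegrable, and_assoc, and_assoc]
  refine and_congr_right fun h₁ => and_congr_right fun h₂ => and_congr_right fun h₃ =>
    exists_congr fun c₀ => forall₂_congr fun x hx => ?_
  have hp := (show T.IsSquareIntegrable g from ⟨h₁, h₂, h₃⟩).memLp_parts
  have i₁ := memLp_two_intervalIntegrable hp.1 0 (T.s x)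
  have i₂ := memLp_two_intervalIntegrable hp.2.1 0 (T.s x)
  have i₃ := memLp_two_intervalIntegrable hp.2.2 0 (T.s x)
  have : ∫ y in 0..T.s x, T.pulled g y = integralOpen T.muCont g.cont x +
      integralOpen T.muPlus g.plus x + integralClosed T.muMinus g.minus x := by
    rw [integralOpen_muCont h₁.1 hx, integralOpen_muPlus h₂.1 hx, integralClosed_muMinus h₃.1 hx,
      ← intervalIntegral.integral_add i₁ i₂, ← intervalIntegral.integral_add (i₁.add i₂) i₃]
    rfl
  rw [this, ← add_assoc, ← add_assoc]

theorem integral_map_eq {J : Set ℝ} (hJ : MeasurableSet J) {h : ℝ → ℝ}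
    (hh : AEStronglyMeasurable h ((volume.restrict J).map T.quantile)) :
    ∫ x, h x ∂(volume.restrict J).map T.quantile = ∫ y, J.indicator (h ∘ T.quantile) y := by
  rw [integral_map measurable_quantile.aemeasurable hh, integral_indicator hJ]
  rfl

/-- The three parts are disjoint, so the product of the glued functions has no cross terms. -/
theorem integral_pulled_mul (h : T.IsSquareIntegrable g) (h' : T.IsSquareIntegrable g') :
    (∫ x, g.cont x * g'.cont x ∂T.muCont) + (∫ x, g.plus x * g'.plus x ∂T.muPlus) +
      (∫ x, g.minus x * g'.minus x ∂T.muMinus) = ∫ y, T.pulled g y * T.pulled g' y := by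
  have m₁ := h.1.1.mul h'.1.1
  have m₂ := h.2.1.1.mul h'.2.1.1
  have m₃ := h.2.2.1.mul h'.2.2.1
  obtain ⟨p₁, p₂, p₃⟩ := h.memLp_parts
  obtain ⟨p₁', p₂', p₃'⟩ := h'.memLp_parts
  rw [muCont_eq] at *
  rw [muPlus_eq] at *
  rw [muMinus_eq] at *
  have e : ∀ (J : Set ℝ) (u v : ℝ → ℝ), J.indicator ((u * v) ∘ T.quantile) =
      J.indicator (u ∘ T.quantile) * J.indicator (v ∘ T.quantile) :=
    fun J u v => by
      ext y
      by_cases hy : y ∈ J <;> simp [hy]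
  have i₁ := MemLp.integrable_mul (p := 2) (q := 2) p₁ p₁'
  have i₂ := MemLp.integrable_mul (p := 2) (q := 2) p₂ p₂'
  have i₃ := MemLp.integrable_mul (p := 2) (q := 2) p₃ p₃'
  change (∫ x, (g.cont * g'.cont) x ∂_) + (∫ x, (g.plus * g'.plus) x ∂_) +
    (∫ x, (g.minus * g'.minus) x ∂_) = _
  rw [integral_map_eq measurableSet_contPart m₁, integral_map_eq measurableSet_plusPart m₂,
    integral_map_eq measurableSet_minusPart m₃, e, e, e, ← integral_add' i₁ i₂,
    ← integral_add' (i₁.add i₂) i₃]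
  congr 1
  ext y
  by_cases hy : y ∈ T.valueRange
  · rcases mem_parts hy with hy | hy | hy
    · rw [pulled, pulled, glue_of_mem_contPart hy, glue_of_mem_contPart hy]
      simp [hy, show y ∉ T.plusPart from fun h => h.2.ne hy.2,
        show y ∉ T.minusPart from fun h => h.2.ne' hy.2]
    · rw [pulled, pulled, glue_of_mem_plusPart hy, glue_of_mem_plusPart hy]
      simp [hy, show y ∉ T.contPart from fun h => hy.2.ne h.2,
        show y ∉ T.minusPart from fun h => lt_asymm hy.2 h.2]
    · rw [pulled, pulled, glue_of_mem_minusPart hy, glue_of_mem_minusPart hy]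
      simp [hy, show y ∉ T.contPart from fun h => hy.2.ne' h.2,
        show y ∉ T.plusPart from fun h => lt_asymm hy.2 h.2]
  · rw [pulled, pulled, glue_of_notMem hy, glue_of_notMem hy]
    simp [show y ∉ T.contPart from fun h => hy h.1, show y ∉ T.plusPart from fun h => hy h.1,
      show y ∉ T.minusPart from fun h => hy h.1]

/-! ### Constancy on the gaps -/

theorem mem_traceSet_of_scale_eq {w : EReal} (h : T.scale w = y) : y ∈ T.traceSet := by
  rcases T.eq_left_or_right_or_coe w with h' | h' | ⟨v, hv, rfl⟩
  · exact left_mem_traceSet (by rw [← h, scale_of_le_left h'])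
  · exact right_mem_traceSet (by rw [← h, scale_of_right_le h'])
  · rw [scale_coe hv, EReal.coe_eq_coe_iff] at h
    rw [← h]
    exact s_mem_traceSet hv

/-- A finite value of the scale belongs to `traceSet` and cannot separate two points of a gap. -/
theorem scale_lt_iff_of_gap {p : ℝ × ℝ} (hp : p ∈ gapSet T.traceSet) (hy : y ∈ Ioo p.1 p.2)
    (hz : z ∈ Ioo p.1 p.2) {w : EReal} : T.scale w < y ↔ T.scale w < z := by
  have key : ∀ {y z}, y ∈ Ioo p.1 p.2 → z ∈ Ioo p.1 p.2 → T.scale w < (y : EReal) →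
      T.scale w < (z : EReal) := by
    intro y z hy hz h
    by_contra! hzw
    have hb : T.scale w ≠ ⊥ := ((EReal.bot_lt_coe z).trans_le hzw).ne'
    have ht : T.scale w ≠ ⊤ := (h.trans (EReal.coe_lt_top y)).ne
    lift T.scale w to ℝ using ⟨ht, hb⟩ with t e
    rw [EReal.coe_lt_coe_iff] at h
    rw [EReal.coe_le_coe_iff] at hzw
    rcases hp.2.2.2 t (mem_traceSet_of_scale_eq e.symm) with h' | h'
    · linarith [hz.1]
    · linarith [hy.2]
  exact ⟨key hy hz, key hz hy⟩

theorem gap_subset_valueRange {p : ℝ × ℝ} (hp : p ∈ gapSet T.traceSet) :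
    Ioo p.1 p.2 ⊆ T.valueRange := fun _ hy =>
  ⟨(traceSet_subset hp.2.1).1.trans_lt (EReal.coe_lt_coe_iff.2 hy.1),
    (EReal.coe_lt_coe_iff.2 hy.2).trans_le (traceSet_subset hp.2.2.1).2⟩

/-- The generalized inverse is constant on a gap, and a gap lies entirely in the plus part or
entirely in the minus part. This is why the pulled density is automatically the minimal one. -/
theorem pulled_eq_of_gap {p : ℝ × ℝ} (hp : p ∈ gapSet T.traceSet) (hy : y ∈ Ioo p.1 p.2)
    (hz : z ∈ Ioo p.1 p.2) : T.pulled g y = T.pulled g z := by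
  have hq : T.quantileE y = T.quantileE z := by
    rw [quantileE, quantileE]
    congr 1
    ext w
    exact scale_lt_iff_of_gap hp hy hz
  have hq' : T.quantile y = T.quantile z := congrArg EReal.toReal hq
  have hyJ := gap_subset_valueRange hp hy
  have hzJ := gap_subset_valueRange hp hz
  have hnot : ∀ {y}, y ∈ Ioo p.1 p.2 → y ∉ T.contPart := by
    intro y hy hc
    rcases hp.2.2.2 y (mem_traceSet_of_scale_eq hc.2) with h | h
    · exact not_lt.2 h hy.1
    · exact not_lt.2 h hy.2
  have hlt : T.scale (T.quantileE y) < y ↔ T.scale (T.quantileE z) < z := by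
    rw [hq]
    exact scale_lt_iff_of_gap hp hy hz
  rcases mem_parts hyJ with h | h | h
  · exact (hnot hy h).elim
  · have h' : z ∈ T.plusPart := ⟨hzJ, hlt.1 h.2⟩
    rw [pulled, glue_of_mem_plusPart h, glue_of_mem_plusPart h', Function.comp_apply,
      Function.comp_apply, hq']
  · have h' : z ∈ T.minusPart := by
      rcases mem_parts hzJ with h' | h' | h'
      · exact (hnot hz h').elim
      · exact (lt_asymm (hlt.2 h'.2) h.2).elim
      · exact h'
    rw [pulled, glue_of_mem_minusPart h, glue_of_mem_minusPart h', Function.comp_apply,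
      Function.comp_apply, hq']

theorem valueRange_subset_intervalHull : T.valueRange ⊆ intervalHull T.traceSet := by
  intro y hy
  obtain ⟨a, ha, hay⟩ := exists_s_lt hy.1
  obtain ⟨b, hb, hyb⟩ := exists_lt_s hy.2
  exact ⟨_, s_mem_traceSet ha, _, s_mem_traceSet hb, (EReal.coe_lt_coe_iff.1 hay).le,
    (EReal.coe_lt_coe_iff.1 hyb).le⟩

theorem isClosed_traceSet : IsClosed T.traceSet := isClosed_closure

theorem IsSquareIntegrable.toLp_mem (h : T.IsSquareIntegrable g) :
    h.memLp_pulled.toLp _ ∈ traceSpace T.traceSet := by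
  refine mem_traceSpace_of_const isClosed_traceSet ?_ fun p hp => ?_
  · filter_upwards [h.memLp_pulled.coeFn_toLp] with y hy hyh
    rw [hy]
    exact glue_of_notMem fun h => hyh (valueRange_subset_intervalHull h)
  · obtain ⟨z, hz, hz'⟩ := exists_between hp.1
    refine ⟨T.pulled g z, ?_⟩
    filter_upwards [h.memLp_pulled.coeFn_toLp] with y hy hyp
    rw [hy]
    exact pulled_eq_of_gap hp hyp ⟨hz, hz'⟩

theorem intervalIntegral_toLp {h : ℝ → ℝ} (hh : MemLp h 2 volume) (a b : ℝ) :
    ∫ y in a..b, (hh.toLp h : LineL2) y = ∫ y in a..b, h y := by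
  refine intervalIntegral.integral_congr_ae ?_
  filter_upwards [hh.coeFn_toLp] with y hy _
  exact hy

/-- A function with densities is a function of the scale. -/
theorem HasDensity.exists_eq_comp (h : T.HasDensity f g) :
    ∃ H, (∀ x ∈ T.openPart, f x = H (T.s x)) ∧ ∃ G : LineL2, G ∈ traceSpace T.traceSet ∧
      (G =ᵐ[volume] T.pulled g) ∧ IsDensity T.traceSet H G := by
  obtain ⟨hg, c₀, hf⟩ := hasDensity_iff.1 h
  refine ⟨primitive 0 c₀ (hg.memLp_pulled.toLp _), fun x hx => ?_, _, hg.toLp_mem,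
    hg.memLp_pulled.coeFn_toLp, (primitive_isDensity _ _ _).mono (subset_univ _)⟩
  rw [hf x hx, primitive, intervalIntegral_toLp]

theorem HasL2Density.eqOn_traceSet (hH : HasL2Density T.traceSet H)
    (hH' : HasL2Density T.traceSet H') (he : ∀ x ∈ T.openPart, H (T.s x) = H' (T.s x)) :
    EqOn H H' T.traceSet := by
  have : EqOn H H' (T.s '' T.openPart) := by
    rintro _ ⟨x, hx, rfl⟩
    exact he x hx
  exact this.of_subset_closure hH.continuousOn hH'.continuousOn subset_closure Subset.rfl

/-- The densities of `H ∘ s`, obtained by averaging the density of `H` over the jumps. -/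
def averaged (T : ScaleTriple) (G : LineL2) : Density where
  cont x := G (T.scale x).toReal
  plus x := (primitive 0 0 G (Function.rightLim T.scale x).toReal -
    primitive 0 0 G (T.scale x).toReal) /
      ((Function.rightLim T.scale x).toReal - (T.scale x).toReal)
  minus x := (primitive 0 0 G (T.scale x).toReal -
    primitive 0 0 G (Function.leftLim T.scale x).toReal) /
      ((T.scale x).toReal - (Function.leftLim T.scale x).toReal)

/-- The extended scale and its one-sided limits are monotone everywhere, whereas `T.s` is arbitrary
off `(l, r)`. -/
theorem measurable_averaged (G : LineL2) : Measurable (T.averaged G).cont ∧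
    Measurable (T.averaged G).plus ∧ Measurable (T.averaged G).minus := by
  have h₁ : Measurable fun x : ℝ => (T.scale x).toReal :=
    measurable_ereal_toReal.comp (scale_mono.measurable.comp measurable_coe_real_ereal)
  have h₂ : Measurable fun x : ℝ => (Function.rightLim T.scale x).toReal :=
    measurable_ereal_toReal.comp ((scale_mono (T := T)).rightLim.measurable.comp
      measurable_coe_real_ereal)
  have h₃ : Measurable fun x : ℝ => (Function.leftLim T.scale x).toReal :=
    measurable_ereal_toReal.comp ((scale_mono (T := T)).leftLim.measurable.comp
      measurable_coe_real_ereal)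
  have hp := (primitive_continuous 0 0 G).measurable
  exact ⟨(Lp.stronglyMeasurable G).measurable.comp h₁,
    ((hp.comp h₂).sub (hp.comp h₁)).div (h₂.sub h₁),
    ((hp.comp h₁).sub (hp.comp h₃)).div (h₁.sub h₃)⟩

theorem gap_of_rightLim (hx : x ∈ T.openPart) (h : T.s x < Function.rightLim T.s x) :
    (T.s x, Function.rightLim T.s x) ∈ gapSet T.traceSet := by
  refine ⟨h, s_mem_traceSet hx, mem_closure_of_tendsto (tendsto_rightLim_s hx) ?_, ?_⟩
  · filter_upwards [mem_nhdsWithin_of_mem_nhds (T.isOpen_openPart.mem_nhds hx)] with z hz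
    exact ⟨z, hz, rfl⟩
  · refine closure_minimal ?_ (isClosed_Iic.union isClosed_Ici)
    rintro _ ⟨z, hz, rfl⟩
    rcases le_or_gt z x with hzx | hzx
    · exact Or.inl (T.s_mono hz hx hzx)
    · exact Or.inr (rightLim_s_le hx hz hzx)

theorem gap_of_leftLim (hx : x ∈ T.openPart) (h : Function.leftLim T.s x < T.s x) :
    (Function.leftLim T.s x, T.s x) ∈ gapSet T.traceSet := by
  refine ⟨h, mem_closure_of_tendsto (tendsto_leftLim_s hx) ?_, s_mem_traceSet hx, ?_⟩
  · filter_upwards [mem_nhdsWithin_of_mem_nhds (T.isOpen_openPart.mem_nhds hx)] with z hz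
    exact ⟨z, hz, rfl⟩
  · refine closure_minimal ?_ (isClosed_Iic.union isClosed_Ici)
    rintro _ ⟨z, hz, rfl⟩
    rcases le_or_gt x z with hzx | hzx
    · exact Or.inr (T.s_mono hx hz hzx)
    · exact Or.inl (le_leftLim_s hx hz hzx)

theorem primitive_sub (G : LineL2) (a b : ℝ) :
    primitive 0 0 G b - primitive 0 0 G a = ∫ t in a..b, G t :=
  primitive_isDensity 0 0 G a (mem_univ a) b (mem_univ b)

/-- On the continuous part the scale undoes the generalized inverse. On a jump the averaged density
is the mean of `G` over a gap, which is `G` itself for elements of the trace space. Off the hull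
both sides vanish. The ends of gaps, countably many, and `s(l)`, `s(r)` are discarded. -/
theorem pulled_averaged {G : LineL2} (hG : G ∈ traceSpace T.traceSet) :
    T.pulled (T.averaged G) =ᵐ[volume] G := by
  have hcount := gapSet_countable T.traceSet
  have h₁ : ∀ᵐ y, y ∉ Prod.fst '' gapSet T.traceSet :=
    (hcount.image _).ae_notMem volume
  have h₂ : ∀ᵐ y, y ∉ Prod.snd '' gapSet T.traceSet :=
    (hcount.image _).ae_notMem volume
  filter_upwards [h₁, h₂, ae_eq_average_on_gaps hG, ae_eq_zero_of_notMem_hull hG,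
    ae_ne (T.scale T.l).toReal, ae_ne (T.scale T.r).toReal] with y h₁ h₂ hgap hhull hl hr
  by_cases hy : y ∈ T.valueRange
  · have hqm := quantile_mem hy
    have hs : (T.scale (T.quantile y)).toReal = T.s (T.quantile y) := by
      rw [scale_coe hqm, EReal.toReal_coe]
    rcases mem_parts hy with hyp | hyp | hyp
    · rw [pulled, glue_of_mem_contPart hyp, Function.comp_apply, averaged]
      simp only
      rw [hs, (mem_contPart_iff.1 hyp).2]
    · obtain ⟨h₃, h₄⟩ := (plusPart_fibre hqm).2 ⟨hyp, rfl⟩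
      have hg := gap_of_rightLim hqm (h₃.trans_le h₄)
      have h₅ : y ≠ Function.rightLim T.s (T.quantile y) := fun e => h₂ ⟨_, hg, e.symm⟩
      rw [pulled, glue_of_mem_plusPart hyp, Function.comp_apply, averaged]
      simp only
      rw [hs, ← rightLim_s hqm, primitive_sub, hgap _ hg ⟨h₃, lt_of_le_of_ne h₄ h₅⟩]
    · obtain ⟨h₃, h₄⟩ := (minusPart_fibre hqm).2 ⟨hyp, rfl⟩
      have hg := gap_of_leftLim hqm (h₃.trans_lt h₄)
      have h₅ : Function.leftLim T.s (T.quantile y) ≠ y := fun e => h₁ ⟨_, hg, e⟩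
      rw [pulled, glue_of_mem_minusPart hyp, Function.comp_apply, averaged]
      simp only
      rw [hs, ← leftLim_s hqm, primitive_sub, hgap _ hg ⟨lt_of_le_of_ne h₃ h₅, h₄⟩]
  · rw [pulled, glue_of_notMem hy, hhull]
    rintro ⟨a, ha, b, hb, hay, hyb⟩
    refine hy ⟨lt_of_le_of_ne ?_ fun e => hl ?_, lt_of_le_of_ne ?_ fun e => hr ?_⟩
    · exact (traceSet_subset ha).1.trans (EReal.coe_le_coe_iff.2 hay)
    · rw [e, EReal.toReal_coe]
    · exact (EReal.coe_le_coe_iff.2 hyb).trans (traceSet_subset hb).2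
    · rw [← e, EReal.toReal_coe]

theorem hasDensity_averaged (hH : HasL2Density T.traceSet H)
    (hf : ∀ x ∈ T.openPart, f x = H (T.s x)) :
    T.HasDensity f (T.averaged (density T.traceSet H)) := by
  set G := density T.traceSet H with hG
  have hp := pulled_averaged (T := T) (density_mem T.traceSet H)
  have hm := measurable_averaged (T := T) G
  have hpl : MemLp (T.pulled (T.averaged G)) 2 volume := (memLp_congr_ae hp).2 (Lp.memLp G)
  rw [hasDensity_iff]
  refine ⟨(isSquareIntegrable_iff hm.1.aestronglyMeasurable hm.2.1.aestronglyMeasurable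
    hm.2.2.aestronglyMeasurable).2 ⟨?_, ?_, ?_⟩, H 0, fun x hx => ?_⟩
  · rw [← indicator_congr (f := T.pulled (T.averaged G)) fun y hy => glue_of_mem_contPart hy]
    exact hpl.indicator T.measurableSet_contPart
  · rw [← indicator_congr (f := T.pulled (T.averaged G)) fun y hy => glue_of_mem_plusPart hy]
    exact hpl.indicator T.measurableSet_plusPart
  · rw [← indicator_congr (f := T.pulled (T.averaged G)) fun y hy => glue_of_mem_minusPart hy]
    exact hpl.indicator T.measurableSet_minusPart
  -- The constant is `H 0`, since `0 = s(0)` is a value of the scale.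
  · have h0 : (0 : ℝ) ∈ T.traceSet := by
      simpa [T.s_zero] using s_mem_traceSet T.zero_mem_openPart
    rw [hf x hx, intervalIntegral.integral_congr_ae (g := G) (hp.mono fun y hy _ => hy),
      ← hH.isDensity 0 h0 _ (s_mem_traceSet hx)]
    ring

theorem mem_S_iff : f ∈ T.S ↔
    ∃ H, HasL2Density T.traceSet H ∧ ∀ x ∈ T.openPart, f x = H (T.s x) := by
  constructor
  · rintro ⟨g, hg⟩
    obtain ⟨H, hf, G, -, -, hG⟩ := hg.exists_eq_comp
    exact ⟨H, ⟨G, hG⟩, hf⟩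
  · rintro ⟨H, hH, hf⟩
    exact ⟨_, hasDensity_averaged hH hf⟩

/-- Whatever densities the definition chooses, once pulled to the line they lie in the trace space
and are densities of `H` and `H'`, so uniqueness identifies them with the minimal ones. -/
theorem energy_eq (hH : HasL2Density T.traceSet H) (hH' : HasL2Density T.traceSet H')
    (hf : ∀ x ∈ T.openPart, f x = H (T.s x)) (hf' : ∀ x ∈ T.openPart, f' x = H' (T.s x)) :
    T.energy f f' = (1 / 2) * inner ℝ (density T.traceSet H) (density T.traceSet H') := by
  have hd : ∀ {f H : ℝ → ℝ} {g : Density}, HasL2Density T.traceSet H →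
      (∀ x ∈ T.openPart, f x = H (T.s x)) → T.HasDensity f g →
      density T.traceSet H =ᵐ[volume] T.pulled g := by
    intro f H g hH hf hg
    obtain ⟨K, hfK, G, hGm, hG, hK⟩ := hg.exists_eq_comp
    have he : EqOn H K T.traceSet := HasL2Density.eqOn_traceSet hH ⟨G, hK⟩ fun x hx => by
      rw [← hf x hx, hfK x hx]
    rw [hH.density_congr he, hK.density_eq hGm]
    exact hG
  have h : (∃ a, T.HasDensity f a) ∧ ∃ b, T.HasDensity f' b :=
    ⟨⟨_, hasDensity_averaged hH hf⟩, _, hasDensity_averaged hH' hf'⟩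
  rw [energy, dif_pos h, integral_pulled_mul (hasDensity_iff.1 h.1.choose_spec).1
    (hasDensity_iff.1 h.2.choose_spec).1, LineL2.inner_eq]
  congr 1
  refine integral_congr_ae ?_
  filter_upwards [hd hH hf h.1.choose_spec, hd hH' hf' h.2.choose_spec] with y h₁ h₂
  rw [h₁, h₂]

end ScaleTriple

/-! ### Boundary limits and the maps `f ↦ f̂` and `f ↦ f*` -/

namespace ScaleTriple

variable {T : ScaleTriple} {x y j : ℝ} {f H H' : ℝ → ℝ}

theorem tendsto_of_tendsto_s (hH : HasL2Density T.traceSet H)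
    (hf : ∀ x ∈ T.openPart, f x = H (T.s x)) {F : Filter ℝ} (hj : j ∈ T.traceSet)
    (hF : Tendsto (fun z => (T.s z : EReal)) F (𝓝 (j : EReal))) (hF' : ∀ᶠ z in F, z ∈ T.openPart) :
    Tendsto f F (𝓝 (H j)) := by
  obtain ⟨H₁, he, hd⟩ := hH.exists_extension
  rw [he hj]
  rw [EReal.tendsto_coe] at hF
  refine (hd.continuous.continuousAt.tendsto.comp hF).congr' ?_
  filter_upwards [hF'] with z hz
  rw [Function.comp_apply, hf z hz, he (s_mem_traceSet hz)]

theorem eventually_atLeft : ∀ᶠ z in T.atLeft, z ∈ T.openPart :=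
  preimage_mem_comap (Ioo_mem_nhdsGT T.l_lt_r)

theorem eventually_atRight : ∀ᶠ z in T.atRight, z ∈ T.openPart :=
  preimage_mem_comap (Ioo_mem_nhdsLT T.l_lt_r)

instance : T.atLeft.NeBot := by
  have : (𝓝[>] T.l).NeBot := nhdsGT_neBot_of_exists_gt ⟨T.r, T.l_lt_r⟩
  refine comap_neBot fun t ht => ?_
  obtain ⟨z, hz, hz'⟩ := Filter.nonempty_of_mem (inter_mem ht (Ioo_mem_nhdsGT T.l_lt_r))
  obtain ⟨w, hw, rfl⟩ := exists_mem_openPart hz'.1 hz'.2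
  exact ⟨w, hz⟩

instance : T.atRight.NeBot := by
  have : (𝓝[<] T.r).NeBot := nhdsLT_neBot_of_exists_lt ⟨T.l, T.l_lt_r⟩
  refine comap_neBot fun t ht => ?_
  obtain ⟨z, hz, hz'⟩ := Filter.nonempty_of_mem (inter_mem ht (Ioo_mem_nhdsLT T.l_lt_r))
  obtain ⟨w, hw, rfl⟩ := exists_mem_openPart hz'.1 hz'.2
  exact ⟨w, hz⟩

theorem tendsto_s_atLeft : Tendsto (fun z => (T.s z : EReal)) T.atLeft (𝓝 (T.scale T.l)) := by
  have h : Tendsto (fun z : ℝ => T.scale z) T.atLeft (𝓝 (T.scale T.l)) :=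
    (continuousAt_scale_left.tendsto.mono_left nhdsWithin_le_nhds).comp tendsto_comap
  exact h.congr' (eventually_atLeft.mono fun z hz => scale_coe hz)

theorem tendsto_s_atRight : Tendsto (fun z => (T.s z : EReal)) T.atRight (𝓝 (T.scale T.r)) := by
  have h : Tendsto (fun z : ℝ => T.scale z) T.atRight (𝓝 (T.scale T.r)) :=
    (continuousAt_scale_right.tendsto.mono_left nhdsWithin_le_nhds).comp tendsto_comap
  exact h.congr' (eventually_atRight.mono fun z hz => scale_coe hz)

theorem tendsto_atLeft (hH : HasL2Density T.traceSet H) (hf : ∀ x ∈ T.openPart, f x = H (T.s x))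
    (hj : (j : EReal) = T.scale T.l) : Tendsto f T.atLeft (𝓝 (H j)) :=
  tendsto_of_tendsto_s hH hf (left_mem_traceSet hj) (hj ▸ tendsto_s_atLeft) eventually_atLeft

theorem tendsto_atRight (hH : HasL2Density T.traceSet H) (hf : ∀ x ∈ T.openPart, f x = H (T.s x))
    (hj : (j : EReal) = T.scale T.r) : Tendsto f T.atRight (𝓝 (H j)) :=
  tendsto_of_tendsto_s hH hf (right_mem_traceSet hj) (hj ▸ tendsto_s_atRight) eventually_atRight

theorem tendsto_comap_val (hH : HasL2Density T.traceSet H) (hj : j ∈ T.traceSet) :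
    Tendsto (fun y : T.hatI => H y) (comap Subtype.val (𝓝 j)) (𝓝 (H j)) := by
  obtain ⟨H₁, he, hd⟩ := hH.exists_extension
  rw [he hj, show (fun y : T.hatI => H y) = H₁ ∘ Subtype.val from
    funext fun y => he (hatI_subset y.2)]
  exact hd.continuous.continuousAt.tendsto.comp tendsto_comap

theorem isIotaHat (hH : HasL2Density T.traceSet H) (hf : ∀ x ∈ T.openPart, f x = H (T.s x)) :
    T.IsIotaHat f fun y => H y where
  continuous := hH.continuousOn.comp_continuous continuous_subtype_val fun y => hatI_subset y.2
  limit_left j hj _ := ⟨_, tendsto_comap_val hH (left_mem_traceSet hj)⟩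
  limit_right j hj _ := ⟨_, tendsto_comap_val hH (right_mem_traceSet hj)⟩
  eq_openPart x hx y hy := by rw [hf x hx, hy]
  eq_left _ y hy := tendsto_atLeft hH hf hy
  eq_right _ y hy := tendsto_atRight hH hf hy
  eq_plus x hx y hy := by
    have hx' : x ∈ T.openPart := ne_of_mem_Dplus hx
    refine tendsto_of_tendsto_s hH hf (hatI_subset y.2) (hy ▸ tendsto_s_coe_right hx') ?_
    exact mem_nhdsWithin_of_mem_nhds (T.isOpen_openPart.mem_nhds hx')
  eq_minus x hx y hy := by
    have hx' : x ∈ T.openPart := ne_of_mem_Dminus hx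
    refine tendsto_of_tendsto_s hH hf (hatI_subset y.2) (hy ▸ tendsto_s_coe_left hx') ?_
    exact mem_nhdsWithin_of_mem_nhds (T.isOpen_openPart.mem_nhds hx')

theorem dense_values : Dense {y : T.hatI | ∃ x ∈ T.openPart, (y : ℝ) = T.s x} := by
  intro y
  rw [mem_closure_iff]
  rintro _ ⟨W, hW, rfl⟩ hy
  have hyh : (y : ℝ) ∈ T.traceSet \ T.missing := (hatI_eq (T := T)).le y.2
  obtain ⟨_, ⟨hzW, hzm⟩, z, hz, rfl⟩ := mem_closure_iff.1 hyh.1 (W \ T.missing)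
    (hW.sdiff finite_missing.isClosed) ⟨hy, hyh.2⟩
  exact ⟨⟨T.s z, (hatI_eq (T := T)).ge ⟨s_mem_traceSet hz, hzm⟩⟩, hzW, z, hz, rfl⟩

/-- The restriction of `H` satisfies the conditions on `f̂`, and they determine `f̂`: it is
continuous and prescribed at the values of the scale, which are dense in `Î`. -/
theorem iotaHat_eq (hH : HasL2Density T.traceSet H) (hf : ∀ x ∈ T.openPart, f x = H (T.s x)) :
    T.iotaHat f = fun y : T.hatI => H y := by
  have h : ∃ f', T.IsIotaHat f f' := ⟨_, isIotaHat hH hf⟩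
  rw [iotaHat, dif_pos h]
  refine h.choose_spec.continuous.ext_on dense_values (isIotaHat hH hf).continuous ?_
  rintro y ⟨x, hx, hy⟩
  rw [h.choose_spec.eq_openPart x hx y hy]
  change f x = H y
  rw [hf x hx, hy]

theorem iotaStar_eq (hH : HasL2Density T.traceSet H) (hf : ∀ x ∈ T.openPart, f x = H (T.s x)) :
    T.iotaStar f = fun p : T.IStar => H (T.sStar p).toReal := by
  ext p
  have h : (T.sStar p).toReal ∈ T.hatI := by
    rw [← range_toReal_sStar]
    exact mem_range_self p
  rw [iotaStar, dif_pos h, iotaHat_eq hH hf]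

/-! ### The functions on `I₀` -/

theorem left_mem_I₀_iff : T.l ∈ T.I₀ ↔ T.LeftReflecting :=
  ⟨fun h => h.2.1 rfl, fun h => ⟨⟨le_rfl, T.l_lt_r.le⟩, fun _ => h, fun e => (T.l_lt_r.ne e).elim⟩⟩

theorem right_mem_I₀_iff : T.r ∈ T.I₀ ↔ T.RightReflecting :=
  ⟨fun h => h.2.2 rfl, fun h => ⟨⟨T.l_lt_r.le, le_rfl⟩, fun e => (T.l_lt_r.ne' e).elim, fun _ => h⟩⟩

theorem coe_toReal_scale_left (h : T.LeftApproachable) :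
    ((T.scale T.l).toReal : EReal) = T.scale T.l :=
  EReal.coe_toReal scale_left_ne_top h

theorem coe_toReal_scale_right (h : T.RightApproachable) :
    ((T.scale T.r).toReal : EReal) = T.scale T.r :=
  EReal.coe_toReal h scale_right_ne_bot

theorem coe_toReal_scale {x : EReal} (hx : x ∈ T.I₀) :
    ((T.scale x).toReal : EReal) = T.scale x := by
  rcases T.eq_left_or_right_or_coe x with h | h | ⟨y, hy, rfl⟩
  · have e := le_antisymm h hx.1.1
    rw [e]
    exact coe_toReal_scale_left (hx.2.1 e).1.1
  · have e := le_antisymm hx.1.2 h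
    rw [e]
    exact coe_toReal_scale_right (hx.2.2 e).1.1
  · rw [scale_coe hy, EReal.toReal_coe]

theorem extendEnds_eq (hH : HasL2Density T.traceSet H) (hf : ∀ x ∈ T.openPart, f x = H (T.s x))
    {x : EReal} (hx : x ∈ T.I₀) : T.extendEnds f x = H (T.scale x).toReal := by
  rcases T.eq_left_or_right_or_coe x with h | h | ⟨y, hy, rfl⟩
  · have e := le_antisymm h hx.1.1
    rw [extendEnds, if_pos h, e]
    exact (tendsto_atLeft hH hf (coe_toReal_scale_left (hx.2.1 e).1.1)).limUnder_eq
  · have e := le_antisymm hx.1.2 h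
    rw [extendEnds, if_neg (not_le.2 (T.l_lt_r.trans_le h)), if_pos h, e]
    exact (tendsto_atRight hH hf (coe_toReal_scale_right (hx.2.2 e).1.1)).limUnder_eq
  · rw [extendEnds, if_neg (not_le.2 hy.1), if_neg (not_le.2 hy.2), EReal.toReal_coe, hf y hy,
      scale_coe hy, EReal.toReal_coe]

/-- The points of `I₀` that the scale maps to `Î`. -/
def carrier (T : ScaleTriple) : Set T.I₀ := {x | (T.scale x).toReal ∈ T.hatI}

/-- A point of `I₀` off the carrier is on the level of a non-reflecting endpoint, as happens when
the scale is constant next to it. There the function vanishes, so the mass of `m` at such points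
plays no role. -/
theorem extendEnds_eq_indicator (hH : HasL2Density T.traceSet H)
    (hf : ∀ x ∈ T.openPart, f x = H (T.s x)) (h0 : ∀ y ∈ T.traceSet \ T.hatI, H y = 0) :
    (fun x : T.I₀ => T.extendEnds f x) =
      T.carrier.indicator fun x : T.I₀ => H (T.scale x).toReal := by
  ext x
  rw [extendEnds_eq hH hf x.2]
  by_cases hx : x ∈ T.carrier
  · rw [indicator_of_mem hx]
  · rw [indicator_of_notMem hx]
    exact h0 _ ⟨mem_traceSet_of_scale_eq (coe_toReal_scale x.2).symm, hx⟩

theorem vanishing_iff (hH : HasL2Density T.traceSet H) (hf : ∀ x ∈ T.openPart, f x = H (T.s x)) :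
    (∀ y ∈ T.traceSet \ T.hatI, H y = 0) ↔
      (T.l ∉ T.I₀ → T.LeftApproachable → Tendsto f T.atLeft (𝓝 0)) ∧
      (T.r ∉ T.I₀ → T.RightApproachable → Tendsto f T.atRight (𝓝 0)) := by
  rw [left_mem_I₀_iff, right_mem_I₀_iff]
  constructor
  · refine fun h => ⟨fun hn ha => ?_, fun hn ha => ?_⟩
    · have hj := coe_toReal_scale_left ha
      have := tendsto_atLeft hH hf hj
      rwa [h _ ⟨left_mem_traceSet hj, fun hc => hn ((mem_hatI_iff.1 hc).2.1 hj)⟩] at this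
    · have hj := coe_toReal_scale_right ha
      have := tendsto_atRight hH hf hj
      rwa [h _ ⟨right_mem_traceSet hj, fun hc => hn ((mem_hatI_iff.1 hc).2.2 hj)⟩] at this
  · rintro ⟨hl, hr⟩ y ⟨hy, hyn⟩
    have hm : y ∈ T.missing := by_contra fun h => hyn (hatI_eq ▸ ⟨hy, h⟩)
    rcases hm with ⟨he, hn⟩ | ⟨he, hn⟩
    · refine tendsto_nhds_unique (tendsto_atLeft hH hf he) (hl hn ?_)
      rw [LeftApproachable, ← he]
      exact EReal.coe_ne_bot y
    · refine tendsto_nhds_unique (tendsto_atRight hH hf he) (hr hn ?_)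
      rw [RightApproachable, ← he]
      exact EReal.coe_ne_top y

theorem measurableSet_I₀ : MeasurableSet T.I₀ := by
  have : T.I₀ = T.I \ {x | (x = T.l ∧ ¬T.LeftReflecting) ∨ (x = T.r ∧ ¬T.RightReflecting)} := by
    ext x
    simp only [I₀, mem_ofPred_eq, Set.mem_sdiff]
    tauto
  rw [this]
  refine measurableSet_Icc.diff (Finite.measurableSet ((toFinite {T.l, T.r}).subset ?_))
  rintro x (⟨h, -⟩ | ⟨h, -⟩)
  · exact Or.inl h
  · exact Or.inr h

section Embedding

variable {X : Type*} [TopologicalSpace X] [MeasurableSpace X] [BorelSpace X] {ι : X → ℝ}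

/-- An endpoint of `I` with scale value in `Î` is reflecting and so belongs to `I₀`; hence no mass
over `Î` is lost in restricting `m` to `I₀`. -/
theorem isTracePullback (hι : IsEmbedding ι) (hr : range ι = T.hatI) :
    IsTracePullback T.traceSet ι ((T.m.map T.scale).comap fun x => (ι x : EReal)) T.carrier
      (fun x => (T.scale x).toReal) T.m₀ := by
  have hΨ : Measurable fun x : T.I₀ => (T.scale x).toReal :=
    measurable_ereal_toReal.comp (scale_mono.measurable.comp measurable_subtype_coe)
  have hA : MeasurableSet T.carrier := hΨ measurableSet_hatI
  refine ⟨hA, hΨ, fun x hx => hatI_subset hx, ?_⟩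
  ext B hB
  rw [Measure.map_apply hΨ hB, Measure.restrict_apply (hΨ hB),
    Measure.map_apply hι.continuous.measurable hB, comap_apply hι hr hB, m₀,
    (MeasurableEmbedding.subtype_coe measurableSet_I₀).comap_apply]
  refine le_antisymm (measure_mono ?_) ?_
  · rintro _ ⟨x, ⟨hxB, hxA⟩, rfl⟩
    exact ⟨_, ⟨hxB, hxA⟩, coe_toReal_scale x.2⟩
  · have hnull : T.m (T.scale ⁻¹' (Real.toEReal '' (B ∩ T.hatI)) \ Icc T.l T.r) = 0 :=
      measure_mono_null (t := (Icc T.l T.r)ᶜ) (fun w hw => hw.2) T.m_compl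
    rw [← measure_inter_add_sdiff _ (measurableSet_Icc (a := T.l) (b := T.r)), hnull, add_zero]
    refine measure_mono ?_
    rintro x ⟨⟨y, ⟨hyB, hyh⟩, he⟩, hxI⟩
    have hy := (mem_hatI_iff.1 hyh).2
    have hx : x ∈ T.I₀ := ⟨hxI, fun e => hy.1 (by rw [he, e]), fun e => hy.2 (by rw [he, e])⟩
    have he' : (T.scale x).toReal = y := by rw [← he, EReal.toReal_coe]
    refine ⟨⟨x, hx⟩, ⟨?_, ?_⟩, rfl⟩
    · change (T.scale x).toReal ∈ B
      rwa [he']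
    · change (T.scale x).toReal ∈ T.hatI
      rwa [he']

variable {ν : Measure X} (h : IsTraceEmbedding T.traceSet ι ν) (hr : range ι = T.hatI)
  (hP : IsTracePullback T.traceSet ι ν T.carrier (fun x => (T.scale x).toReal) T.m₀)

include h hr hP

theorem mem_F_iff (hH : HasL2Density T.traceSet H) (hf : ∀ x ∈ T.openPart, f x = H (T.s x)) :
    f ∈ T.F ↔ H ∈ traceDomain T.traceSet ι ν := by
  have hv := vanishing_iff hH hf
  have hS : f ∈ T.S := mem_S_iff.2 ⟨H, hH, hf⟩
  constructor
  · rintro ⟨-, hm, hc⟩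
    have h0 := hv.2 hc
    rw [extendEnds_eq_indicator hH hf h0, hP.memLp_iff h hH] at hm
    exact ⟨hH, by rwa [hr], hm⟩
  · rintro ⟨-, h0, hm⟩
    rw [hr] at h0
    refine ⟨hS, ?_, hv.1 h0⟩
    rwa [extendEnds_eq_indicator hH hf h0, hP.memLp_iff h hH]

theorem exists_mem_traceDomain (hf : f ∈ T.F) :
    ∃ H ∈ traceDomain T.traceSet ι ν, ∀ x ∈ T.openPart, f x = H (T.s x) := by
  obtain ⟨H, hH, hfH⟩ := mem_S_iff.1 hf.1
  exact ⟨H, (mem_F_iff h hr hP hH hfH).1 hf, hfH⟩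

/-- A realization of the functions in `ℱ` that only depends on the corresponding functions of the
scale yields a form with values `½ ∫ G G'`. -/
theorem ofFunctions_energy_eq {Y : Type*} [MeasurableSpace Y] {μ : Measure Y}
    {ev ev' : (ℝ → ℝ) → Y → ℝ}
    (hev : ∀ f, ∀ H ∈ traceDomain T.traceSet ι ν, (∀ x ∈ T.openPart, f x = H (T.s x)) →
      ev f = ev' H)
    (hinj : ∀ H ∈ traceDomain T.traceSet ι ν, ∀ H' ∈ traceDomain T.traceSet ι ν,
      ev' H =ᵐ[μ] ev' H' → EqOn H H' T.traceSet) :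
    L2Form.ofFunctions μ T.F ev T.energy =
      L2Form.ofFunctions μ (traceDomain T.traceSet ι ν) ev'
        fun H H' => (1 / 2) * inner ℝ (density T.traceSet H) (density T.traceSet H') := by
  have hcomp : ∀ f ∈ T.F, ∀ H ∈ traceDomain T.traceSet ι ν, ev f =ᵐ[μ] ev' H →
      ∀ x ∈ T.openPart, f x = H (T.s x) := by
    intro f hf H hH he x hx
    obtain ⟨K, hK, hfK⟩ := exists_mem_traceDomain h hr hP hf
    rw [hev f K hK hfK] at he
    rw [hfK x hx, hinj K hK H hH he (s_mem_traceSet hx)]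
  refine L2Form.ofFunctions_congr (fun f hf => ?_) (fun H hH => ?_) ?_
  · obtain ⟨H, hH, hfH⟩ := exists_mem_traceDomain h hr hP hf
    exact ⟨H, hH, by rw [hev f H hH hfH]⟩
  · refine ⟨H ∘ T.s, (mem_F_iff h hr hP hH.1 fun _ _ => rfl).2 hH, ?_⟩
    rw [hev (H ∘ T.s) H hH fun _ _ => rfl]
  · intro f hf H hH he f' hf' H' hH' he'
    exact energy_eq hH.1 hH'.1 (hcomp f hf H hH he) (hcomp f' hf' H' hH' he')

theorem wideForm_eq : T.wideForm =
    pullbackForm T.traceSet ι ν T.carrier (fun x => (T.scale x).toReal) T.m₀ := by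
  refine ofFunctions_energy_eq h hr hP (fun f H hH hf => ?_) fun H hH H' hH' he =>
    hP.eqOn_of_ae_eq h hH.1 hH'.1 he
  refine extendEnds_eq_indicator hH.1 hf ?_
  rw [← hr]
  exact hH.2.1

end Embedding

theorem isTracePullback_val : IsTracePullback T.traceSet (Subtype.val : T.hatI → ℝ) T.hatM T.carrier
    (fun x => (T.scale x).toReal) T.m₀ :=
  isTracePullback .subtypeVal Subtype.range_val

theorem isTracePullback_sStar : IsTracePullback T.traceSet
    (fun p : T.IStar => (T.sStar p).toReal) T.mStar T.carrier
    (fun x => (T.scale x).toReal) T.m₀ := by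
  have h := isTracePullback (T := T) isEmbedding_toReal_sStar range_toReal_sStar
  simp only [coe_toReal_sStar] at h
  exact h

theorem hatForm_eq (hDK : T.DK) (hDM : T.DM) :
    T.hatForm = traceForm T.traceSet Subtype.val T.hatM := by
  have h := isTraceEmbedding_val hDK hDM
  exact ofFunctions_energy_eq h Subtype.range_val isTracePullback_val
    (fun f H hH hf => iotaHat_eq hH.1 hf) fun H hH H' hH' he => h.eqOn_of_ae_eq hH.1 hH'.1 he

theorem starForm_eq (hDK : T.DK) (hDM : T.DM) :
    T.starForm = traceForm T.traceSet (fun p : T.IStar => (T.sStar p).toReal) T.mStar := by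
  have h := isTraceEmbedding_sStar hDK hDM
  exact ofFunctions_energy_eq h range_toReal_sStar isTracePullback_sStar
    (fun f H hH hf => iotaStar_eq hH.1 hf) fun H hH H' hH' he => h.eqOn_of_ae_eq hH.1 hH'.1 he

/-! ### The domain and the energy on `Î` -/

/-- `Î` and `traceSet` differ at most in `s(l)` and `s(r)`, which are not in the open interval. The
ends of a component lie in `traceSet`: inside because they are not in the open set, and at finite
`s(l)` or `s(r)` always. -/
theorem gaps_eq : T.gaps = gapSet T.traceSet := by
  ext ⟨a, b⟩
  have hO : ∀ y : ℝ, (T.scale T.l < (y : EReal) ∧ (y : EReal) < T.scale T.r ∧ y ∉ T.hatI) ↔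
      y ∈ T.valueRange ∧ y ∉ T.traceSet := by
    intro y
    rw [← and_assoc]
    refine and_congr_right fun hy => not_congr ⟨fun h => hatI_subset h, fun h => ?_⟩
    exact mem_hatI_iff.2 ⟨h, fun e => (hy.1.ne' e).elim, fun e => (hy.2.ne e).elim⟩
  simp only [gaps, IsComponentInterval, mem_ofPred_eq, hO]
  constructor
  · rintro ⟨hab, hsub, ha, hb⟩
    have hsub' : Ioo a b ⊆ T.valueRange := fun y hy => (hsub hy).1
    have hla : T.scale T.l ≤ a := by
      by_contra! h
      obtain ⟨c, hc, hc'⟩ := EReal.lt_iff_exists_real_btwn.1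
        (lt_min h (EReal.coe_lt_coe_iff.2 hab))
      rw [lt_min_iff] at hc'
      exact lt_asymm (hsub' ⟨EReal.coe_lt_coe_iff.1 hc, EReal.coe_lt_coe_iff.1 hc'.2⟩).1 hc'.1
    have hbr : (b : EReal) ≤ T.scale T.r := by
      by_contra! h
      obtain ⟨c, hc, hc'⟩ := EReal.lt_iff_exists_real_btwn.1
        (max_lt h (EReal.coe_lt_coe_iff.2 hab))
      rw [max_lt_iff] at hc
      exact lt_asymm (hsub' ⟨EReal.coe_lt_coe_iff.1 hc.2, EReal.coe_lt_coe_iff.1 hc'⟩).2 hc.1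
    refine ⟨hab, ?_, ?_, fun c hc => ?_⟩
    · by_contra haC
      rcases hla.eq_or_lt with e | hlt
      · exact haC (left_mem_traceSet e.symm)
      · exact ha ⟨⟨hlt, (EReal.coe_lt_coe_iff.2 hab).trans_le hbr⟩, haC⟩
    · by_contra hbC
      rcases hbr.eq_or_lt with e | hlt
      · exact hbC (right_mem_traceSet e)
      · exact hb ⟨⟨hla.trans_lt (EReal.coe_lt_coe_iff.2 hab), hlt⟩, hbC⟩
    · by_contra! hcc
      exact (hsub hcc).2 hc
  · intro hg
    have hg' := hg
    obtain ⟨hab, ha, hb, hC⟩ := hg'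
    refine ⟨hab, fun y hy => ⟨gap_subset_valueRange hg hy, fun hyC => ?_⟩, fun h => h.2 ha,
      fun h => h.2 hb⟩
    rcases hC y hyC with h | h
    · exact not_lt.2 h hy.1
    · exact not_lt.2 h hy.2

theorem hatF_eq (hDK : T.DK) (hDM : T.DM) :
    T.hatF = {f | f ∈ T.hatS ∧ MemLp f 2 T.hatM ∧
      (∀ j : ℝ, (j : EReal) = T.scale T.l → j ∉ T.hatI →
        Tendsto f (comap Subtype.val (𝓝 j)) (𝓝 0)) ∧
      (∀ j : ℝ, (j : EReal) = T.scale T.r → j ∉ T.hatI →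
        Tendsto f (comap Subtype.val (𝓝 j)) (𝓝 0))} := by
  have h := isTraceEmbedding_val hDK hDM
  have hP := isTracePullback_val (T := T)
  ext f'
  constructor
  · rintro ⟨f, hf, rfl⟩
    obtain ⟨H, hH, hfH⟩ := exists_mem_traceDomain h Subtype.range_val hP hf
    have h0 := hH.2.1
    rw [Subtype.range_val] at h0
    refine ⟨⟨f, hf.1, rfl⟩, ?_, fun j hj hjn => ?_, fun j hj hjn => ?_⟩
    · rw [iotaHat_eq hH.1 hfH]
      exact hH.2.2
    · rw [iotaHat_eq hH.1 hfH, ← h0 j ⟨left_mem_traceSet hj, hjn⟩]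
      exact tendsto_comap_val hH.1 (left_mem_traceSet hj)
    · rw [iotaHat_eq hH.1 hfH, ← h0 j ⟨right_mem_traceSet hj, hjn⟩]
      exact tendsto_comap_val hH.1 (right_mem_traceSet hj)
  · rintro ⟨⟨f, hf, rfl⟩, hm, hl, hr⟩
    obtain ⟨H, hH, hfH⟩ := mem_S_iff.1 hf
    rw [iotaHat_eq hH hfH] at hm hl hr
    refine ⟨f, (mem_F_iff h Subtype.range_val hP hH hfH).2 ⟨hH, ?_, hm⟩, rfl⟩
    rw [Subtype.range_val]
    rintro y ⟨hy, hyn⟩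
    -- By DK a missing point is a limit of points of `Î`, so the limit of `f̂` there is the value of
    -- `H`.
    have : (comap (Subtype.val : T.hatI → ℝ) (𝓝 y)).NeBot :=
      mem_closure_iff_comap_neBot.1 (traceSet_subset_closure hDK hy)
    have hmis : y ∈ T.missing := by_contra fun h => hyn (hatI_eq ▸ ⟨hy, h⟩)
    rcases hmis with ⟨he, -⟩ | ⟨he, -⟩
    · exact tendsto_nhds_unique (tendsto_comap_val hH hy) (hl y he hyn)
    · exact tendsto_nhds_unique (tendsto_comap_val hH hy) (hr y he hyn)

theorem hatForm_energy (hDK : T.DK) (hDM : T.DM) {f : T.hatI → ℝ} (hf : f ∈ T.hatF)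
    (hf' : MemLp f 2 T.hatM) :
    (∀ᵐ x ∂volume.restrict T.hatI, DifferentiableWithinAt ℝ (T.zeroExtend f) T.hatI x) ∧
      IntegrableOn (fun x => derivWithin (T.zeroExtend f) T.hatI x ^ 2) T.hatI ∧
      Summable (fun g : T.gaps =>
        (T.zeroExtend f g.1.1 - T.zeroExtend f g.1.2) ^ 2 / |g.1.2 - g.1.1|) ∧
      T.hatForm.form (hf'.toLp f) (hf'.toLp f) =
        (1 / 2) * (∫ x in T.hatI, derivWithin (T.zeroExtend f) T.hatI x ^ 2) +
        (1 / 2) * ∑' g : T.gaps,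
          (T.zeroExtend f g.1.1 - T.zeroExtend f g.1.2) ^ 2 / |g.1.2 - g.1.1| := by
  have h := isTraceEmbedding_val hDK hDM
  obtain ⟨f₀, hf₀, rfl⟩ := hf
  obtain ⟨H, hH, hfH⟩ := exists_mem_traceDomain h Subtype.range_val isTracePullback_val hf₀
  have h0 := hH.2.1
  rw [Subtype.range_val] at h0
  have hfin := h.finite
  rw [Subtype.range_val] at hfin
  -- The default value `0` of the extension is the value of `H` at the missing points.
  have hz : EqOn (T.zeroExtend (T.iotaHat f₀)) H T.traceSet := by
    intro y hy
    rw [iotaHat_eq hH.1 hfH, zeroExtend]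
    by_cases hyh : y ∈ T.hatI
    · exact Subtype.val_injective.extend_apply (fun y : T.hatI => H y) 0 ⟨y, hyh⟩
    · rw [Function.extend_apply' _ _ _ (by rintro ⟨z, rfl⟩; exact hyh z.2), h0 y ⟨hy, hyh⟩]
      rfl
  obtain ⟨h₁, h₂, h₃⟩ := IsTraceEmbedding.energy_formula h.isClosed hatI_subset hfin hH.1
    (hz.mono hatI_subset)
  have h₄ : HasSum (fun g : T.gaps => (T.zeroExtend (T.iotaHat f₀) g.1.1 -
      T.zeroExtend (T.iotaHat f₀) g.1.2) ^ 2 / |g.1.2 - g.1.1|)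
      (inner ℝ (density T.traceSet H) (density T.traceSet H) -
        ∫ x in T.hatI, derivWithin (T.zeroExtend (T.iotaHat f₀)) T.hatI x ^ 2) := by
    rw [gaps_eq]
    convert h₃ using 2 with g
    rw [hz g.2.2.1, hz g.2.2.2.1, abs_of_pos (sub_pos.2 g.2.1)]
    ring
  refine ⟨h₁, h₂, h₄.summable, ?_⟩
  have hu : hf'.toLp (T.iotaHat f₀) =ᵐ[T.hatM] fun y : T.hatI => H y := by
    refine hf'.coeFn_toLp.trans ?_
    rw [iotaHat_eq hH.1 hfH]
  rw [h₄.tsum_eq, hatForm_eq hDK hDM, h.traceForm_form hH hH hu hu]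
  ring

end ScaleTriple

end

/-! ### The theorem, assembled from the trace forms on `I*` and `Î` -/

theorem theorem3p5 (T : ScaleTriple) (hDK : T.DK) (hDM : T.DM) :
    -- (1) fully supported Radon measures
    ((T.mStar.Regular ∧ T.mStar.IsOpenPosMeasure) ∧
      (T.hatM.Regular ∧ T.hatM.IsOpenPosMeasure)) ∧
    -- (2) the regularization
    ((∀ f ∈ T.F, MemLp (T.iotaStar f) 2 T.mStar) ∧
      T.starForm.IsRegularDirichletForm ∧ T.starForm.IsIrreducible ∧
      T.wideForm.IsRegularRepresentation T.starForm) ∧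
    -- (3) the image regularization
    (T.hatForm.IsRegularDirichletForm ∧ T.hatForm.IsIrreducible ∧
      T.hatF = {f | f ∈ T.hatS ∧ MemLp f 2 T.hatM ∧
        (∀ j : ℝ, (j : EReal) = T.scale T.l → j ∉ T.hatI →
          Tendsto f (comap Subtype.val (𝓝 j)) (𝓝 0)) ∧
        (∀ j : ℝ, (j : EReal) = T.scale T.r → j ∉ T.hatI →
          Tendsto f (comap Subtype.val (𝓝 j)) (𝓝 0))} ∧
      (∀ f ∈ T.hatF, ∀ hf : MemLp f 2 T.hatM,
        (∀ᵐ x ∂volume.restrict T.hatI, DifferentiableWithinAt ℝ (T.zeroExtend f) T.hatI x) ∧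
        IntegrableOn (fun x => derivWithin (T.zeroExtend f) T.hatI x ^ 2) T.hatI ∧
        Summable (fun g : T.gaps =>
          (T.zeroExtend f g.1.1 - T.zeroExtend f g.1.2) ^ 2 / |g.1.2 - g.1.1|) ∧
        T.hatForm.form (hf.toLp f) (hf.toLp f) =
          (1 / 2) * (∫ x in T.hatI, derivWithin (T.zeroExtend f) T.hatI x ^ 2) +
          (1 / 2) * ∑' g : T.gaps,
            (T.zeroExtend f g.1.1 - T.zeroExtend f g.1.2) ^ 2 / |g.1.2 - g.1.1|) ∧
      T.wideForm.IsRegularRepresentation T.hatForm) := by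
  have hh := ScaleTriple.isTraceEmbedding_val hDK hDM
  have hs := ScaleTriple.isTraceEmbedding_sStar hDK hDM
  have hhP := ScaleTriple.isTracePullback_val (T := T)
  have hsP := ScaleTriple.isTracePullback_sStar (T := T)
  refine ⟨⟨⟨hs.regular, hs.open_pos⟩, hh.regular, hh.open_pos⟩, ⟨fun f hf => ?_, ?_, ?_, ?_⟩,
    ?_, ?_, ScaleTriple.hatF_eq hDK hDM, fun f hf hf' => ScaleTriple.hatForm_energy hDK hDM hf hf',
    ?_⟩
  · obtain ⟨H, hH, hfH⟩ :=
      ScaleTriple.exists_mem_traceDomain hs ScaleTriple.range_toReal_sStar hsP hf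
    rw [ScaleTriple.iotaStar_eq hH.1 hfH]
    exact hH.2.2
  · rw [ScaleTriple.starForm_eq hDK hDM]
    exact hs.isRegularDirichletForm
  · rw [ScaleTriple.starForm_eq hDK hDM]
    exact hs.isIrreducible
  · rw [ScaleTriple.starForm_eq hDK hDM,
      ScaleTriple.wideForm_eq hs ScaleTriple.range_toReal_sStar hsP]
    exact hsP.isRegularRepresentation hs
  · rw [ScaleTriple.hatForm_eq hDK hDM]
    exact hh.isRegularDirichletForm
  · rw [ScaleTriple.hatForm_eq hDK hDM]
    exact hh.isIrreducible
  · rw [ScaleTriple.hatForm_eq hDK hDM, ScaleTriple.wideForm_eq hh Subtype.range_val hhP]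
    exact hhP.isRegularRepresentation hh
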